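/- Conventions. A map is a continuous function; $f\colon[-1,1]\to[-1,1]$ is piecewise-linear if there are $-1=c_0<c_1<\dots<c_n=1$ such that $f$ is linear (affine) on each $[c_{i-1},c_i]$. For a map $g\colon[0,1]\to[-1,1]$ with $g(0)=0$, a departure of $g$ is a number $x\in(0,1]$ with $g(x)\notin g([0,x))$; it is positively (negatively) oriented if $g(x)>0$ ($g(x)<0$). A contour point of $g$ is a departure $\alpha$ such that for every departure $x>\alpha$ there is a departure $y$ with $\alpha<y\le x$ whose orientation is opposite to that of $\alpha$. If $g$ is piecewise-linear and non-constant, let $0<\alpha_1<\dots<\alpha_n$ be its contour points and put $\alpha_0=0$; the contour factor of $g$ is the map $t_g\colon[0,1]\to[-1,1]$ with $t_g(i/n)=g(\alpha_i)$ for $i=0,\dots,n$ that is linear in between these points. For a piecewise-linear $f\colon[-1,1]\to[-1,1]$ with $f(0)=0$ that is non-constant on each of $[-1,0]$ and $[0,1]$, the radial contour factor of $f$ is the map $t_f\colon[-1,1]\to[-1,1]$ whose restriction to $[0,1]$ is the contour factor of $f|_{[0,1]}$ and for which $x\mapsto t_f(-x)$, $x\in[0,1]$, is the contour factor of $x\mapsto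 f(-x)$, $x\in[0,1]$. A negative radial departure of a map $h\colon[-1,1]\to[-1,1]$ with $h(0)=0$ is a pair $\langle x_1,x_2\rangle$ with $-1\le x_1<0<x_2\le1$ and $h((x_1,x_2))=(h(x_2),h(x_1))$ (open intervals). Lemma. Let $f_1,f_2,f_3\colon[-1,1]\to[-1,1]$ be piecewise-linear maps with $f_1(0)=f_2(0)=f_3(0)=0$, each non-constant on $[-1,0]$ and on $[0,1]$, such that $t_{f_1}=t_{f_1\circ f_2}$ and $t_{f_2}=t_{f_2\circ f_3}$ (where the compositions are also non-constant on $[-1,0]$ and on $[0,1]$, so that these radial contour factors are defined). Then there exists a map $\tilde s\colon[-1,1]\to[-1,1]$ with $\tilde s(0)=0$ such that 1. $t_{f_1}\circ\tilde s=f_1\circ f_2$; and 2. $\tilde s\circ t_{f_3}$ has no negative radial departures. -/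

import Mathlib

open Set

namespace RadialContour

/-- `f` restricts to a piecewise-linear map `[-1,1] → ℝ`: there is a partition
`-1 = c 0 < c 1 < ⋯ < c n = 1` such that `f` is affine on each closed interval
`[c i, c (i+1)]`. Continuity on `[-1,1]` follows. -/
def PiecewiseLinear (f : ℝ → ℝ) : Prop :=
  ∃ (n : ℕ) (c : ℕ → ℝ), c 0 = -1 ∧ c n = 1 ∧ (∀ i < n, c i < c (i + 1)) ∧
    ∀ i < n, ∃ a b : ℝ, ∀ x ∈ Icc (c i) (c (i + 1)), f x = a * x + b

/-- The maps under consideration: `f` (restricted to `[-1,1]`) is a piecewise-linear map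
`[-1,1] → [-1,1]` with `f 0 = 0` that is non-constant on `[-1,0]` and on `[0,1]`. -/
structure IsPLMap (f : ℝ → ℝ) : Prop where
  mapsTo : MapsTo f (Icc (-1) 1) (Icc (-1) 1)
  piecewiseLinear : PiecewiseLinear f
  map_zero : f 0 = 0
  nonconst_left : ∃ x ∈ Icc (-1 : ℝ) 0, ∃ y ∈ Icc (-1 : ℝ) 0, f x ≠ f y
  nonconst_right : ∃ x ∈ Icc (0 : ℝ) 1, ∃ y ∈ Icc (0 : ℝ) 1, f x ≠ f y

/-- `x` is a departure of `g` (regarded as a map on `[0,1]`). -/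
def IsDeparture (g : ℝ → ℝ) (x : ℝ) : Prop :=
  0 < x ∧ x ≤ 1 ∧ g x ∉ g '' Ico 0 x

/-- `x` and `y` have opposite orientations: one of `g x`, `g y` is positive and the other
is negative. (A departure is positively oriented if its value is positive, and negatively
oriented if its value is negative.) -/
def OppositeOrientation (g : ℝ → ℝ) (x y : ℝ) : Prop :=
  (0 < g x ∧ g y < 0) ∨ (g x < 0 ∧ 0 < g y)

/-- `α` is a (nonzero) contour point of `g` (regarded as a map on `[0,1]`): a departure such that
every later departure `x` is preceded by, or equal to, a departure `y > α` whose orientation is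
opposite to that of `α`. -/
def IsContourPoint (g : ℝ → ℝ) (α : ℝ) : Prop :=
  IsDeparture g α ∧ ∀ x, IsDeparture g x → α < x →
    ∃ y, IsDeparture g y ∧ OppositeOrientation g α y ∧ α < y ∧ y ≤ x

/-- The number `n` of nonzero contour points of `g` (a finite number for piecewise-linear `g`). -/
noncomputable def numContourPoints (g : ℝ → ℝ) : ℕ :=
  {α | IsContourPoint g α}.ncard

/-- The increasing enumeration `0 = α_0 < α_1 < ⋯ < α_n` of the contour points of `g`:
`α_{k+1}` is the least contour point greater than `α_k` (only meaningful for `k < n`). -/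
noncomputable def contourPoint (g : ℝ → ℝ) : ℕ → ℝ
  | 0 => 0
  | k + 1 => sInf {α | IsContourPoint g α ∧ contourPoint g k < α}

/-- The contour factor `t_g` of `g` on `[0,1]`: it takes the value `g (α_k)` at `k / n` for
`k = 0, …, n`, and is linear in between. For `k / n ≤ x < (k+1) / n` we have `k = ⌊n x⌋`; at `x = 1`
the second summand vanishes. -/
noncomputable def contourFactor (g : ℝ → ℝ) (x : ℝ) : ℝ :=
  let y : ℝ := numContourPoints g * x
  let k : ℕ := ⌊y⌋₊
  (1 - (y - k)) * g (contourPoint g k) + (y - k) * g (contourPoint g (k + 1))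

/-- The radial contour factor `t_f` of `f` on `[-1,1]`: on `[0,1]` it is the contour factor of `f`
restricted to `[0,1]`, and on `[-1,0]` it is the reflection of the contour factor of the
map `x ↦ f (-x)` on `[0,1]`. -/
noncomputable def radialContourFactor (f : ℝ → ℝ) (x : ℝ) : ℝ :=
  if 0 ≤ x then contourFactor f x else contourFactor (fun u => f (-u)) (-x)

/-- `⟨x₁, x₂⟩` is a negative (negatively oriented) radial departure of `f : [-1,1] → [-1,1]`. -/
def IsNegRadialDeparture (f : ℝ → ℝ) (x₁ x₂ : ℝ) : Prop :=
  -1 ≤ x₁ ∧ x₁ < 0 ∧ 0 < x₂ ∧ x₂ ≤ 1 ∧ f '' Ioo x₁ x₂ = Ioo (f x₂) (f x₁)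

end RadialContour

namespace RadialContour

/-! ### Running extrema -/

/-! On one side of `0`, call the images of the intervals `[0, x]` the hulls of a map; they form an
increasing chain of intervals. A contour factor is a zigzag with the same chain as the map it comes
from (`ZData.chain`), and a path whose hulls all belong to the chain of a zigzag lifts through that
zigzag (`Zig.lift`). Hence, with `T` the radial contour factor of `f₁`, one has `f₁ = T ∘ s₁`, and
`q = s₁ ∘ f₂` satisfies `T ∘ q = f₁ ∘ f₂`. The freedom left is to replace `q` by another `s` with `T
∘ s = T ∘ q`.

Let `t` be the radial contour factor of `f₃` and suppose that `s ∘ t` has a negative departure.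
Inside it `t` avoids its own end values, so `t` departs too (`departure_split`). If `t` departs
positively, `s` has a negative departure. If `t` departs negatively, `s` has a positive departure
over an interval `[c, d]` in which hulls of `q` reaching across `0` agree with one-sided hulls of
`q`; this is where equality of the factors of `f₂` and `f₂ ∘ f₃` enters (`nwin_of_swap`). The map
`q` has no departures of the second kind (`NWin.not_posDep`), so the task is to remove the first
kind without creating the second (`Compat.exists_no_negDep`).

On each side of `0`, the hulls of `T ∘ s` are hulls of `T` on the same side. At a negative departure
of `s` the left path reaches its positive end value before going as low as the right end value, and
the right path does the reverse. This forces a left hull of `T` to coincide with a right hull. A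
maximal run of coincidences is a band `[-p, r]` with inner marks `-A` and `e` (`exists_nband`); the
departure has end values in `(e, r]` and `[-p, -A)`. Over a band, `T` folds onto either half
(`exists_fold`). Applying one of the folds to part of `q`, during the time window in which `q` stays
in the band, removes the departures belonging to the band. One choice of fold may create a forbidden
positive departure, but both cannot, essentially because the two folds cannot cross (`no_cross`,
`exists_good`). Bands are nested (`NBand.nested`) and their marks `e` are break points of `T`, so
treating them in decreasing order of `e` ends after finitely many patches (`Stage.patch`). -/

/-- The running maximum of `h` over `[0, y]`. -/
noncomputable def hi (h : ℝ → ℝ) (y : ℝ) : ℝ :=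
  sSup ((fun t => h (t * max y 0)) '' Icc (0 : ℝ) 1)

/-- The running depth of `h` over `[0, y]`: minus its minimum. -/
noncomputable def dp (h : ℝ → ℝ) (y : ℝ) : ℝ := hi (fun x => - h x) y

section hi

variable {h : ℝ → ℝ}

lemma cneg (hc : Continuous h) : Continuous fun x => - h x := hc.neg

lemma dp_neg (h : ℝ → ℝ) (y : ℝ) : dp (fun x => - h x) y = hi h y := by
  simp [dp]

lemma hi_neg (h : ℝ → ℝ) (y : ℝ) : hi (fun x => - h x) y = dp h y := rfl

lemma hi_image {y : ℝ} (hy : 0 ≤ y) :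
    (fun t => h (t * max y 0)) '' Icc (0 : ℝ) 1 = h '' Icc 0 y := by
  rw [max_eq_left hy]
  ext z
  constructor
  · rintro ⟨t, ht, rfl⟩
    exact ⟨t * y, ⟨mul_nonneg ht.1 hy, by nlinarith [ht.2]⟩, rfl⟩
  · rintro ⟨x, hx, rfl⟩
    rcases hy.eq_or_lt with rfl | hy
    · refine ⟨0, by simp, ?_⟩
      have : x = 0 := le_antisymm hx.2 hx.1
      simp [this]
    · refine ⟨x / y, ⟨div_nonneg hx.1 hy.le, (div_le_one hy).2 hx.2⟩, ?_⟩
      simp [div_mul_cancel₀ x hy.ne']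

/-- Rescaling `[0, y]` to `[0, 1]` turns the running maximum into a supremum over a fixed compact
set. -/
lemma hi_continuous (hc : Continuous h) : Continuous (hi h) := by
  have := isCompact_Icc (a := (0 : ℝ)) (b := 1) |>.continuous_sSup
    (f := fun y t => h (t * max y 0)) (by fun_prop)
  exact this

lemma hi_eq {y : ℝ} (hy : 0 ≤ y) : hi h y = sSup (h '' Icc 0 y) := by
  rw [hi, hi_image hy]

lemma le_hi (hc : Continuous h) {x y : ℝ} (hx : 0 ≤ x) (hxy : x ≤ y) : h x ≤ hi h y := by
  rw [hi_eq (hx.trans hxy)]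
  exact le_csSup (isCompact_Icc.image hc).bddAbove ⟨x, ⟨hx, hxy⟩, rfl⟩

lemma exists_hi (hc : Continuous h) {y : ℝ} (hy : 0 ≤ y) : ∃ x ∈ Icc 0 y, h x = hi h y := by
  rw [hi_eq hy]
  obtain ⟨x, hx, hx'⟩ := (isCompact_Icc.image hc).sSup_mem ((nonempty_Icc.2 hy).image h)
  exact ⟨x, hx, hx'⟩

lemma hi_le (hc : Continuous h) {y c : ℝ} (hy : 0 ≤ y) (H : ∀ x ∈ Icc 0 y, h x ≤ c) :
    hi h y ≤ c := by
  obtain ⟨x, hx, e⟩ := exists_hi hc hy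
  exact e ▸ H x hx

lemma hi_of_nonpos {y : ℝ} (hy : y ≤ 0) : hi h y = h 0 := by
  rw [hi, max_eq_right hy]
  simp [(nonempty_Icc.2 (zero_le_one (α := ℝ))).image_const]

lemma hi_mono (hc : Continuous h) : Monotone (hi h) := by
  intro x y hxy
  rcases le_total 0 x with hx | hx
  · exact hi_le hc hx fun z hz => le_hi hc hz.1 (hz.2.trans hxy)
  · rw [hi_of_nonpos hx]
    rcases le_total 0 y with hy | hy
    · exact le_hi hc le_rfl hy
    · rw [hi_of_nonpos hy]

lemma hi_nonneg (hc : Continuous h) (h0 : h 0 = 0) (y : ℝ) : 0 ≤ hi h y := by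
  rcases le_total 0 y with hy | hy
  · exact h0 ▸ le_hi hc le_rfl hy
  · rw [hi_of_nonpos hy, h0]

lemma hi_eq_of_new (hc : Continuous h) {y : ℝ} (hy : 0 ≤ y) (H : ∀ x ∈ Ico 0 y, hi h x < hi h y) :
    h y = hi h y := by
  obtain ⟨x, hx, e⟩ := exists_hi hc hy
  rcases hx.2.eq_or_lt with rfl | hlt
  · exact e
  · exact absurd (le_hi hc hx.1 le_rfl) (not_le.2 (e ▸ H x ⟨hx.1, hlt⟩))

lemma hi_congr {g : ℝ → ℝ} {y : ℝ} (hy : 0 ≤ y) (H : EqOn h g (Icc 0 y)) : hi h y = hi g y := by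
  rw [hi_eq hy, hi_eq hy, H.image_eq]

lemma dp_congr {g : ℝ → ℝ} {y : ℝ} (hy : 0 ≤ y) (H : EqOn h g (Icc 0 y)) : dp h y = dp g y :=
  hi_congr hy fun x hx => by simp [H hx]

lemma dp_continuous (hc : Continuous h) : Continuous (dp h) := hi_continuous (cneg hc)

lemma dp_mono (hc : Continuous h) : Monotone (dp h) := hi_mono (cneg hc)

lemma neg_dp_le (hc : Continuous h) {x y : ℝ} (hx : 0 ≤ x) (hxy : x ≤ y) : - dp h y ≤ h x := by
  have := le_hi (cneg hc) hx hxy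
  rw [dp]; linarith

lemma exists_dp (hc : Continuous h) {y : ℝ} (hy : 0 ≤ y) : ∃ x ∈ Icc 0 y, h x = - dp h y := by
  obtain ⟨x, hx, e⟩ := exists_hi (cneg hc) hy
  exact ⟨x, hx, by rw [dp, ← e]; ring⟩

lemma dp_le (hc : Continuous h) {y c : ℝ} (hy : 0 ≤ y) (H : ∀ x ∈ Icc 0 y, -c ≤ h x) :
    dp h y ≤ c :=
  hi_le (cneg hc) hy fun x hx => by have := H x hx; linarith

lemma dp_nonneg (hc : Continuous h) (h0 : h 0 = 0) (y : ℝ) : 0 ≤ dp h y :=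
  hi_nonneg (cneg hc) (by simp [h0]) y

lemma dp_of_nonpos {y : ℝ} (hy : y ≤ 0) : dp h y = - h 0 := hi_of_nonpos hy

lemma dp_eq_of_new (hc : Continuous h) {y : ℝ} (hy : 0 ≤ y) (H : ∀ x ∈ Ico 0 y, dp h x < dp h y) :
    h y = - dp h y := by
  have := hi_eq_of_new (cneg hc) hy H
  rw [dp]; linarith

/-- By the intermediate value theorem a hull is determined by the two numbers `dp` and `hi`; this
lets chains of hulls be treated as pairs of monotone functions. -/
lemma image_Icc_eq (hc : Continuous h) {y : ℝ} (hy : 0 ≤ y) :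
    h '' Icc 0 y = Icc (- dp h y) (hi h y) := by
  apply Subset.antisymm
  · rintro _ ⟨x, hx, rfl⟩
    exact ⟨neg_dp_le hc hx.1 hx.2, le_hi hc hx.1 hx.2⟩
  · obtain ⟨x, hx, ex⟩ := exists_dp hc hy
    obtain ⟨z, hz, ez⟩ := exists_hi hc hy
    rw [← ex, ← ez]
    exact ((isPreconnected_Icc.image h hc.continuousOn).ordConnected).out ⟨x, hx, rfl⟩ ⟨z, hz, rfl⟩

end hi

/-! ### Zigzag data -/

/-- The points `0 = α 0 < ⋯ < α n ≤ 1` carry the successive extreme values of `h`. -/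
structure ZData (h : ℝ → ℝ) (α : ℕ → ℝ) (n : ℕ) : Prop where
  one_le : 1 ≤ n
  zero : α 0 = 0
  lt : ∀ k < n, α k < α (k + 1)
  le_one : α n ≤ 1
  bd : ∀ k < n, ∀ x ∈ Icc 0 (α (k + 1)), h x ∈ uIcc (h (α k)) (h (α (k + 1)))
  new : ∀ k < n, ∀ x ∈ Ico 0 (α (k + 1)), h x ≠ h (α (k + 1))
  top : ∀ x ∈ Icc (0 : ℝ) 1, ∃ x' ∈ Icc 0 (α n), h x = h x'

namespace ZData

variable {h : ℝ → ℝ} {α : ℕ → ℝ} {n : ℕ}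

lemma neg (Z : ZData h α n) : ZData (fun x => - h x) α n where
  one_le := Z.one_le
  zero := Z.zero
  lt := Z.lt
  le_one := Z.le_one
  bd k hk x hx := by
    have := Z.bd k hk x hx
    rw [mem_uIcc] at this ⊢
    rcases this with h | h
    · right; constructor <;> linarith [h.1, h.2]
    · left; constructor <;> linarith [h.1, h.2]
  new k hk x hx := by
    have := Z.new k hk x hx
    intro h; exact this (neg_injective h)
  top x hx := by
    obtain ⟨x', h1, h2⟩ := Z.top x hx
    exact ⟨x', h1, by simp [h2]⟩

lemma mono (Z : ZData h α n) {j k : ℕ} (hk : k ≤ n) (hjk : j ≤ k) : α j ≤ α k := by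
  induction k, hjk using Nat.le_induction with
  | base => exact le_rfl
  | succ k _ ih => exact (ih (by omega)).trans (Z.lt k (by omega)).le

lemma nonneg (Z : ZData h α n) {k : ℕ} (hk : k ≤ n) : 0 ≤ α k := Z.zero ▸ Z.mono hk (Nat.zero_le k)

lemma le_one' (Z : ZData h α n) {k : ℕ} (hk : k ≤ n) : α k ≤ 1 := (Z.mono le_rfl hk).trans Z.le_one

lemma hi_succ (Z : ZData h α n) (hc : Continuous h) {k : ℕ} (hk : k < n) :
    hi h (α (k + 1)) = max (h (α k)) (h (α (k + 1))) := by
  have h0 := Z.nonneg (k := k) (by omega)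
  have h1 := (Z.lt k hk).le
  apply le_antisymm
  · exact hi_le hc (h0.trans h1) fun x hx => (Z.bd k hk x hx).2
  · exact max_le (le_hi hc h0 h1) (le_hi hc (h0.trans h1) le_rfl)

lemma dp_succ (Z : ZData h α n) (hc : Continuous h) {k : ℕ} (hk : k < n) :
    dp h (α (k + 1)) = max (-h (α k)) (-h (α (k + 1))) := Z.neg.hi_succ (cneg hc) hk

lemma hi_top (Z : ZData h α n) (hc : Continuous h) {y : ℝ} (hy : α n ≤ y) (hy1 : y ≤ 1) :
    hi h y = hi h (α n) := by
  have h0 := Z.nonneg le_rfl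
  apply le_antisymm _ (hi_mono hc hy)
  refine hi_le hc (h0.trans hy) fun x hx => ?_
  obtain ⟨x', h1, h2⟩ := Z.top x ⟨hx.1, hx.2.trans hy1⟩
  exact h2 ▸ le_hi hc h1.1 h1.2

lemma dp_top (Z : ZData h α n) (hc : Continuous h) {y : ℝ} (hy : α n ≤ y) (hy1 : y ≤ 1) :
    dp h y = dp h (α n) := Z.neg.hi_top (cneg hc) hy hy1

lemma exists_piece (Z : ZData h α n) {y : ℝ} (h0 : 0 ≤ y) (hy : y ≤ α n) :
    ∃ k < n, α k ≤ y ∧ y ≤ α (k + 1) := by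
  have : ∀ m ≤ n, y ≤ α m → 1 ≤ m → ∃ k < n, α k ≤ y ∧ y ≤ α (k + 1) := by
    intro m
    induction m with
    | zero => intro _ _ h; omega
    | succ m ih =>
      intro hm hym _
      by_cases h : α m ≤ y
      · exact ⟨m, by omega, h, hym⟩
      · rcases Nat.eq_zero_or_pos m with rfl | hpos
        · rw [Z.zero] at h; exact absurd h0 h
        · exact ih (by omega) (not_le.1 h).le hpos
  exact this n le_rfl hy Z.one_le

variable {t : ℝ → ℝ} {β : ℕ → ℝ}

/-- The hull at a node is spanned by the last two extreme values, so equal extreme values give equal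
hulls. -/
lemma same_at (Z : ZData h α n) (hc : Continuous h) (Y : ZData t β n) (tc : Continuous t)
    (hv : ∀ k ≤ n, h (α k) = t (β k)) {k : ℕ} (hk : k ≤ n) :
    dp h (α k) = dp t (β k) ∧ hi h (α k) = hi t (β k) := by
  cases k with
  | zero =>
    have := hv 0 (by omega)
    rw [Z.zero, Y.zero] at this
    rw [Z.zero, Y.zero, hi_of_nonpos le_rfl, hi_of_nonpos le_rfl, dp_of_nonpos le_rfl,
      dp_of_nonpos le_rfl, this]
    exact ⟨rfl, rfl⟩
  | succ k =>
    rw [Z.hi_succ hc hk, Z.dp_succ hc hk, Y.hi_succ tc hk, Y.dp_succ tc hk, hv _ hk,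
      hv k (by omega)]
    exact ⟨rfl, rfl⟩

/-- On a descending piece the maximum is frozen and only the depth grows; matching the depth by the
intermediate value theorem matches the whole hull. -/
lemma chain_aux (Z : ZData h α n) (hc : Continuous h) (Y : ZData t β n) (tc : Continuous t)
    (hv : ∀ k ≤ n, h (α k) = t (β k)) {y : ℝ} {k : ℕ} (hk : k < n) (h1 : α k ≤ y)
    (h2 : y ≤ α (k + 1)) (hd : h (α (k + 1)) ≤ h (α k)) :
    ∃ y' ∈ Icc (0 : ℝ) 1, dp h y = dp t y' ∧ hi h y = hi t y' := by
  obtain ⟨d0, u0⟩ := same_at Z hc Y tc hv hk.le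
  obtain ⟨d1, u1⟩ := same_at Z hc Y tc hv (k := k + 1) hk
  have hdy := dp_mono hc h1
  have hdy' := dp_mono hc h2
  obtain ⟨y', hy', e⟩ := intermediate_value_Icc (Y.lt k hk).le (dp_continuous tc).continuousOn
    (show dp h y ∈ Icc (dp t (β k)) (dp t (β (k + 1))) by rw [← d0, ← d1]; exact ⟨hdy, hdy'⟩)
  refine ⟨y', ⟨(Y.nonneg hk.le).trans hy'.1, hy'.2.trans (Y.le_one' hk)⟩, e.symm, ?_⟩
  have hu : ∀ (g : ℝ → ℝ) (γ : ℕ → ℝ), ZData g γ n → Continuous g → g (γ (k + 1)) ≤ g (γ k) →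
      ∀ z ∈ Icc (γ k) (γ (k + 1)), hi g z = g (γ k) := by
    intro g γ G gc hg z hz
    apply le_antisymm
    · refine (hi_mono gc hz.2).trans ?_
      rw [G.hi_succ gc hk, max_eq_left hg]
    · exact le_hi gc (G.nonneg hk.le) hz.1
  rw [hu h α Z hc hd y ⟨h1, h2⟩, hu t β Y tc (by rw [← hv k hk.le, ← hv _ hk]; exact hd) y' hy',
    hv k hk.le]

/-- The chain of hulls is determined by the successive extreme values. -/
lemma chain (Z : ZData h α n) (hc : Continuous h) (Y : ZData t β n) (tc : Continuous t)
    (hv : ∀ k ≤ n, h (α k) = t (β k)) {y : ℝ} (hy : y ∈ Icc (0 : ℝ) 1) :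
    ∃ y' ∈ Icc (0 : ℝ) 1, dp h y = dp t y' ∧ hi h y = hi t y' := by
  rcases le_total y (α n) with hyn | hyn
  · obtain ⟨k, hk, h1, h2⟩ := Z.exists_piece hy.1 hyn
    rcases le_total (h (α (k + 1))) (h (α k)) with hd | hd
    · exact chain_aux Z hc Y tc hv hk h1 h2 hd
    · obtain ⟨y', hy', e1, e2⟩ := chain_aux Z.neg (cneg hc) Y.neg (cneg tc) (by simpa using hv) hk h1 h2
        (by simpa using hd)
      rw [dp_neg, dp_neg] at e1
      exact ⟨y', hy', e2, e1⟩
  · obtain ⟨d1, u1⟩ := same_at Z hc Y tc hv le_rfl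
    exact ⟨β n, ⟨Y.nonneg le_rfl, Y.le_one⟩, by rw [Z.dp_top hc hyn hy.2, d1],
      by rw [Z.hi_top hc hyn hy.2, u1]⟩

end ZData

/-- A zigzag: the successive extreme values are taken at the break points `β k`, with affine pieces
in between. -/
structure Zig (t : ℝ → ℝ) (β : ℕ → ℝ) (n : ℕ) : Prop extends ZData t β n where
  last : β n = 1
  affine : ∀ k < n, ∀ x ∈ Icc (β k) (β (k + 1)),
    (t x - t (β k)) * (β (k + 1) - β k) = (t (β (k + 1)) - t (β k)) * (x - β k)

namespace Zig

variable {t : ℝ → ℝ} {β : ℕ → ℝ} {n : ℕ}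

lemma neg (Z : Zig t β n) : Zig (fun x => - t x) β n where
  toZData := Z.toZData.neg
  last := Z.last
  affine k hk x hx := by have := Z.affine k hk x hx; linarith

lemma ne_succ (Z : Zig t β n) {k : ℕ} (hk : k < n) : t (β k) ≠ t (β (k + 1)) :=
  Z.new k hk (β k) ⟨Z.nonneg hk.le, Z.lt k hk⟩

lemma anti_piece (Z : Zig t β n) {k : ℕ} (hk : k < n) (hd : t (β (k + 1)) < t (β k)) {x y : ℝ}
    (hx : β k ≤ x) (hxy : x < y) (hy : y ≤ β (k + 1)) : t y < t x := by
  have e1 := Z.affine k hk x ⟨hx, hxy.le.trans hy⟩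
  have e2 := Z.affine k hk y ⟨hx.trans hxy.le, hy⟩
  have hb := sub_pos.2 (Z.lt k hk)
  by_contra hcon
  rw [not_lt] at hcon
  nlinarith [mul_nonneg (sub_nonneg.2 hcon) hb.le, mul_pos (sub_pos.2 hd) (sub_pos.2 hxy)]

lemma new' (Z : Zig t β n) {k : ℕ} (hk : k ≤ n) {x : ℝ} (h0 : 0 ≤ x) (hx : x < β k) :
    t x ≠ t (β k) := by
  cases k with
  | zero => rw [Z.zero] at hx; linarith
  | succ k => exact Z.new k hk x ⟨h0, hx⟩

/-- Two points with the same hull lie in one piece, the first part of which moves inward. -/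
lemma level (Z : Zig t β n) (tc : Continuous t) {y₁ y₂ : ℝ} (h0 : 0 ≤ y₁) (hlt : y₁ < y₂)
    (h1 : y₂ ≤ 1) (hd : dp t y₁ = dp t y₂) (hu : hi t y₁ = hi t y₂) :
    (t y₂ < t y₁ ∧ (∃ z ∈ Icc 0 y₁, dp t z = dp t y₁ ∧ hi t z = hi t y₁ ∧
        ∀ y ∈ Ico 0 z, hi t y < hi t y₁) ∧
        ∃ y ∈ Icc (0 : ℝ) 1, dp t y₁ < dp t y ∧ hi t y = hi t y₁) ∨
    (t y₁ < t y₂ ∧ (∃ z ∈ Icc 0 y₁, dp t z = dp t y₁ ∧ hi t z = hi t y₁ ∧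
        ∀ y ∈ Ico 0 z, dp t y < dp t y₁) ∧
        ∃ y ∈ Icc (0 : ℝ) 1, hi t y₁ < hi t y ∧ dp t y = dp t y₁) := by
  have main : ∀ s : ℝ → ℝ, Zig s β n → Continuous s → dp s y₁ = dp s y₂ → hi s y₁ = hi s y₂ →
      ∀ k < n, β k ≤ y₁ → y₂ ≤ β (k + 1) → s (β (k + 1)) < s (β k) →
      (s y₂ < s y₁ ∧ (∃ z ∈ Icc 0 y₁, dp s z = dp s y₁ ∧ hi s z = hi s y₁ ∧
        ∀ y ∈ Ico 0 z, hi s y < hi s y₁) ∧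
        ∃ y ∈ Icc (0 : ℝ) 1, dp s y₁ < dp s y ∧ hi s y = hi s y₁) := by
    intro s S sc hd hu k hk hk1 hk2 hdec
    have hlt' := S.anti_piece hk hdec hk1 hlt hk2
    have hk0 := S.nonneg hk.le
    have hu1 : hi s y₁ = s (β k) := by
      apply le_antisymm
      · refine (hi_mono sc (hlt.le.trans hk2)).trans ?_
        rw [S.hi_succ sc hk, max_eq_left hdec.le]
      · exact le_hi sc hk0 hk1
    refine ⟨hlt', ⟨β k, ⟨hk0, hk1⟩, ?_, ?_, ?_⟩, β (k + 1), ⟨S.nonneg hk, S.le_one' hk⟩, ?_, ?_⟩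
    · apply le_antisymm (dp_mono sc hk1)
      obtain ⟨x, hx, ex⟩ := exists_dp sc h0
      rcases le_or_gt x (β k) with hxk | hxk
      · have := neg_dp_le sc hx.1 hxk
        linarith
      · exfalso
        have h3 := S.anti_piece hk hdec hxk.le (hx.2.trans_lt hlt) hk2
        have h4 := neg_dp_le sc (h0.trans hlt.le) (le_refl y₂)
        linarith
    · apply le_antisymm (hi_mono sc hk1)
      rw [hu1]; exact le_hi sc hk0 le_rfl
    · intro y hy
      rw [hu1]
      obtain ⟨x, hx, ex⟩ := exists_hi sc hy.1
      have hxk := hx.2.trans_lt hy.2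
      have := S.new' hk.le hx.1 hxk
      rw [← ex]
      refine lt_of_le_of_ne ?_ this
      rw [← hu1]; exact le_hi sc hx.1 (hxk.le.trans hk1)
    · obtain ⟨x, hx, ex⟩ := exists_dp sc h0
      have hx2 : x < β (k + 1) := hx.2.trans_lt (hlt.trans_le hk2)
      have h3 := S.new k hk x ⟨hx.1, hx2⟩
      have h4 := S.bd k hk x ⟨hx.1, hx2.le⟩
      rw [uIcc_of_ge hdec.le] at h4
      have h5 := lt_of_le_of_ne h4.1 h3.symm
      have h6 := neg_dp_le sc (S.nonneg hk) (le_refl (β (k + 1)))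
      linarith
    · rw [S.hi_succ sc hk, max_eq_left hdec.le, hu1]
  obtain ⟨k, hk, hk1, hk2⟩ : ∃ k < n, β k < y₂ ∧ y₂ ≤ β (k + 1) := by
    have hP : ∃ m, m ≤ n ∧ y₂ ≤ β m := ⟨n, le_rfl, by rw [Z.last]; exact h1⟩
    classical
    have hm := Nat.find_spec hP
    have hm0 : Nat.find hP ≠ 0 := by
      intro h
      rw [h, Z.zero] at hm
      linarith [hm.2]
    obtain ⟨k, hk⟩ := Nat.exists_eq_succ_of_ne_zero hm0
    rw [hk] at hm
    refine ⟨k, hm.1, ?_, hm.2⟩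
    by_contra hcon
    exact Nat.find_min hP (m := k) (by omega) ⟨by omega, not_lt.1 hcon⟩
  -- The value at `β k` is new there, yet it lies in the common hull of `y₁` and `y₂`, so it has
  -- been taken by time `y₁`.
  have hk3 : β k ≤ y₁ := by
    by_contra hcon
    rw [not_le] at hcon
    have : t (β k) ∈ t '' Icc 0 y₁ := by
      rw [image_Icc_eq tc h0, hd, hu]
      exact ⟨neg_dp_le tc (Z.nonneg hk.le) hk1.le, le_hi tc (Z.nonneg hk.le) hk1.le⟩
    obtain ⟨x, hx, ex⟩ := this
    exact Z.new' hk.le hx.1 (hx.2.trans_lt hcon) ex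
  rcases lt_or_gt_of_ne (Z.ne_succ hk) with hinc | hdec
  · right
    have := main _ Z.neg (cneg tc) (by rw [dp_neg, dp_neg]; exact hu) hd k hk hk3 hk2 (by simpa using hinc)
    simpa [dp_neg, hi_neg, and_comm, and_left_comm, and_assoc] using this
  · left
    exact main t Z tc hd hu k hk hk3 hk2 hdec

/-- A point where the running maximum stops increasing is a break point. -/
lemma vertex (Z : Zig t β n) (tc : Continuous t) {e M : ℝ} (h0 : 0 ≤ e) (heM : e < M) (hM : M ≤ 1)
    (hu : hi t e = hi t M) (hnew : ∀ y ∈ Ico 0 e, hi t y < hi t e) : ∃ k ≤ n, e = β k := by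
  have he := hi_eq_of_new tc h0 hnew
  obtain ⟨k, hk, hk1, hk2⟩ := Z.exists_piece h0 (by rw [Z.last]; linarith)
  rcases hk1.eq_or_lt with h | h
  · exact ⟨k, hk.le, h.symm⟩
  rcases hk2.eq_or_lt with h' | h'
  · exact ⟨k + 1, hk, h'⟩
  exfalso
  rcases lt_or_gt_of_ne (Z.ne_succ hk) with hinc | hdec
  · have h1 := Z.neg.anti_piece hk (by simpa using hinc) hk1 (show e < min M (β (k + 1)) from lt_min heM h')
      (min_le_right _ _)
    have h2 := le_hi tc (x := min M (β (k + 1))) (y := M) (le_min (h0.trans heM.le) (Z.nonneg hk))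
      (min_le_left _ _)
    linarith
  · have h1 := Z.anti_piece hk hdec le_rfl h hk2
    have h2 := hnew (β k) ⟨Z.nonneg hk.le, h⟩
    have h3 := le_hi tc (Z.nonneg hk.le) (le_refl (β k))
    linarith

/-- Paths whose hulls are hulls of a zigzag lift to it. -/
lemma lift (Z : Zig t β n) (tc : Continuous t) (j : ℕ) (hj : j ≤ n) :
    ∀ Y : ℝ, 0 ≤ Y → Y ≤ β j → (∀ x ∈ Ico 0 Y, t x ≠ t Y) → ∀ L : ℝ, 0 ≤ L → ∀ h : ℝ → ℝ,
    Continuous h → h 0 = 0 →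
    (∀ s ∈ Icc 0 L, ∃ y ∈ Icc 0 Y, h '' Icc 0 s = t '' Icc 0 y) →
    ∃ θ : ℝ → ℝ, ContinuousOn θ (Icc 0 L) ∧ MapsTo θ (Icc 0 L) (Icc 0 Y) ∧ θ 0 = 0 ∧
      ∀ s ∈ Icc 0 L, t (θ s) = h s := by
  induction j with
  | zero =>
    intro Y hY0 hY _ L hL h hc h0 H
    have hY' : Y = 0 := le_antisymm (hY.trans_eq Z.zero) hY0
    subst hY'
    refine ⟨fun _ => 0, continuousOn_const, fun _ _ => by simp, rfl, fun s hs => ?_⟩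
    obtain ⟨y, hy, e⟩ := H s hs
    have : h s ∈ t '' Icc 0 y := e ▸ ⟨s, ⟨hs.1, le_rfl⟩, rfl⟩
    obtain ⟨x, hx, ex⟩ := this
    have : x = 0 := le_antisymm (hx.2.trans hy.2) hx.1
    rw [← ex, this]
  | succ j ih =>
    intro Y hY0 hY hrec L hL h hc h0 H
    have hjn : j < n := hj
    rcases le_or_gt Y (β j) with hYj | hYj
    · exact ih hjn.le Y hY0 hYj hrec L hL h hc h0 H
    have hb0 := Z.nonneg hjn.le
    have hbrec : ∀ x ∈ Ico 0 (β j), t x ≠ t (β j) := fun x hx => Z.new' hjn.le hx.1 hx.2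
    by_cases hhit : ∃ s ∈ Icc 0 L, h s = t (β j)
    swap
    · refine (ih hjn.le (β j) hb0 le_rfl hbrec L hL h hc h0 fun s hs => ?_).imp
        fun θ hθ => ⟨hθ.1, fun s hs => ⟨(hθ.2.1 hs).1, (hθ.2.1 hs).2.trans hYj.le⟩, hθ.2.2⟩
      obtain ⟨y, hy, e⟩ := H s hs
      refine ⟨y, ⟨hy.1, ?_⟩, e⟩
      by_contra hcon
      have : t (β j) ∈ h '' Icc 0 s := e ▸ ⟨β j, ⟨hb0, (not_le.1 hcon).le⟩, rfl⟩
      obtain ⟨x, hx, ex⟩ := this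
      exact hhit ⟨x, ⟨hx.1, hx.2.trans hs.2⟩, ex⟩
    -- At `s₀` the path first takes the value of the vertex `β j`. Up to then the hulls come from
    -- `[0, β j]` and the induction hypothesis lifts the path.
    · obtain ⟨s₀, ⟨hs₀, es₀⟩, hfirst⟩ : ∃ s₀, (s₀ ∈ Icc 0 L ∧ h s₀ = t (β j)) ∧
          ∀ s ∈ Ico 0 s₀, h s ≠ t (β j) := by
        have hcomp : IsCompact (Icc 0 L ∩ h ⁻¹' {t (β j)}) :=
          isCompact_Icc.inter_right (isClosed_singleton.preimage hc)
        obtain ⟨s, hs⟩ := hhit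
        obtain ⟨s₀, hs₀, hm⟩ := hcomp.exists_isLeast ⟨s, hs⟩
        refine ⟨s₀, hs₀, fun s hs hcon => ?_⟩
        exact absurd (hm ⟨⟨hs.1, hs.2.le.trans hs₀.1.2⟩, hcon⟩) (not_le.2 hs.2)
      have hbefore : ∀ s ∈ Ico 0 s₀, ∃ y ∈ Icc 0 (β j), h '' Icc 0 s = t '' Icc 0 y := by
        intro s hs
        obtain ⟨y, hy, e⟩ := H s ⟨hs.1, hs.2.le.trans hs₀.2⟩
        refine ⟨y, ⟨hy.1, ?_⟩, e⟩
        by_contra hcon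
        have : t (β j) ∈ h '' Icc 0 s := e ▸ ⟨β j, ⟨hb0, (not_le.1 hcon).le⟩, rfl⟩
        obtain ⟨x, hx, ex⟩ := this
        exact hfirst x ⟨hx.1, hx.2.trans_lt hs.2⟩ ex
      obtain ⟨θ, hθc, hθm, hθ0, hθ⟩ := ih hjn.le (β j) hb0 le_rfl hbrec s₀ hs₀.1 h hc h0 (by
        intro s hs
        rcases hs.2.lt_or_eq with hlt | rfl
        · exact hbefore s ⟨hs.1, hlt⟩
        · refine ⟨β j, ⟨hb0, le_rfl⟩, Subset.antisymm ?_ ?_⟩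
          · rintro _ ⟨x, hx, rfl⟩
            rcases hx.2.lt_or_eq with hlt | rfl
            · obtain ⟨y, hy, e⟩ := hbefore x ⟨hx.1, hlt⟩
              have : h x ∈ t '' Icc 0 y := e ▸ ⟨x, ⟨hx.1, le_rfl⟩, rfl⟩
              exact image_mono (Icc_subset_Icc_right hy.2) this
            · exact ⟨β j, ⟨hb0, le_rfl⟩, es₀.symm⟩
          · obtain ⟨y, hy, e⟩ := H s hs₀
            rw [e]
            apply image_mono (Icc_subset_Icc_right _)
            by_contra hcon
            have : h s ∈ t '' Icc 0 y := e ▸ ⟨s, ⟨hs.1, le_rfl⟩, rfl⟩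
            obtain ⟨x, hx, ex⟩ := this
            exact hbrec x ⟨hx.1, hx.2.trans_lt (not_le.1 hcon)⟩ (ex.trans es₀))
      -- The lift is at the vertex itself, since the zigzag does not take this value earlier. From
      -- here on the affine last piece can be inverted.
      have hθs : θ s₀ = β j := by
        have h1 := hθm (show s₀ ∈ Icc 0 s₀ from ⟨hs₀.1, le_rfl⟩)
        by_contra hne
        exact hbrec _ ⟨h1.1, lt_of_le_of_ne h1.2 hne⟩ ((hθ s₀ ⟨hs₀.1, le_rfl⟩).trans es₀)
      set b := β j with hb
      set v := t b with hv
      set c := (t (β (j + 1)) - v) / (β (j + 1) - b) with hcdef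
      have hbpos : 0 < β (j + 1) - b := sub_pos.2 (Z.lt j hjn)
      have hc0 : c ≠ 0 := div_ne_zero (sub_ne_zero.2 (Z.ne_succ hjn).symm) hbpos.ne'
      have haff : ∀ x ∈ Icc b (β (j + 1)), t x = v + c * (x - b) := by
        intro x hx
        have := Z.affine j hjn x hx
        rw [hcdef]; field_simp; linarith
      -- the range of the zigzag up to `Y`
      have hrange : ∀ x ∈ Icc 0 Y, t x ∈ uIcc v (t Y) := by
        intro x hx
        have hbd := Z.bd j hjn x ⟨hx.1, hx.2.trans hY⟩
        rw [← hb, ← hv] at hbd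
        have hYv : t Y = v + c * (Y - b) := haff Y ⟨hYj.le, hY⟩
        have hlast : t (β (j + 1)) = v + c * (β (j + 1) - b) := haff _ ⟨(Z.lt j hjn).le, le_rfl⟩
        rcases hx.2.eq_or_lt with rfl | hxY
        · exact right_mem_uIcc
        have hconn : ∀ z ∈ uIcc (t x) v, z ≠ t Y := by
          intro z hz hcon
          have : z ∈ t '' Ico 0 Y :=
            (isPreconnected_Ico.image t tc.continuousOn).ordConnected.uIcc_subset
              ⟨x, ⟨hx.1, hxY⟩, rfl⟩ ⟨b, ⟨hb0, hYj⟩, rfl⟩ hz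
          obtain ⟨w, hw, ew⟩ := this
          exact hrec w hw (ew.trans hcon)
        rw [mem_uIcc]
        rcases lt_or_gt_of_ne hc0 with hneg | hpos
        · right
          have h1 : t Y < v := by rw [hYv]; nlinarith [sub_pos.2 hYj]
          have h2 : t (β (j + 1)) < v := by rw [hlast]; nlinarith
          rw [uIcc_of_ge h2.le] at hbd
          refine ⟨?_, hbd.2⟩
          by_contra hcon
          exact hconn (t Y) (by rw [uIcc_of_le hbd.2]; exact ⟨(not_le.1 hcon).le, h1.le⟩) rfl
        · left
          have h1 : v < t Y := by rw [hYv]; nlinarith [sub_pos.2 hYj, mul_pos hpos (sub_pos.2 hYj)]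
          have h2 : v < t (β (j + 1)) := by rw [hlast]; nlinarith [mul_pos hpos hbpos]
          rw [uIcc_of_le h2.le] at hbd
          refine ⟨hbd.1, ?_⟩
          by_contra hcon
          exact hconn (t Y) (by rw [uIcc_of_ge hbd.1]; exact ⟨h1.le, (not_le.1 hcon).le⟩) rfl
      have hpiece : ∀ s ∈ Icc s₀ L, b + (h s - v) / c ∈ Icc b Y := by
        intro s hs
        obtain ⟨y, hy, e⟩ := H s ⟨hs₀.1.trans hs.1, hs.2⟩
        have : h s ∈ t '' Icc 0 y := e ▸ ⟨s, ⟨hs₀.1.trans hs.1, le_rfl⟩, rfl⟩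
        obtain ⟨x, hx, ex⟩ := this
        have := hrange x ⟨hx.1, hx.2.trans hy.2⟩
        rw [ex, haff Y ⟨hYj.le, hY⟩, mem_uIcc] at this
        rcases lt_or_gt_of_ne hc0 with hneg | hpos
        · have h1 : v + c * (Y - b) ≤ h s ∧ h s ≤ v := by
            rcases this with h | h
            · constructor <;> nlinarith [h.1, h.2, mul_pos_of_neg_of_neg hneg (neg_neg_of_pos (sub_pos.2 hYj))]
            · exact h
          constructor
          · have := div_nonneg_of_nonpos (sub_nonpos.2 h1.2) hneg.le; linarith
          · have : (h s - v) / c ≤ Y - b := by rw [div_le_iff_of_neg hneg]; linarith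
            linarith
        · have h1 : v ≤ h s ∧ h s ≤ v + c * (Y - b) := by
            rcases this with h | h
            · exact h
            · constructor <;> nlinarith [h.1, h.2, mul_pos hpos (sub_pos.2 hYj)]
          constructor
          · have := div_nonneg (sub_nonneg.2 h1.1) hpos.le; linarith
          · have : (h s - v) / c ≤ Y - b := by rw [div_le_iff₀ hpos]; linarith
            linarith
      refine ⟨fun s => if s ≤ s₀ then θ s else b + (h s - v) / c, ?_, ?_, ?_, ?_⟩
      · have hc2 : ContinuousOn (fun s => b + (h s - v) / c) (Icc s₀ L) := by fun_prop
        rw [show Icc 0 L = Icc 0 s₀ ∪ Icc s₀ L from (Icc_union_Icc_eq_Icc hs₀.1 hs₀.2).symm]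
        apply ContinuousOn.union_of_isClosed _ _ isClosed_Icc isClosed_Icc
        · exact hθc.congr fun s hs => by simp [hs.2]
        · refine hc2.congr fun s hs => ?_
          rcases hs.1.eq_or_lt with rfl | hlt
          · simp [hθs, es₀]
          · simp [not_le.2 hlt]
      · intro s hs
        simp only
        split_ifs with hss
        · have := hθm (show s ∈ Icc 0 s₀ from ⟨hs.1, hss⟩)
          exact ⟨this.1, this.2.trans hYj.le⟩
        · have := hpiece s ⟨(not_le.1 hss).le, hs.2⟩
          exact ⟨hb0.trans this.1, this.2⟩
      · simp [hs₀.1, hθ0]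
      · intro s hs
        simp only
        split_ifs with hss
        · exact hθ s ⟨hs.1, hss⟩
        · have := hpiece s ⟨(not_le.1 hss).le, hs.2⟩
          rw [haff _ ⟨this.1, this.2.trans hY⟩]
          field_simp
          ring

end Zig

/-! ### Contour points -/

section contour

variable {h : ℝ → ℝ}

lemma IsDeparture.ne_zero (h0 : h 0 = 0) {x : ℝ} (hx : IsDeparture h x) : h x ≠ 0 := fun hcon =>
  hx.2.2 ⟨0, ⟨le_rfl, hx.1⟩, by rw [h0, hcon]⟩

lemma isDeparture_neg {x : ℝ} : IsDeparture (fun y => - h y) x ↔ IsDeparture h x := by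
  simp [IsDeparture]

lemma oppositeOrientation_neg {x y : ℝ} :
    OppositeOrientation (fun y => - h y) x y ↔ OppositeOrientation h x y := by
  simp [OppositeOrientation, or_comm]

lemma isContourPoint_neg {x : ℝ} : IsContourPoint (fun y => - h y) x ↔ IsContourPoint h x := by
  simp [IsContourPoint, isDeparture_neg, oppositeOrientation_neg]

lemma IsDeparture.lt_of_pos (hc : Continuous h) (h0 : h 0 = 0) {x : ℝ} (hx : IsDeparture h x)
    (hp : 0 < h x) {y : ℝ} (hy : y ∈ Ico 0 x) : h y < h x := by
  by_contra hcon
  obtain ⟨z, hz, ez⟩ := intermediate_value_Icc hy.1 hc.continuousOn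
    (show h x ∈ Icc (h 0) (h y) from ⟨by rw [h0]; exact hp.le, not_lt.1 hcon⟩)
  exact hx.2.2 ⟨z, ⟨hz.1, hz.2.trans_lt hy.2⟩, ez⟩

lemma isDeparture_of_forall_lt {x : ℝ} (hx : 0 < x) (hx1 : x ≤ 1) (H : ∀ y ∈ Ico 0 x, h y < h x) :
    IsDeparture h x :=
  ⟨hx, hx1, by rintro ⟨y, hy, e⟩; exact (H y hy).ne e⟩

/-- Every contour point lies at or beyond `w`, where positive departures have value at least `h w`.
Between two contour points there is a departure of opposite sign to the first, so the values differ
by at least `h w`; uniform continuity bounds the distance below. -/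
lemma contour_separated_of_pos (hc : Continuous h) (h0 : h 0 = 0) {c w : ℝ} (hc0 : 0 ≤ c)
    (hcw : c < w) (hw : w ≤ 1) (hz : ∀ x ∈ Icc 0 c, h x = 0)
    (hm : ∀ x ∈ Icc c w, ∀ y ∈ Icc c w, x < y → h x < h y) :
    ∃ η > 0, ∀ α β, IsContourPoint h α → IsContourPoint h β → α < β → η ≤ β - α := by
  have hcc : h c = 0 := hz c ⟨hc0, le_rfl⟩
  have hpos : ∀ x ∈ Ioc c w, 0 < h x := fun x hx =>
    hcc ▸ hm c ⟨le_rfl, hcw.le⟩ x ⟨hx.1.le, hx.2⟩ hx.1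
  have hδ := hpos w ⟨hcw, le_rfl⟩
  have hwlt : ∀ y ∈ Ico 0 w, h y < h w := by
    intro y hy
    rcases le_or_gt y c with hyc | hyc
    · rw [hz y ⟨hy.1, hyc⟩]; exact hδ
    · exact hm y ⟨hyc.le, hy.2.le⟩ w ⟨hcw.le, le_rfl⟩ hy.2
  have hwd : IsDeparture h w := isDeparture_of_forall_lt (hc0.trans_lt hcw) hw hwlt
  have hgtc : ∀ x, IsDeparture h x → c < x := by
    intro x hx
    by_contra hcon
    exact hx.ne_zero h0 (hz x ⟨hx.1.le, not_lt.1 hcon⟩)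
  have hCw : ∀ α, IsContourPoint h α → w ≤ α := by
    intro α hα
    by_contra hcon
    rw [not_le] at hcon
    have hca := hgtc α hα.1
    have h1 := hpos α ⟨hca, hcon.le⟩
    obtain ⟨y, hy, ho, hay, hyw⟩ := hα.2 w hwd hcon
    have h2 := hpos y ⟨hca.trans hay, hyw⟩
    rcases ho with ho | ho <;> linarith [ho.1, ho.2]
  have hval : ∀ x, IsDeparture h x → w ≤ x → 0 < h x → h w ≤ h x := by
    intro x hx hwx hp
    rcases hwx.eq_or_lt with rfl | hlt
    · exact le_rfl
    · exact (hx.lt_of_pos hc h0 hp ⟨(hc0.trans hcw.le), hlt⟩).le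
  have hunif := isCompact_Icc.uniformContinuousOn_of_continuous (s := Icc (0 : ℝ) 1) hc.continuousOn
  rw [Metric.uniformContinuousOn_iff] at hunif
  obtain ⟨η, hη, hU⟩ := hunif (h w) hδ
  refine ⟨η, hη, fun α β hα hβ hlt => ?_⟩
  obtain ⟨y, hy, ho, hay, hyb⟩ := hα.2 β hβ.1 hlt
  have hwa := hCw α hα
  by_contra hcon
  have := hU α ⟨hα.1.1.le, hα.1.2.1⟩ y ⟨hy.1.le, hy.2.1⟩ (by
    rw [Real.dist_eq, abs_lt]; constructor <;> linarith)
  rw [Real.dist_eq, abs_lt] at this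
  rcases ho with ho | ho
  · have := hval α hα.1 hwa ho.1
    linarith [ho.2]
  · have := hval y hy (hwa.trans hay.le) ho.2
    linarith [ho.1]

/-- `h` is affine immediately to the right of every point of `[0, 1)`. -/
def RightAffine (h : ℝ → ℝ) : Prop :=
  ∀ c ∈ Ico (0 : ℝ) 1, ∃ w, c < w ∧ w ≤ 1 ∧ ∃ a b : ℝ, ∀ x ∈ Icc c w, h x = a * x + b

/-- Only the affine germ at the point where `h` first leaves `0` matters: it rules out infinitely
many small oscillations there, and compactness handles the rest. -/
lemma contour_finite (hc : Continuous h) (h0 : h 0 = 0) (hne : ∃ x ∈ Icc (0 : ℝ) 1, h x ≠ 0)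
    (hg : RightAffine h) : {α | IsContourPoint h α}.Finite := by
  obtain ⟨η, hη, hsep⟩ : ∃ η > 0, ∀ α β, IsContourPoint h α → IsContourPoint h β → α < β →
      η ≤ β - α := by
    -- The supremum of `S` is the end of the initial interval on which `h` vanishes.
    set S := {x : ℝ | x ∈ Icc (0 : ℝ) 1 ∧ ∀ y ∈ Icc 0 x, h y = 0} with hS
    have h0S : (0 : ℝ) ∈ S := ⟨by simp, fun y hy => by
      rw [le_antisymm hy.2 hy.1, h0]⟩
    have hbdd : BddAbove S := ⟨1, fun x hx => hx.1.2⟩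
    set c := sSup S with hcdef
    have hc0 : 0 ≤ c := le_csSup hbdd h0S
    have hc1' : c ≤ 1 := csSup_le ⟨0, h0S⟩ fun x hx => hx.1.2
    have hlt0 : ∀ y ∈ Ico 0 c, h y = 0 := by
      intro y hy
      obtain ⟨x, hx, hyx⟩ := exists_lt_of_lt_csSup ⟨0, h0S⟩ hy.2
      exact hx.2 y ⟨hy.1, hyx.le⟩
    have hz : ∀ x ∈ Icc 0 c, h x = 0 := by
      intro x hx
      rcases hc0.eq_or_lt with h | hcpos
      · rw [← h] at hx; rw [le_antisymm hx.2 hx.1, h0]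
      · have : closure (Ico 0 c) ⊆ {x | h x = 0} :=
          closure_minimal hlt0 (isClosed_eq hc continuous_const)
        rw [closure_Ico hcpos.ne] at this
        exact this hx
    have hc1 : c < 1 := by
      refine lt_of_le_of_ne hc1' fun hcon => ?_
      obtain ⟨x, hx, hx'⟩ := hne
      exact hx' (hz x (hcon ▸ hx))
    obtain ⟨w, hcw, hw1, a, b, hab⟩ := hg c ⟨hc0, hc1⟩
    have hac : a * c + b = 0 := by rw [← hab c ⟨le_rfl, hcw.le⟩, hz c ⟨hc0, le_rfl⟩]
    have ha : a ≠ 0 := by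
      rintro rfl
      have : w ∈ S := ⟨⟨hc0.trans hcw.le, hw1⟩, fun y hy => by
        rcases le_total y c with hyc | hyc
        · exact hz y ⟨hy.1, hyc⟩
        · rw [hab y ⟨hyc, hy.2⟩]; linarith⟩
      exact absurd (le_csSup hbdd this) (not_le.2 hcw)
    rcases lt_or_gt_of_ne ha with hneg | hpos
    · have := contour_separated_of_pos (h := fun x => - h x) (cneg hc) (by simp [h0]) hc0 hcw hw1
        (fun x hx => by simp [hz x hx]) (fun x hx y hy hxy => by
          rw [hab x hx, hab y hy]; nlinarith)
      simpa only [isContourPoint_neg] using this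
    · exact contour_separated_of_pos hc h0 hc0 hcw hw1 hz (fun x hx y hy hxy => by
          rw [hab x hx, hab y hy]; nlinarith)
  refine Set.Finite.of_injOn (f := fun α : ℝ => ⌊α / η⌋₊) (t := Iic ⌊1 / η⌋₊) ?_ ?_ (finite_Iic _)
  · intro α hα
    exact Nat.floor_le_floor (div_le_div_of_nonneg_right hα.1.2.1 hη.le)
  · intro α hα β hβ hab
    simp only at hab
    by_contra hne
    have key : ∀ α β, IsContourPoint h α → IsContourPoint h β → α < β → ⌊α / η⌋₊ < ⌊β / η⌋₊ := by
      intro α β hα hβ hlt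
      have h1 := hsep α β hα hβ hlt
      rw [← Nat.add_one_le_iff]
      apply Nat.le_floor
      have h2 := Nat.floor_le (div_nonneg hα.1.1.le hη.le)
      push_cast
      have h3 : α / η + 1 ≤ β / η := by
        rw [div_add_one hη.ne']; exact div_le_div_of_nonneg_right (by linarith) hη.le
      linarith
    rcases lt_or_gt_of_ne hne with h | h
    · exact (key α β hα hβ h).ne hab
    · exact (key β α hβ hα h).ne' hab

lemma exists_first (hc : Continuous h) {y v : ℝ} (hv : ∃ x ∈ Icc 0 y, h x = v) :
    ∃ x ∈ Icc 0 y, h x = v ∧ ∀ z ∈ Ico 0 x, h z ≠ v := by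
  have hcomp : IsCompact (Icc 0 y ∩ h ⁻¹' {v}) :=
    isCompact_Icc.inter_right (isClosed_singleton.preimage hc)
  obtain ⟨s, hs⟩ := hv
  obtain ⟨x, hx, hm⟩ := hcomp.exists_isLeast ⟨s, hs⟩
  refine ⟨x, hx.1, hx.2, fun z hz hcon => ?_⟩
  exact absurd (hm ⟨⟨hz.1, hz.2.le.trans hx.1.2⟩, hcon⟩) (not_le.2 hz.2)

/-- The predecessor of a positive contour point. -/
lemma contour_pred_of_pos (hc : Continuous h) (h0 : h 0 = 0) {β : ℝ} (hβ : IsContourPoint h β)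
    (hp : 0 < h β) :
    ∃ x, (x = 0 ∨ IsContourPoint h x) ∧ x < β ∧ (∀ α, IsContourPoint h α → ¬ (x < α ∧ α < β)) ∧
      ∀ y ∈ Icc 0 β, h y ∈ uIcc (h x) (h β) := by
  have hβ0 := hβ.1.1
  have hup : ∀ y ∈ Icc 0 β, h y ≤ h β := by
    intro y hy
    rcases hy.2.eq_or_lt with rfl | hlt
    · exact le_rfl
    · exact (hβ.1.lt_of_pos hc h0 hp ⟨hy.1, hlt⟩).le
  -- The predecessor is the first place where the minimum over `[0, β]` is attained; every departure
  -- after it and up to `β` is positive.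
  obtain ⟨x, hx, ex, hfirst⟩ := exists_first hc (exists_dp hc hβ0.le)
  have hmin : ∀ y ∈ Icc 0 β, h x ≤ h y := fun y hy => ex ▸ neg_dp_le hc hy.1 hy.2
  have hx0 : h x ≤ 0 := h0 ▸ hmin 0 ⟨le_rfl, hβ0.le⟩
  have hxβ : x < β := lt_of_le_of_ne hx.2 (by rintro rfl; linarith)
  have hnoneg : ∀ y, IsDeparture h y → x < y → y ≤ β → 0 < h y := by
    intro y hy hxy hyb
    by_contra hcon
    obtain ⟨z, hz, ez⟩ := intermediate_value_Icc' hx.1 hc.continuousOn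
      (show h y ∈ Icc (h x) (h 0) from ⟨hmin y ⟨hy.1.le, hyb⟩, by rw [h0]; exact not_lt.1 hcon⟩)
    exact hy.2.2 ⟨z, ⟨hz.1, hz.2.trans_lt hxy⟩, ez⟩
  refine ⟨x, ?_, hxβ, ?_, ?_⟩
  · rcases hx.1.eq_or_lt with h | hxpos
    · exact Or.inl h.symm
    · right
      have hxd : IsDeparture h x := ⟨hxpos, hx.2.trans hβ.1.2.1, by
        rintro ⟨z, hz, e⟩; exact hfirst z hz (e.trans ex)⟩
      have hxneg : h x < 0 := lt_of_le_of_ne hx0 (hxd.ne_zero h0)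
      refine ⟨hxd, fun x' hx' hlt => ?_⟩
      rcases le_or_gt β x' with hb | hb
      · exact ⟨β, hβ.1, Or.inr ⟨hxneg, hp⟩, hxβ, hb⟩
      · exact ⟨x', hx', Or.inr ⟨hxneg, hnoneg x' hx' hlt hb.le⟩, hlt, le_rfl⟩
  · rintro α hα ⟨h1, h2⟩
    have hαp := hnoneg α hα.1 h1 h2.le
    obtain ⟨y, hy, ho, hay, hyb⟩ := hα.2 β hβ.1 h2
    have := hnoneg y hy (h1.trans hay) hyb
    rcases ho with ho | ho <;> linarith [ho.1, ho.2]
  · intro y hy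
    rw [mem_uIcc]
    exact Or.inl ⟨hmin y hy, hup y hy⟩

lemma contour_pred (hc : Continuous h) (h0 : h 0 = 0) {β : ℝ} (hβ : IsContourPoint h β) :
    ∃ x, (x = 0 ∨ IsContourPoint h x) ∧ x < β ∧ (∀ α, IsContourPoint h α → ¬ (x < α ∧ α < β)) ∧
      ∀ y ∈ Icc 0 β, h y ∈ uIcc (h x) (h β) := by
  rcases lt_or_gt_of_ne (hβ.1.ne_zero h0) with hn | hp
  · obtain ⟨x, h1, h2, h3, h4⟩ := contour_pred_of_pos (h := fun y => - h y) (cneg hc) (by simp [h0])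
      (isContourPoint_neg.2 hβ) (by simpa using hn)
    refine ⟨x, by simpa [isContourPoint_neg] using h1, h2, by simpa [isContourPoint_neg] using h3,
      fun y hy => ?_⟩
    have := h4 y hy
    rw [mem_uIcc] at this ⊢
    rcases this with h | h
    · right; constructor <;> linarith [h.1, h.2]
    · left; constructor <;> linarith [h.1, h.2]
  · exact contour_pred_of_pos hc h0 hβ hp

/-- The last contour point is the later of the first times at which the global minimum and maximum
are attained; after it there are no departures. -/
lemma contour_last (hc : Continuous h) (h0 : h 0 = 0) (hne : ∃ x ∈ Icc (0 : ℝ) 1, h x ≠ 0) :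
    ∃ x, IsContourPoint h x ∧ (∀ α, IsContourPoint h α → α ≤ x) ∧
      ∀ y ∈ Icc (0 : ℝ) 1, ∃ z ∈ Icc 0 x, h y = h z := by
  obtain ⟨a, ha, ea, fa⟩ := exists_first hc (exists_dp hc zero_le_one)
  obtain ⟨b, hb, eb, fb⟩ := exists_first hc (exists_hi hc zero_le_one)
  have hcov : ∀ y ∈ Icc (0 : ℝ) 1, ∃ z ∈ Icc 0 (max a b), h y = h z := by
    intro y hy
    obtain ⟨z, hz, e⟩ : h y ∈ h '' Icc 0 (max a b) :=
      (isPreconnected_Icc.image h hc.continuousOn).ordConnected.out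
        ⟨a, ⟨ha.1, le_max_left _ _⟩, rfl⟩ ⟨b, ⟨hb.1, le_max_right _ _⟩, rfl⟩
        ⟨ea ▸ neg_dp_le hc hy.1 hy.2, eb ▸ le_hi hc hy.1 hy.2⟩
    exact ⟨z, hz, e.symm⟩
  have hpos : 0 < max a b := by
    by_contra hcon
    obtain ⟨x, hx, hx'⟩ := hne
    obtain ⟨z, hz, e⟩ := hcov x hx
    have : z = 0 := le_antisymm (hz.2.trans (not_lt.1 hcon)) hz.1
    rw [e, this, h0] at hx'
    exact hx' rfl
  have hdep : IsDeparture h (max a b) := by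
    refine ⟨hpos, max_le ha.2 hb.2, ?_⟩
    rintro ⟨z, hz, e⟩
    rcases le_total a b with hab | hab
    · rw [max_eq_right hab] at hz e
      exact fb z hz (e.trans eb)
    · rw [max_eq_left hab] at hz e
      exact fa z hz (e.trans ea)
  have hnone : ∀ x, IsDeparture h x → x ≤ max a b := by
    intro x hx
    by_contra hcon
    obtain ⟨z, hz, e⟩ := hcov x ⟨hx.1.le, hx.2.1⟩
    exact hx.2.2 ⟨z, ⟨hz.1, hz.2.trans_lt (not_le.1 hcon)⟩, e.symm⟩
  exact ⟨max a b, ⟨hdep, fun x hx hlt => absurd (hnone x hx) (not_le.2 hlt)⟩,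
    fun α hα => hnone α hα.1, hcov⟩

/-- Counting the contour points up to the `k`-th one shows that the set in the recursive infimum is
nonempty as long as `k` has not reached the total number. -/
lemma contourPoint_enum (hf : {α | IsContourPoint h α}.Finite)
    (k : ℕ) (hk : k ≤ numContourPoints h) :
    (1 ≤ k → IsContourPoint h (contourPoint h k)) ∧
      {α | IsContourPoint h α ∧ α ≤ contourPoint h k}.ncard = k := by
  induction k with
  | zero =>
    refine ⟨by omega, ?_⟩
    rw [ncard_eq_zero (hf.subset fun α hα => hα.1)]
    ext α
    simp only [mem_ofPred_eq, mem_empty_iff_false, iff_false, contourPoint]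
    rintro ⟨h1, h2⟩
    exact absurd h1.1.1 (not_lt.2 h2)
  | succ k ih =>
    obtain ⟨_, ihc⟩ := ih (by omega)
    set S := {α | IsContourPoint h α ∧ contourPoint h k < α} with hS
    have hSne : S.Nonempty := by
      by_contra hcon
      have : {α | IsContourPoint h α ∧ α ≤ contourPoint h k} = {α | IsContourPoint h α} := by
        ext α
        simp only [mem_ofPred_eq, and_iff_left_iff_imp]
        intro hα
        by_contra hlt
        exact hcon ⟨α, hα, not_le.1 hlt⟩
      rw [this] at ihc
      rw [numContourPoints] at hk
      omega
    have hSf : S.Finite := hf.subset fun α hα => hα.1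
    have hmem : contourPoint h (k + 1) ∈ S := hSne.csInf_mem hSf
    refine ⟨fun _ => hmem.1, ?_⟩
    have : {α | IsContourPoint h α ∧ α ≤ contourPoint h (k + 1)} =
        insert (contourPoint h (k + 1)) {α | IsContourPoint h α ∧ α ≤ contourPoint h k} := by
      ext α
      simp only [mem_ofPred_eq, mem_insert_iff]
      constructor
      · rintro ⟨h1, h2⟩
        by_cases h3 : α ≤ contourPoint h k
        · exact Or.inr ⟨h1, h3⟩
        · left
          exact le_antisymm h2 (csInf_le hSf.bddBelow ⟨h1, not_le.1 h3⟩)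
      · rintro (rfl | ⟨h1, h2⟩)
        · exact ⟨hmem.1, le_rfl⟩
        · exact ⟨h1, h2.trans hmem.2.le⟩
    rw [this, ncard_insert_of_notMem (fun hcon => absurd hmem.2 (not_lt.2 hcon.2))
      (hf.subset fun α hα => hα.1), ihc]

lemma zdata_contour (hc : Continuous h) (h0 : h 0 = 0) (hne : ∃ x ∈ Icc (0 : ℝ) 1, h x ≠ 0)
    (hg : RightAffine h) : ZData h (contourPoint h) (numContourPoints h) := by
  have hf := contour_finite hc h0 hne hg
  obtain ⟨l, hl, hlmax, hltop⟩ := contour_last hc h0 hne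
  have hmem : ∀ k < numContourPoints h, IsContourPoint h (contourPoint h (k + 1)) := fun k hk =>
    (contourPoint_enum hf (k + 1) hk).1 (by omega)
  have hlt : ∀ k < numContourPoints h, contourPoint h k < contourPoint h (k + 1) := by
    intro k hk
    by_contra hcon
    have h1 := (contourPoint_enum hf (k + 1) hk).2
    have h2 := (contourPoint_enum hf k hk.le).2
    have := ncard_le_ncard (s := {α | IsContourPoint h α ∧ α ≤ contourPoint h (k + 1)})
      (t := {α | IsContourPoint h α ∧ α ≤ contourPoint h k})
      (fun α hα => ⟨hα.1, hα.2.trans (not_lt.1 hcon)⟩) (hf.subset fun α hα => hα.1)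
    omega
  have hbetween : ∀ k < numContourPoints h, ∀ α, IsContourPoint h α → contourPoint h k < α →
      contourPoint h (k + 1) ≤ α := fun k hk α hα hlt =>
    csInf_le (hf.subset fun α hα => hα.1 : {α | IsContourPoint h α ∧ contourPoint h k < α}.Finite).bddBelow
      ⟨hα, hlt⟩
  have hone : 1 ≤ numContourPoints h := by
    rw [numContourPoints, Nat.one_le_iff_ne_zero, Ne, ncard_eq_zero hf]
    exact fun hcon => (hcon ▸ hl : l ∈ (∅ : Set ℝ))
  have hlast : contourPoint h (numContourPoints h) = l := by
    obtain ⟨h1, h2⟩ := contourPoint_enum hf _ le_rfl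
    apply le_antisymm (hlmax _ (h1 hone))
    by_contra hcon
    have : ({α | IsContourPoint h α ∧ α ≤ contourPoint h (numContourPoints h)}) =
        {α | IsContourPoint h α} :=
      eq_of_subset_of_ncard_le (fun α hα => hα.1) (by rw [h2]; rfl) hf
    exact hcon (this ▸ hl : l ∈ {α | IsContourPoint h α ∧ α ≤ contourPoint h (numContourPoints h)}).2
  refine ⟨hone, rfl, hlt, hlast ▸ hl.1.2.1, ?_, ?_, ?_⟩
  · intro k hk
    obtain ⟨x, hx, hxlt, hxb, hxr⟩ := contour_pred hc h0 (hmem k hk)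
    have : contourPoint h k = x := by
      rcases lt_trichotomy (contourPoint h k) x with h | h | h
      · exfalso
        rcases hx with rfl | hx
        · rcases Nat.eq_zero_or_pos k with rfl | hk0
          · exact h.ne rfl
          · exact absurd ((contourPoint_enum hf k hk.le).1 hk0).1.1 (not_lt.2 h.le)
        · exact absurd (hbetween k hk x hx h) (not_le.2 hxlt)
      · exact h
      · exfalso
        rcases Nat.eq_zero_or_pos k with rfl | hk0
        · rcases hx with rfl | hx
          · exact h.ne rfl
          · exact absurd hx.1.1 (not_lt.2 h.le)
        · exact hxb _ ((contourPoint_enum hf k hk.le).1 hk0) ⟨h, hlt k hk⟩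
    rw [this]; exact hxr
  · intro k hk x hx hcon
    exact (hmem k hk).1.2.2 ⟨x, hx, hcon⟩
  · intro x hx
    rw [hlast]; exact hltop x hx

/-! ### Contour factors are zigzags -/

lemma contourPoint_mem (h : ℝ → ℝ) (k : ℕ) : contourPoint h k ∈ Icc (0 : ℝ) 1 := by
  cases k with
  | zero => simp [contourPoint]
  | succ k =>
    rw [contourPoint]
    -- With no contour point left the infimum is over the empty set and takes the default value `0`,
    -- which still lies in the interval.
    rcases ({α | IsContourPoint h α ∧ contourPoint h k < α}).eq_empty_or_nonempty with he | ⟨a, ha⟩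
    · rw [he, Real.sInf_empty]; simp
    · have hb : ∀ x ∈ {α | IsContourPoint h α ∧ contourPoint h k < α}, 0 ≤ x := fun x hx => hx.1.1.1.le
      exact ⟨le_csInf ⟨a, ha⟩ hb, (csInf_le ⟨0, hb⟩ ha).trans ha.1.1.2.1⟩

lemma contourFactor_congr {g : ℝ → ℝ} (H : EqOn g h (Icc 0 1)) : contourFactor g = contourFactor h := by
  have hd : ∀ x, IsDeparture g x ↔ IsDeparture h x := by
    intro x
    have : ∀ (_ : 0 < x) (_ : x ≤ 1), (g x ∉ g '' Ico 0 x ↔ h x ∉ h '' Ico 0 x) := by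
      intro hx hx'
      have e : g '' Ico 0 x = h '' Ico 0 x := image_congr fun y hy => H ⟨hy.1, hy.2.le.trans hx'⟩
      rw [H ⟨hx.le, hx'⟩, e]
    constructor
    · rintro ⟨h1, h2, h3⟩; exact ⟨h1, h2, (this h1 h2).1 h3⟩
    · rintro ⟨h1, h2, h3⟩; exact ⟨h1, h2, (this h1 h2).2 h3⟩
  have hcp : ∀ x, IsContourPoint g x ↔ IsContourPoint h x := by
    intro x
    unfold IsContourPoint
    rw [hd]
    refine and_congr_right fun hx => forall_congr' fun y => ?_
    rw [hd]
    refine imp_congr_right fun hy => imp_congr_right fun _ => exists_congr fun z => ?_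
    rw [hd]
    refine and_congr_right fun hz => ?_
    rw [OppositeOrientation, H ⟨hx.1.le, hx.2.1⟩, H ⟨hz.1.le, hz.2.1⟩]
    rfl
  have hnum : numContourPoints g = numContourPoints h := by
    unfold numContourPoints; simp_rw [hcp]
  have hpt : ∀ k, contourPoint g k = contourPoint h k := by
    intro k
    induction k with
    | zero => rfl
    | succ k ih => rw [contourPoint, contourPoint, ih]; simp_rw [hcp]
  funext x
  unfold contourFactor
  simp only [hnum, hpt]
  rw [H (contourPoint_mem h _), H (contourPoint_mem h _)]

lemma contourFactor_piece {k : ℕ} {x : ℝ} (hx0 : 0 ≤ x) (h1 : (k : ℝ) ≤ numContourPoints h * x)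
    (h2 : numContourPoints h * x ≤ k + 1) :
    contourFactor h x = (1 - (numContourPoints h * x - k)) * h (contourPoint h k) +
      (numContourPoints h * x - k) * h (contourPoint h (k + 1)) := by
  have hnn : 0 ≤ (numContourPoints h : ℝ) * x := mul_nonneg (Nat.cast_nonneg _) hx0
  simp only [contourFactor]
  rcases h2.lt_or_eq with hlt | heq
  · rw [(Nat.floor_eq_iff hnn).2 ⟨h1, hlt⟩]
  -- At the right end of the piece the floor has already moved on to `k + 1`; both formulas give the
  -- same value.
  · rw [heq]
    have : ⌊(k : ℝ) + 1⌋₊ = k + 1 := by exact_mod_cast Nat.floor_natCast (R := ℝ) (k + 1)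
    rw [this]; push_cast; ring

lemma contourFactor_node {k : ℕ} (hn : 1 ≤ numContourPoints h) :
    contourFactor h (k / numContourPoints h) = h (contourPoint h k) := by
  have hn' : (0 : ℝ) < numContourPoints h := by exact_mod_cast hn
  have : (numContourPoints h : ℝ) * (k / numContourPoints h) = k := by field_simp
  rw [contourFactor_piece (k := k) (by positivity) (by rw [this]) (by rw [this]; linarith), this]
  ring

lemma exists_nat_piece {n : ℕ} (hn : 1 ≤ n) {x : ℝ} (hx : x ∈ Icc (0 : ℝ) 1) :
    ∃ k < n, (k : ℝ) ≤ n * x ∧ n * x ≤ k + 1 := by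
  have hnn : 0 ≤ (n : ℝ) * x := mul_nonneg (Nat.cast_nonneg _) hx.1
  have hle : (n : ℝ) * x ≤ n := by nlinarith [hx.2, (Nat.cast_nonneg n : (0 : ℝ) ≤ n)]
  by_cases h : ⌊(n : ℝ) * x⌋₊ < n
  · exact ⟨_, h, Nat.floor_le hnn, (Nat.lt_floor_add_one _).le⟩
  · refine ⟨n - 1, by omega, ?_, ?_⟩
    · have h1 : (n : ℝ) ≤ n * x := (Nat.le_floor_iff hnn).1 (not_lt.1 h)
      have : ((n - 1 : ℕ) : ℝ) ≤ n := by exact_mod_cast Nat.sub_le n 1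
      linarith
    · rw [Nat.cast_sub hn]; push_cast; linarith

lemma contourFactor_continuousOn (hn : 1 ≤ numContourPoints h) :
    ContinuousOn (contourFactor h) (Icc 0 1) := by
  set n := numContourPoints h with hndef
  have hn' : (0 : ℝ) < n := by exact_mod_cast hn
  have hcover : Icc (0 : ℝ) 1 ⊆ ⋃ k : Fin n, Icc ((k : ℝ) / n) ((k + 1) / n) := by
    intro x hx
    obtain ⟨k, hk, h1, h2⟩ := exists_nat_piece hn hx
    refine mem_iUnion.2 ⟨⟨k, hk⟩, ?_, ?_⟩
    · rw [div_le_iff₀ hn']; linarith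
    · rw [le_div_iff₀ hn']; linarith
  refine ContinuousOn.mono ?_ hcover
  apply (locallyFinite_of_finite _).continuousOn_iUnion (fun k => isClosed_Icc)
  intro k
  have : ContinuousOn (fun x : ℝ => (1 - (n * x - (k : ℕ))) * h (contourPoint h k) +
      (n * x - (k : ℕ)) * h (contourPoint h (k + 1))) (Icc ((k : ℝ) / n) ((k + 1) / n)) := by fun_prop
  refine this.congr fun x hx => ?_
  have h0 : 0 ≤ x := le_trans (by positivity) hx.1
  have h1 := hx.1
  have h2 := hx.2
  rw [div_le_iff₀ hn'] at h1
  rw [le_div_iff₀ hn'] at h2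
  exact contourFactor_piece h0 (by linarith) (by linarith)

/-- Linear interpolation stays between consecutive node values, and those intervals increase with
`k`. A node value reached earlier would have to lie between older extremes, against its being new.
-/
lemma zig_contourFactor (Z : ZData h (contourPoint h) (numContourPoints h)) :
    Zig (contourFactor h) (fun k => (k : ℝ) / numContourPoints h) (numContourPoints h) := by
  set n := numContourPoints h with hndef
  set t := contourFactor h with ht
  set v : ℕ → ℝ := fun k => h (contourPoint h k) with hv
  have hn := Z.one_le
  have hn' : (0 : ℝ) < n := by exact_mod_cast hn
  have hnode : ∀ k : ℕ, t ((k : ℝ) / n) = v k := fun k => contourFactor_node hn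
  have hpiece : ∀ k : ℕ, ∀ x : ℝ, 0 ≤ x → (k : ℝ) ≤ n * x → n * x ≤ k + 1 →
      t x = (1 - (n * x - k)) * v k + (n * x - k) * v (k + 1) := fun k x h0 h1 h2 =>
    contourFactor_piece h0 h1 h2
  have hseg : ∀ k : ℕ, ∀ x : ℝ, 0 ≤ x → (k : ℝ) ≤ n * x → n * x ≤ k + 1 →
      t x ∈ uIcc (v k) (v (k + 1)) := by
    intro k x h0 h1 h2
    rw [hpiece k x h0 h1 h2, ← segment_eq_uIcc]
    exact ⟨_, _, by linarith, by linarith, by ring, rfl⟩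
  have hloc : ∀ x : ℝ, 0 ≤ x → ∀ k : ℕ, n * x ≤ k + 1 → ∃ j ≤ k, (j : ℝ) ≤ n * x ∧ n * x ≤ j + 1 := by
    intro x hx k hk
    induction k with
    | zero => exact ⟨0, le_rfl, by simpa using mul_nonneg hn'.le hx, hk⟩
    | succ k ih =>
      rcases le_total (n * x) ((k + 1 : ℕ) : ℝ) with h | h
      · obtain ⟨j, hj, h1⟩ := ih (by exact_mod_cast h)
        exact ⟨j, by omega, h1⟩
      · exact ⟨k + 1, le_rfl, h, by exact_mod_cast hk⟩
  have hvmem : ∀ k < n, ∀ j ≤ k, uIcc (v j) (v (j + 1)) ⊆ uIcc (v k) (v (k + 1)) := by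
    intro k hk j hj
    apply uIcc_subset_uIcc
    · exact Z.bd k hk _ ⟨Z.nonneg (by omega), Z.mono hk (by omega)⟩
    · exact Z.bd k hk _ ⟨Z.nonneg (by omega), Z.mono hk (by omega)⟩
  have hbd : ∀ k < n, ∀ x : ℝ, 0 ≤ x → n * x ≤ k + 1 → t x ∈ uIcc (v k) (v (k + 1)) := by
    intro k hk x h0 hx
    obtain ⟨j, hj, h1, h2⟩ := hloc x h0 k hx
    exact hvmem k hk j hj (hseg j x h0 h1 h2)
  have hdiv : ∀ k : ℕ, ∀ x : ℝ, x ≤ ((k + 1 : ℕ) : ℝ) / n ↔ n * x ≤ k + 1 := by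
    intro k x
    rw [le_div_iff₀ hn', mul_comm]; push_cast; rfl
  have hne : ∀ k < n, v k ≠ v (k + 1) := fun k hk =>
    Z.new k hk _ ⟨Z.nonneg hk.le, Z.lt k hk⟩
  refine ⟨⟨hn, by simp, fun k hk => ?_, ?_, ?_, ?_, ?_⟩, ?_, ?_⟩
  · gcongr; simp
  · rw [div_self hn'.ne']
  · intro k hk x hx
    simp only [hnode] at hx ⊢
    exact hbd k hk x hx.1 ((hdiv k x).1 hx.2)
  · intro k hk x hx
    simp only [hnode] at hx ⊢
    have hxlt : n * x < k + 1 := by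
      have := hx.2
      rw [lt_div_iff₀ hn'] at this; push_cast at this; linarith
    rcases le_or_gt (k : ℝ) (n * x) with hkx | hkx
    · rw [hpiece k x hx.1 hkx hxlt.le]
      intro hcon
      have : (1 - (n * x - k)) * (v k - v (k + 1)) = 0 := by linarith
      rcases mul_eq_zero.1 this with h | h
      · linarith
      · exact hne k hk (by linarith)
    · cases k with
      | zero => simp only [Nat.cast_zero] at hkx; nlinarith [mul_nonneg hn'.le hx.1]
      | succ k =>
        have h1 := hbd k (by omega) x hx.1 (by push_cast at hkx; exact hkx.le)
        intro hcon
        rw [hcon, mem_uIcc] at h1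
        have h2 := Z.bd (k + 1) hk (contourPoint h k) ⟨Z.nonneg (by omega), Z.mono hk (by omega)⟩
        have h3 := hne (k + 1) hk
        have h4 : v k ≠ v (k + 2) := Z.new (k + 1) hk _ ⟨Z.nonneg (by omega),
          (Z.lt k (by omega)).trans (Z.lt (k + 1) hk)⟩
        change v k ∈ uIcc (v (k + 1)) (v (k + 2)) at h2
        rw [mem_uIcc] at h2
        rcases h1 with h1 | h1 <;> rcases h2 with h2 | h2
        · exact h3 (le_antisymm (h2.1.trans h1.1) h1.2)
        · exact h4 (le_antisymm h1.1 h2.1)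
        · exact h4 (le_antisymm h2.2 h1.2)
        · exact h3 (le_antisymm h1.1 (h1.2.trans h2.2))
  · intro x hx
    refine ⟨x, ⟨hx.1, ?_⟩, rfl⟩
    rw [div_self hn'.ne']; exact hx.2
  · rw [div_self hn'.ne']
  · intro k hk x hx
    simp only [hnode] at hx ⊢
    have h1 := hx.1
    rw [div_le_iff₀ hn'] at h1
    have h0 : 0 ≤ x := le_trans (by positivity) hx.1
    rw [hpiece k x h0 (by linarith) ((hdiv k x).1 hx.2)]
    push_cast
    field_simp
    ring

end contour

/-! ### Bands of two running chains -/

/-- A pair of running depth and height functions. -/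
structure Running (d u : ℝ → ℝ) : Prop where
  dm : Monotone d
  um : Monotone u
  dc : Continuous d
  uc : Continuous u
  d0 : d 0 = 0
  u0 : u 0 = 0
  one : ∀ y, 0 < y → (∀ x ∈ Ico 0 y, d x < d y) → (∀ x ∈ Ico 0 y, u x < u y) → False

namespace Running

variable {d u : ℝ → ℝ}

lemma swap (R : Running d u) : Running u d :=
  ⟨R.um, R.dm, R.uc, R.dc, R.u0, R.d0, fun y hy h1 h2 => R.one y hy h2 h1⟩

/-- Both functions are monotone, so the length `d + u` parametrizes the chain. Matching hulls by the
intermediate value theorem can then use this one number. -/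
lemma eq_of_sum (R : Running d u) {x y : ℝ} (h : d x + u x = d y + u y) : d x = d y ∧ u x = u y := by
  rcases le_total x y with hxy | hxy
  · have := R.dm hxy; have := R.um hxy
    constructor <;> linarith
  · have := R.dm hxy; have := R.um hxy
    constructor <;> linarith

lemma sc (R : Running d u) : Continuous fun x => d x + u x := R.dc.add R.uc

/-- A hull that first appears at `m` is new through exactly one of its ends, because `one` forbids
both ends from being new at once. -/
lemma new_cases (R : Running d u) {m : ℝ} (hm : 0 < m)
    (H : ∀ x ∈ Ico 0 m, ¬ (d x = d m ∧ u x = u m)) :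
    ((∀ x ∈ Ico 0 m, d x < d m) ∧ ∃ x ∈ Ico 0 m, u x = u m) ∨
    ((∀ x ∈ Ico 0 m, u x < u m) ∧ ∃ x ∈ Ico 0 m, d x = d m) := by
  by_cases h1 : ∃ x ∈ Ico 0 m, d x = d m
  · right
    obtain ⟨x, hx, ex⟩ := h1
    refine ⟨fun y hy => lt_of_le_of_ne (R.um hy.2.le) fun hcon => ?_, x, hx, ex⟩
    refine H (max x y) ⟨le_max_of_le_left hx.1, max_lt hx.2 hy.2⟩ ⟨?_, ?_⟩
    · exact le_antisymm (R.dm (max_lt hx.2 hy.2).le) (ex ▸ R.dm (le_max_left _ _))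
    · exact le_antisymm (R.um (max_lt hx.2 hy.2).le) (hcon ▸ R.um (le_max_right _ _))
  · left
    have h2 : ∀ x ∈ Ico 0 m, d x < d m := fun x hx =>
      lt_of_le_of_ne (R.dm hx.2.le) fun hcon => h1 ⟨x, hx, hcon⟩
    refine ⟨h2, ?_⟩
    by_contra hcon
    exact R.one m hm h2 fun x hx => lt_of_le_of_ne (R.um hx.2.le) fun e => hcon ⟨x, hx, e⟩

end Running

/-- The union of the hull of the first chain at `x` and of the second at `y` lies in the first. -/
def In (d u d' u' : ℝ → ℝ) (x y : ℝ) : Prop :=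
  ∃ z ∈ Icc (0 : ℝ) 1, d z = max (d x) (d' y) ∧ u z = max (u x) (u' y)

lemma In.swap {d u d' u' : ℝ → ℝ} {x y : ℝ} (h : In d u d' u' x y) : In u d u' d' x y := by
  obtain ⟨z, hz, h1, h2⟩ := h; exact ⟨z, hz, h2, h1⟩

/-- The way in which the two chains first reach a common hull at `m0`, `M0`: the first chain reaches
its depth early (at `A`), the second its height early (at `e`). -/
structure Turn (dL uL dR uR : ℝ → ℝ) (A e m0 M0 : ℝ) : Prop where
  Alt : A < m0
  elt : e < M0
  dA : dL A = dL m0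
  Anew : ∀ m ∈ Ico 0 A, dL m < dL m0
  mnew : ∀ m ∈ Ico 0 m0, uL m < uL m0
  ue : uR e = uR M0
  enew : ∀ M ∈ Ico 0 e, uR M < uR M0
  Mnew : ∀ M ∈ Ico 0 M0, dR M < dR M0

lemma Turn.mirror {dL uL dR uR : ℝ → ℝ} {A e m0 M0 : ℝ} (t : Turn dL uL dR uR A e m0 M0) :
    Turn uR dR uL dL e A M0 m0 := ⟨t.elt, t.Alt, t.ue, t.enew, t.Mnew, t.dA, t.Anew, t.mnew⟩

/-- A maximal interval of common hulls of two chains. -/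
structure NBand (dL uL dR uR : ℝ → ℝ) (A e m0 M0 p r : ℝ) : Prop where
  A0 : 0 ≤ A
  Am : A ≤ m0
  mp : m0 ≤ p
  p1 : p ≤ 1
  e0 : 0 ≤ e
  eM : e ≤ M0
  Mr : M0 ≤ r
  r1 : r ≤ 1
  kL : ∀ m ∈ Icc m0 p, ∃ M ∈ Icc (0 : ℝ) 1, dR M = dL m ∧ uR M = uL m
  kR : ∀ M ∈ Icc M0 r, ∃ m ∈ Icc (0 : ℝ) 1, dL m = dR M ∧ uL m = uR M
  E0d : dL m0 = dR M0
  E0u : uL m0 = uR M0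
  E1d : dL p = dR r
  E1u : uL p = uR r
  exL : ∀ m ∈ Ioc p 1, ∃ m' ∈ Ioc p m, ∀ M ∈ Icc (0 : ℝ) 1, ¬ (dR M = dL m' ∧ uR M = uL m')
  exR : ∀ M ∈ Ioc r 1, ∃ M' ∈ Ioc r M, ∀ m ∈ Icc (0 : ℝ) 1, ¬ (dL m = dR M' ∧ uL m = uR M')
  turn : (A = 0 ∧ e = 0 ∧ m0 = 0 ∧ M0 = 0) ∨ Turn dL uL dR uR A e m0 M0 ∨ Turn uL dL uR dR A e m0 M0

namespace NBand

variable {dL uL dR uR : ℝ → ℝ} {A e m0 M0 p r : ℝ}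

lemma swap (B : NBand dL uL dR uR A e m0 M0 p r) : NBand uL dL uR dR A e m0 M0 p r where
  A0 := B.A0
  Am := B.Am
  mp := B.mp
  p1 := B.p1
  e0 := B.e0
  eM := B.eM
  Mr := B.Mr
  r1 := B.r1
  kL m hm := by obtain ⟨M, hM, h1, h2⟩ := B.kL m hm; exact ⟨M, hM, h2, h1⟩
  kR m hm := by obtain ⟨M, hM, h1, h2⟩ := B.kR m hm; exact ⟨M, hM, h2, h1⟩
  E0d := B.E0u
  E0u := B.E0d
  E1d := B.E1u
  E1u := B.E1d
  exL m hm := by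
    obtain ⟨m', hm', h⟩ := B.exL m hm
    exact ⟨m', hm', fun M hM h' => h M hM h'.symm⟩
  exR m hm := by
    obtain ⟨m', hm', h⟩ := B.exR m hm
    exact ⟨m', hm', fun M hM h' => h M hM h'.symm⟩
  turn := by have := B.turn; tauto

lemma mirror (B : NBand dL uL dR uR A e m0 M0 p r) : NBand dR uR dL uL e A M0 m0 r p where
  A0 := B.e0
  Am := B.eM
  mp := B.Mr
  p1 := B.r1
  e0 := B.A0
  eM := B.Am
  Mr := B.mp
  r1 := B.p1
  kL := B.kR
  kR := B.kL
  E0d := B.E0d.symm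
  E0u := B.E0u.symm
  E1d := B.E1d.symm
  E1u := B.E1u.symm
  exL := B.exR
  exR := B.exL
  turn := by
    rcases B.turn with h | h | h
    · tauto
    · exact Or.inr (Or.inr h.mirror)
    · exact Or.inr (Or.inl h.mirror)

/-- The right hull at `e` already has the height that the left chain attains only at `m0`, when its
depth is complete. A left hull containing that height must therefore have the full depth, which a
part before `A` cannot supply. -/
lemma left_le_of_turn (L : Running dL uL) (t : Turn dL uL dR uR A e m0 M0)
    (e0 : 0 ≤ e) (E0d : dL m0 = dR M0) (E0u : uL m0 = uR M0) {m : ℝ} (hm : 0 ≤ m)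
    (h : In dL uL dR uR m e) : A ≤ m := by
  by_contra hcon
  rw [not_le] at hcon
  obtain ⟨z, hz, h1, h2⟩ := h
  have h3 := t.Anew m ⟨hm, hcon⟩
  have h4 := t.Mnew e ⟨e0, t.elt⟩
  have h5 : dL z < dL m0 := by rw [h1]; exact max_lt h3 (by linarith)
  have h6 : z < m0 := by
    by_contra h; exact absurd (L.dm (not_lt.1 h)) (not_le.2 h5)
  have h7 := t.mnew z ⟨hz.1, h6⟩
  rw [h2, t.ue, ← E0u] at h7
  exact absurd (le_max_right _ _) (not_le.2 h7)

lemma left_le_of_in (L : Running dL uL) (B : NBand dL uL dR uR A e m0 M0 p r) {m : ℝ}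
    (hm : 0 ≤ m) (h : In dL uL dR uR m e) : A ≤ m := by
  rcases B.turn with t | t | t
  · rw [t.1]; exact hm
  · exact left_le_of_turn L t B.e0 B.E0d B.E0u hm h
  · exact left_le_of_turn L.swap t B.e0 B.E0u B.E0d hm h.swap

/-- Beyond `r` a right hull contains every left hull up to `p`, so a union of the two is that right
hull; by maximality of the band it is not always a left hull. -/
lemma exists_forall_not_in (L : Running dL uL) (R : Running dR uR) (B : NBand dL uL dR uR A e m0 M0 p r) {M : ℝ}
    (hM : M ∈ Ioc r 1) : ∃ M' ∈ Ioc r M, ∀ m ∈ Icc 0 p, ¬ In dL uL dR uR m M' := by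
  obtain ⟨M', hM', h⟩ := B.exR M hM
  refine ⟨M', hM', fun m hm => ?_⟩
  rintro ⟨z, hz, h1, h2⟩
  refine h z hz ⟨?_, ?_⟩
  · rw [h1]; apply max_eq_right
    exact (L.dm hm.2).trans (B.E1d.trans_le (R.dm hM'.1.le))
  · rw [h2]; apply max_eq_right
    exact (L.um hm.2).trans (B.E1u.trans_le (R.um hM'.1.le))

/-- For `y ≥ M0` the right hull is common and absorbs the left one. For `y < M0` the depth is
already that of `A`, and the left chain realizes the required height between `A` and `m0`. -/
lemma in_of_turn (L : Running dL uL) (R : Running dR uR) (B : NBand dL uL dR uR A e m0 M0 p r)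
    (t : Turn dL uL dR uR A e m0 M0) {y : ℝ} (hy : y ∈ Icc 0 r) : In dL uL dR uR A y := by
  rcases le_or_gt M0 y with h | h
  · obtain ⟨m, hm, h1, h2⟩ := B.kR y ⟨h, hy.2⟩
    refine ⟨m, hm, ?_, ?_⟩
    · rw [h1, max_eq_right]; rw [t.dA, B.E0d]; exact R.dm h
    · rw [h2, max_eq_right]; exact (L.um B.Am).trans (B.E0u.trans_le (R.um h))
  · have h1 := t.Mnew y ⟨hy.1, h⟩
    have hle : max (uL A) (uR y) ≤ uL m0 := max_le (L.um B.Am) (by rw [B.E0u]; exact R.um h.le)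
    obtain ⟨m, hm, em⟩ := intermediate_value_Icc B.Am L.uc.continuousOn
      (show max (uL A) (uR y) ∈ Icc (uL A) (uL m0) from ⟨le_max_left _ _, hle⟩)
    refine ⟨m, ⟨B.A0.trans hm.1, hm.2.trans (B.mp.trans B.p1)⟩, ?_, em⟩
    rw [max_eq_left (by rw [t.dA, B.E0d]; exact h1.le)]
    exact le_antisymm ((L.dm hm.2).trans t.dA.ge) (L.dm hm.1)

lemma in_right (L : Running dL uL) (R : Running dR uR) (B : NBand dL uL dR uR A e m0 M0 p r)
    {y : ℝ} (hy : y ∈ Icc 0 r) : In dL uL dR uR A y := by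
  rcases B.turn with t | t | t
  · obtain ⟨m, hm, h1, h2⟩ := B.kR y ⟨by rw [t.2.2.2]; exact hy.1, hy.2⟩
    refine ⟨m, hm, ?_, ?_⟩
    · rw [h1, t.1, L.d0, max_eq_right]; rw [← R.d0]; exact R.dm hy.1
    · rw [h2, t.1, L.u0, max_eq_right]; rw [← R.u0]; exact R.um hy.1
  · exact in_of_turn L R B t hy
  · exact (in_of_turn L.swap R.swap B.swap t hy).swap

end NBand

/-! ### Existence of bands of common hulls -/

lemma exists_right_end {K : Set ℝ} (hK : IsClosed K) {x b : ℝ} (hx : x ∈ K) (hxb : x ≤ b) :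
    ∃ p ∈ Icc x b, Icc x p ⊆ K ∧ ∀ m ∈ Ioc p b, ∃ m' ∈ Ioc p m, m' ∉ K := by
  set S := {m | m ∈ Icc x b ∧ Icc x m ⊆ K} with hS
  have hxS : x ∈ S := ⟨⟨le_rfl, hxb⟩, by rw [Icc_self]; exact singleton_subset_iff.2 hx⟩
  have hb : BddAbove S := ⟨b, fun m hm => hm.1.2⟩
  have h1 : x ≤ sSup S := le_csSup hb hxS
  have hsub : Icc x (sSup S) ⊆ K := by
    rcases h1.eq_or_lt with h | h
    · rw [← h, Icc_self]; exact singleton_subset_iff.2 hx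
    · rw [← closure_Ico h.ne]
      refine closure_minimal (fun y hy => ?_) hK
      obtain ⟨m, hm, hym⟩ := exists_lt_of_lt_csSup ⟨x, hxS⟩ hy.2
      exact hm.2 ⟨hy.1, hym.le⟩
  refine ⟨sSup S, ⟨h1, csSup_le ⟨x, hxS⟩ fun m hm => hm.1.2⟩, hsub, fun m hm => ?_⟩
  by_contra hcon
  push Not at hcon
  have : m ∈ S := ⟨⟨h1.trans hm.1.le, hm.2⟩, fun y hy => by
    rcases le_or_gt y (sSup S) with h | h
    · exact hsub ⟨hy.1, h⟩
    · exact hcon y ⟨h, hy.2⟩⟩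
  exact absurd (le_csSup hb this) (not_le.2 hm.1)

lemma exists_left_end {K : Set ℝ} (hK : IsClosed K) {x b : ℝ} (hx : x ∈ K) (hxb : b ≤ x) :
    ∃ p ∈ Icc b x, Icc p x ⊆ K ∧ ∀ m ∈ Ico b p, ∃ m' ∈ Ico m p, m' ∉ K := by
  obtain ⟨p, hp, h1, h2⟩ := exists_right_end (K := (fun y => - y) ⁻¹' K)
    (hK.preimage continuous_neg) (x := -x) (b := -b) (by simpa using hx) (by linarith)
  refine ⟨-p, ⟨by linarith [hp.2], by linarith [hp.1]⟩, fun y hy => ?_, fun m hm => ?_⟩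
  · have := @h1 (-y) ⟨by linarith [hy.2], by linarith [hy.1]⟩
    simpa using this
  · obtain ⟨m', hm', h⟩ := h2 (-m) ⟨by linarith [hm.2], by linarith [hm.1]⟩
    exact ⟨-m', ⟨by linarith [hm'.2], by linarith [hm'.1]⟩, h⟩

lemma exists_first_eq {f : ℝ → ℝ} (fm : Monotone f) (fc : Continuous f) {m0 : ℝ} (h0 : 0 ≤ m0) :
    ∃ A ∈ Icc 0 m0, f A = f m0 ∧ ∀ m ∈ Ico 0 A, f m < f m0 := by
  obtain ⟨A, hA, e, h⟩ := exists_first fc ⟨m0, ⟨h0, le_rfl⟩, rfl⟩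
  exact ⟨A, hA, e, fun m hm => lt_of_le_of_ne (fm (hm.2.le.trans hA.2)) (h m hm)⟩

/-- If both chains arrived at their common hull by raising the same end, with the other end settled,
hulls slightly earlier would also be common, against the choice of `m0`. -/
lemma not_both_new {dL uL dR uR : ℝ → ℝ} (L : Running dL uL) (R : Running dR uR) {m0 M0 : ℝ}
    (hM1 : M0 ≤ 1) (Ed : dL m0 = dR M0) (Eu : uL m0 = uR M0)
    (hK : ∀ m ∈ Ico 0 m0, ∃ m' ∈ Ico m m0, ¬ ∃ M ∈ Icc (0 : ℝ) 1, dR M = dL m' ∧ uR M = uL m')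
    (hL : (∀ x ∈ Ico 0 m0, uL x < uL m0) ∧ ∃ x ∈ Ico 0 m0, dL x = dL m0)
    (hR : (∀ x ∈ Ico 0 M0, uR x < uR M0) ∧ ∃ x ∈ Ico 0 M0, dR x = dR M0) : False := by
  obtain ⟨hLu, mA, hmA, emA⟩ := hL
  obtain ⟨hRu, MA, hMA, eMA⟩ := hR
  have h1 := hLu mA hmA
  have h2 := hRu MA hMA
  obtain ⟨m, hm, em⟩ := intermediate_value_Icc hmA.2.le L.uc.continuousOn
    (show max (uL mA) (uR MA) ∈ Icc (uL mA) (uL m0) from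
      ⟨le_max_left _ _, max_le h1.le (by rw [Eu]; exact h2.le)⟩)
  have hmlt : m < m0 := lt_of_le_of_ne hm.2 (by
    rintro rfl
    rcases max_choice (uL mA) (uR MA) with h | h <;> rw [h] at em <;> linarith)
  obtain ⟨m', hm', hno⟩ := hK m ⟨hmA.1.trans hm.1, hmlt⟩
  obtain ⟨M, hM, eM⟩ := intermediate_value_Icc hMA.2.le R.uc.continuousOn
    (show uL m' ∈ Icc (uR MA) (uR M0) from
      ⟨((le_max_right _ _).trans em.ge).trans (L.um hm'.1), by rw [← Eu]; exact L.um hm'.2.le⟩)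
  refine hno ⟨M, ⟨hMA.1.trans hM.1, hM.2.trans hM1⟩, ?_, eM⟩
  have h3 : dR M = dR M0 := le_antisymm (R.dm hM.2) (eMA ▸ R.dm hM.1)
  have h4 : dL m' = dL m0 := le_antisymm (L.dm hm'.2.le) (emA ▸ L.dm (hm.1.trans hm'.1))
  rw [h3, h4, Ed]

lemma turn_exists {dL uL dR uR : ℝ → ℝ} (L : Running dL uL) (R : Running dR uR) {m0 M0 : ℝ}
    (hL : (∀ x ∈ Ico 0 m0, uL x < uL m0) ∧ ∃ x ∈ Ico 0 m0, dL x = dL m0)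
    (hR : (∀ x ∈ Ico 0 M0, dR x < dR M0) ∧ ∃ x ∈ Ico 0 M0, uR x = uR M0) :
    ∃ A e, 0 ≤ A ∧ 0 ≤ e ∧ Turn dL uL dR uR A e m0 M0 := by
  obtain ⟨hLu, mA, hmA, emA⟩ := hL
  obtain ⟨hRu, MA, hMA, eMA⟩ := hR
  obtain ⟨A, hA, eA, nA⟩ := exists_first_eq L.dm L.dc (hmA.1.trans hmA.2.le)
  obtain ⟨e, he, ee, ne⟩ := exists_first_eq R.um R.uc (hMA.1.trans hMA.2.le)
  refine ⟨A, e, hA.1, he.1, ⟨?_, ?_, eA, nA, hLu, ee, ne, hRu⟩⟩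
  · by_contra h
    exact (nA mA ⟨hmA.1, hmA.2.trans_le (not_lt.1 h)⟩).ne emA
  · by_contra h
    exact (ne MA ⟨hMA.1, hMA.2.trans_le (not_lt.1 h)⟩).ne eMA

/-- If `Ml ≤ e`, the depth of the union must come from `mr`, so `A ≤ mr`; following the right path
to `A` then forces `e ≤ Mr`, a contradiction. Once `e < Ml`, the left path followed to `e` gives `A
≤ ml`. -/
lemma turn_position {dL uL dR uR : ℝ → ℝ} (L : Running dL uL) (R : Running dR uR)
    {A e m0 M0 ml mr Ml Mr : ℝ} (t : Turn dL uL dR uR A e m0 M0) (hA : 0 ≤ A) (he : 0 ≤ e)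
    (Ed : dL m0 = dR M0) (Eu : uL m0 = uR M0) (hmlr : ml < mr) (hMrl : Mr < Ml) (hMl0 : 0 ≤ Ml)
    (pathL : ∀ M' ∈ Icc 0 Ml, ∃ m' ∈ Icc 0 ml, In dL uL dR uR m' M')
    (pathR : ∀ m' ∈ Icc 0 mr, ∃ M' ∈ Icc 0 Mr, In dR uR dL uL M' m')
    (hE : dL m0 ≤ max (dL mr) (dR Ml)) : e < Ml ∧ A < mr := by
  have h1 : e < Ml := by
    by_contra hcon
    rw [not_lt] at hcon
    have h2 : dR Ml < dL m0 := by rw [Ed]; exact t.Mnew Ml ⟨hMl0, hcon.trans_lt t.elt⟩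
    have h3 : dL m0 ≤ dL mr := (le_max_iff.1 hE).resolve_right (not_le.2 h2)
    have h4 : A ≤ mr := by
      by_contra h
      have := L.dm (not_le.1 h).le
      have h5 : dL mr = dL m0 := le_antisymm (this.trans t.dA.le) h3
      rcases lt_or_ge mr 0 with h6 | h6
      · rcases hA.eq_or_lt with h7 | h7
        · have := t.Alt
          have h8 := t.mnew 0 ⟨le_rfl, hA.trans_lt this⟩
          obtain ⟨m', hm', -⟩ := pathL 0 ⟨le_rfl, hMl0⟩
          linarith [hm'.1, hm'.2]
        · obtain ⟨m', hm', -⟩ := pathL 0 ⟨le_rfl, hMl0⟩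
          linarith [hm'.1, hm'.2]
      · exact (t.Anew mr ⟨h6, not_le.1 h⟩).ne h5
    obtain ⟨M', hM', hin⟩ := pathR A ⟨hA, h4⟩
    have := NBand.left_le_of_turn R.swap t.mirror hA Eu.symm Ed.symm hM'.1 hin.swap
    linarith [hM'.2]
  obtain ⟨m', hm', hin⟩ := pathL e ⟨he, h1.le⟩
  have := NBand.left_le_of_turn L t he Ed Eu hm'.1 hin
  exact ⟨h1, by linarith [hm'.2]⟩

/-- The union of the left hull at `mr` and the right hull at `Ml` belongs to both chains. The band
is the component of common hulls around it. -/
lemma exists_nband {dL uL dR uR : ℝ → ℝ} (L : Running dL uL) (R : Running dR uR)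
    {ml mr Ml Mr : ℝ} (hml : 0 ≤ ml) (hmlr : ml < mr) (hmr : mr ≤ 1) (hMr : 0 ≤ Mr) (hMrl : Mr < Ml)
    (hMl : Ml ≤ 1)
    (hL : In dL uL dR uR ml Ml) (hR : In dR uR dL uL Mr mr)
    (pathL : ∀ M' ∈ Icc 0 Ml, ∃ m' ∈ Icc 0 ml, In dL uL dR uR m' M')
    (pathR : ∀ m' ∈ Icc 0 mr, ∃ M' ∈ Icc 0 Mr, In dR uR dL uL M' m') :
    ∃ A e m0 M0 p r, NBand dL uL dR uR A e m0 M0 p r ∧ e < Ml ∧ Ml ≤ r ∧ A < mr ∧ mr ≤ p := by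
  -- In a chain the union of two hulls is the later one, so the later of `z` and `mr` works.
  obtain ⟨mE, hmE, dmE, umE⟩ : ∃ m ∈ Icc (0 : ℝ) 1, dL m = max (dL mr) (dR Ml) ∧
      uL m = max (uL mr) (uR Ml) := by
    obtain ⟨z, hz, h1, h2⟩ := hL
    refine ⟨max z mr, ⟨le_max_of_le_left hz.1, max_le hz.2 hmr⟩, ?_, ?_⟩
    · rw [L.dm.map_max, h1, max_comm, ← max_assoc, max_eq_left (L.dm hmlr.le)]
    · rw [L.um.map_max, h2, max_comm, ← max_assoc, max_eq_left (L.um hmlr.le)]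
  obtain ⟨ME, hME, dME, uME⟩ : ∃ M ∈ Icc (0 : ℝ) 1, dR M = max (dL mr) (dR Ml) ∧
      uR M = max (uL mr) (uR Ml) := by
    obtain ⟨z, hz, h1, h2⟩ := hR
    refine ⟨max z Ml, ⟨le_max_of_le_left hz.1, max_le hz.2 hMl⟩, ?_, ?_⟩
    · rw [R.dm.map_max, h1, max_right_comm, max_eq_right (R.dm hMrl.le), max_comm]
    · rw [R.um.map_max, h2, max_right_comm, max_eq_right (R.um hMrl.le), max_comm]
  set K := {m : ℝ | m ∈ Icc (0 : ℝ) 1 ∧ ∃ M ∈ Icc (0 : ℝ) 1, dR M = dL m ∧ uR M = uL m} with hKdef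
  have hK : IsClosed K := by
    have hcl : IsClosed {x : ℝ × ℝ | dR x.2 = dL x.1 ∧ uR x.2 = uL x.1} := by
      have := L.dc; have := L.uc; have := R.dc; have := R.uc
      exact (isClosed_eq (by fun_prop) (by fun_prop)).inter (isClosed_eq (by fun_prop) (by fun_prop))
    have : K = Prod.fst '' ((Icc (0 : ℝ) 1 ×ˢ Icc (0 : ℝ) 1) ∩
        {x : ℝ × ℝ | dR x.2 = dL x.1 ∧ uR x.2 = uL x.1}) := by
      ext m
      constructor
      · rintro ⟨hm, M, hM, h⟩
        exact ⟨(m, M), ⟨⟨hm, hM⟩, h⟩, rfl⟩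
      · rintro ⟨⟨m, M⟩, ⟨⟨hm, hM⟩, h⟩, rfl⟩
        exact ⟨hm, M, hM, h⟩
    rw [this]
    exact (((isCompact_Icc.prod isCompact_Icc).inter_right hcl).image continuous_fst).isClosed
  have hmEK : mE ∈ K := ⟨hmE, ME, hME, by rw [dME, dmE], by rw [uME, umE]⟩
  obtain ⟨p, hp, hpK, hpex⟩ := exists_right_end hK hmEK hmE.2
  obtain ⟨m0, hm0, hm0K, hm0ex⟩ := exists_left_end hK hmEK hmE.1
  have hKK : ∀ m ∈ Icc m0 p, m ∈ K := fun m hm => by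
    rcases le_total m mE with h | h
    · exact hm0K ⟨hm.1, h⟩
    · exact hpK ⟨h, hm.2⟩
  have hmp : m0 ≤ p := hm0.2.trans hp.1
  have hcomp : ∀ a b : ℝ, IsCompact {M : ℝ | M ∈ Icc (0 : ℝ) 1 ∧ dR M = a ∧ uR M = b} := fun a b =>
    isCompact_Icc.inter_right ((isClosed_eq R.dc continuous_const).inter
      (isClosed_eq R.uc continuous_const))
  obtain ⟨-, Mp, hMp, hMp'⟩ := hKK p ⟨hmp, le_rfl⟩
  -- On the right take the greatest parameter for the final hull and, below, the least for the
  -- initial hull, so that stretches of constant hull belong to the band.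
  obtain ⟨r, ⟨hr, hrd, hru⟩, hrmax⟩ := (hcomp (dL p) (uL p)).exists_isGreatest ⟨Mp, hMp, hMp'⟩
  obtain ⟨-, Mm, hMm, hMm'⟩ := hKK m0 ⟨le_rfl, hmp⟩
  obtain ⟨M0, ⟨hM0, hM0d, hM0u⟩, hM0min⟩ := (hcomp (dL m0) (uL m0)).exists_isLeast ⟨Mm, hMm, hMm'⟩
  have hM0r : M0 ≤ r := by
    by_contra hcon
    rw [not_le] at hcon
    refine absurd (hM0min ⟨hr, ?_, ?_⟩) (not_le.2 hcon)
    · exact le_antisymm ((R.dm hcon.le).trans hM0d.le) (hrd ▸ L.dm hmp)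
    · exact le_antisymm ((R.um hcon.le).trans hM0u.le) (hru ▸ L.um hmp)
  have hmleast : ∀ m ∈ Ico 0 m0, ¬ (dL m = dL m0 ∧ uL m = uL m0) := by
    rintro m hm ⟨h1, h2⟩
    obtain ⟨m', hm', hno⟩ := hm0ex m hm
    refine hno ⟨⟨hm.1.trans hm'.1, hm'.2.le.trans (hmp.trans hp.2)⟩, M0, hM0, ?_, ?_⟩
    · rw [hM0d]; exact le_antisymm (h1 ▸ L.dm hm'.1) (L.dm hm'.2.le)
    · rw [hM0u]; exact le_antisymm (h2 ▸ L.um hm'.1) (L.um hm'.2.le)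
  have hMleast : ∀ M ∈ Ico 0 M0, ¬ (dR M = dR M0 ∧ uR M = uR M0) := by
    rintro M hM ⟨h1, h2⟩
    exact absurd (hM0min ⟨⟨hM.1, hM.2.le.trans hM0.2⟩, h1.trans hM0d, h2.trans hM0u⟩) (not_le.2 hM.2)
  have hkR : ∀ M ∈ Icc M0 r, ∃ m ∈ Icc (0 : ℝ) 1, dL m = dR M ∧ uL m = uR M := by
    intro M hM
    have h1 := R.dm hM.1; have h2 := R.um hM.1; have h3 := R.dm hM.2; have h4 := R.um hM.2
    obtain ⟨m, hm, em⟩ := intermediate_value_Icc hmp L.sc.continuousOn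
      (show dR M + uR M ∈ Icc (dL m0 + uL m0) (dL p + uL p) from ⟨by linarith, by linarith⟩)
    obtain ⟨hm01, M', hM', h5, h6⟩ := hKK m hm
    have := R.eq_of_sum (x := M') (y := M) (by simp only at em; linarith)
    exact ⟨m, hm01, by rw [← h5, this.1], by rw [← h6, this.2]⟩
  have hexR : ∀ M ∈ Ioc r 1, ∃ M' ∈ Ioc r M, ∀ m ∈ Icc (0 : ℝ) 1, ¬ (dL m = dR M' ∧ uL m = uR M') := by
    intro M hM
    by_contra hcon
    push Not at hcon
    obtain ⟨m, hm, h1, h2⟩ := hcon M ⟨hM.1, le_rfl⟩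
    have hpm : p < m := by
      by_contra h
      have h3 := L.dm (not_lt.1 h); have h4 := L.um (not_lt.1 h)
      have h5 := R.dm hM.1.le; have h6 := R.um hM.1.le
      exact absurd (hrmax ⟨⟨hr.1.trans hM.1.le, hM.2⟩, by linarith, by linarith⟩) (not_le.2 hM.1)
    obtain ⟨m', hm', hno⟩ := hpex m ⟨hpm, hm.2⟩
    have h3 := L.dm hm'.1.le; have h4 := L.um hm'.1.le; have h5 := L.dm hm'.2; have h6 := L.um hm'.2
    obtain ⟨M', hM', eM'⟩ := intermediate_value_Icc hM.1.le R.sc.continuousOn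
      (show dL m' + uL m' ∈ Icc (dR r + uR r) (dR M + uR M) from ⟨by linarith, by linarith⟩)
    simp only at eM'
    refine hno ⟨⟨hp.1.trans' hmE.1 |>.trans hm'.1.le, hm'.2.trans hm.2⟩, M',
      ⟨hr.1.trans hM'.1, hM'.2.trans hM.2⟩, ?_⟩
    rcases hM'.1.eq_or_lt with h7 | h7
    · rw [← h7] at eM' ⊢
      have := L.eq_of_sum (x := p) (y := m') (by linarith)
      exact ⟨by rw [hrd, this.1], by rw [hru, this.2]⟩
    · obtain ⟨m'', hm'', h8, h9⟩ := hcon M' ⟨h7, hM'.2⟩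
      have := L.eq_of_sum (x := m'') (y := m') (by linarith)
      exact ⟨by rw [← h8, this.1], by rw [← h9, this.2]⟩
  have hkL : ∀ m ∈ Icc m0 p, ∃ M ∈ Icc (0 : ℝ) 1, dR M = dL m ∧ uR M = uL m := fun m hm => (hKK m hm).2
  have hp0 : 0 ≤ p := hmE.1.trans hp.1
  have hexL : ∀ m ∈ Ioc p 1, ∃ m' ∈ Ioc p m, ∀ M ∈ Icc (0 : ℝ) 1, ¬ (dR M = dL m' ∧ uR M = uL m') := by
    intro m hm
    obtain ⟨m', hm', h⟩ := hpex m hm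
    exact ⟨m', hm', fun M hM h' => h ⟨⟨hp0.trans hm'.1.le, hm'.2.trans hm.2⟩, M, hM, h'⟩⟩
  have hMlr : Ml ≤ r := by
    by_contra hcon
    rw [not_le] at hcon
    have h1 := L.dm hp.1; have h2 := L.um hp.1
    have h3 := R.dm hcon.le; have h4 := R.um hcon.le
    have h5 := le_max_right (dL mr) (dR Ml); have h6 := le_max_right (uL mr) (uR Ml)
    exact absurd (hrmax ⟨⟨hMr.trans hMrl.le, hMl⟩, by linarith, by linarith⟩) (not_le.2 hcon)
  have hmrp : mr ≤ p := by
    by_contra hcon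
    rw [not_le] at hcon
    obtain ⟨m', hm', h⟩ := hexL mr ⟨hcon, hmr⟩
    have h1 := L.dm hp.1; have h2 := L.um hp.1
    have h3 := L.dm hm'.1.le; have h4 := L.um hm'.1.le
    have h7 := L.dm hm'.2; have h8 := L.um hm'.2
    have h5 := le_max_left (dL mr) (dR Ml); have h6 := le_max_left (uL mr) (uR Ml)
    exact h r hr ⟨by linarith, by linarith⟩
  have key : ∀ A e, 0 ≤ A → 0 ≤ e → A ≤ m0 → e ≤ M0 →
      ((A = 0 ∧ e = 0 ∧ m0 = 0 ∧ M0 = 0) ∨ Turn dL uL dR uR A e m0 M0 ∨ Turn uL dL uR dR A e m0 M0) →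
      ∃ A e m0 M0 p r, NBand dL uL dR uR A e m0 M0 p r ∧ e < Ml ∧ Ml ≤ r ∧ A < mr ∧ mr ≤ p := by
    intro A e hA he hAm heM ht
    refine ⟨A, e, m0, M0, p, r, ⟨hA, hAm, hmp, hp.2, he, heM, hM0r, hr.2, hkL, hkR, hM0d.symm, hM0u.symm,
      hrd.symm, hru.symm, hexL, hexR, ht⟩, ?_⟩
    suffices e < Ml ∧ A < mr from ⟨this.1, hMlr, this.2, hmrp⟩
    rcases ht with t | t | t
    · rw [t.1, t.2.1]; exact ⟨hMr.trans_lt hMrl, hml.trans_lt hmlr⟩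
    · exact turn_position L R t hA he hM0d.symm hM0u.symm hmlr hMrl (hMr.trans hMrl.le) pathL pathR
        (dmE ▸ L.dm hm0.2)
    · refine turn_position L.swap R.swap t hA he hM0u.symm hM0d.symm hmlr hMrl (hMr.trans hMrl.le)
        (fun M' hM' => ?_) (fun m' hm' => ?_) (umE ▸ L.um hm0.2)
      · obtain ⟨m', hm', h⟩ := pathL M' hM'; exact ⟨m', hm', h.swap⟩
      · obtain ⟨m', hm', h⟩ := pathR m' hm'; exact ⟨m', hm', h.swap⟩
  rcases hm0.1.eq_or_lt with h | hm0pos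
  · have hM00 : M0 = 0 := by
      refine le_antisymm (hM0min ⟨by simp, ?_, ?_⟩) hM0.1
      · rw [R.d0, ← h, L.d0]
      · rw [R.u0, ← h, L.u0]
    exact key 0 0 le_rfl le_rfl hm0.1 hM0.1 (Or.inl ⟨rfl, rfl, h.symm, hM00⟩)
  · have hM0pos : 0 < M0 := by
      rcases hM0.1.eq_or_lt with h | h
      · exfalso
        refine hmleast 0 ⟨le_rfl, hm0pos⟩ ⟨?_, ?_⟩
        · rw [← hM0d, ← h, R.d0, L.d0]
        · rw [← hM0u, ← h, R.u0, L.u0]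
      · exact h
    have hm0ex' : ∀ m ∈ Ico 0 m0, ∃ m' ∈ Ico m m0, ¬ ∃ M ∈ Icc (0 : ℝ) 1, dR M = dL m' ∧ uR M = uL m' := by
      intro m hm
      obtain ⟨m', hm', h⟩ := hm0ex m hm
      exact ⟨m', hm', fun h' => h ⟨⟨hm.1.trans hm'.1, hm'.2.le.trans (hmp.trans hp.2)⟩, h'⟩⟩
    -- The two chains must reach the first common hull through opposite ends, and this is a `Turn`
    -- in one of its two orientations.
    rcases L.new_cases hm0pos hmleast with hl | hl <;> rcases R.new_cases hM0pos hMleast with hr' | hr'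
    · refine (not_both_new L.swap R.swap hM0.2 hM0u.symm hM0d.symm (fun m hm => ?_) hl hr').elim
      obtain ⟨m', hm', h⟩ := hm0ex' m hm
      exact ⟨m', hm', fun ⟨M, hM, h1, h2⟩ => h ⟨M, hM, h2, h1⟩⟩
    · obtain ⟨A, e, hA, he, t⟩ := turn_exists L.swap R.swap hl hr'
      exact key A e hA he t.Alt.le t.elt.le (Or.inr (Or.inr t))
    · obtain ⟨A, e, hA, he, t⟩ := turn_exists L R hl hr'
      exact key A e hA he t.Alt.le t.elt.le (Or.inr (Or.inl t))
    · exact (not_both_new L R hM0.2 hM0d.symm hM0u.symm hm0ex' hl hr').elim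

/-! ### Folding maps of a band -/

/-- A function `t` with its running depth and height, such that two points with the same hull
lie on a monotone piece. -/
structure Chain (t d u : ℝ → ℝ) : Prop extends Running d u where
  ge : ∀ x, 0 ≤ x → - d x ≤ t x
  le : ∀ x, 0 ≤ x → t x ≤ u x
  newd : ∀ y, 0 ≤ y → (∀ x ∈ Ico 0 y, d x < d y) → t y = - d y
  newu : ∀ y, 0 ≤ y → (∀ x ∈ Ico 0 y, u x < u y) → t y = u y
  level : ∀ y₁ y₂, 0 ≤ y₁ → y₁ < y₂ → y₂ ≤ 1 → d y₁ = d y₂ → u y₁ = u y₂ →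
    (t y₂ < t y₁ ∧ (∃ z ∈ Icc 0 y₁, d z = d y₁ ∧ u z = u y₁ ∧ ∀ y ∈ Ico 0 z, u y < u y₁) ∧
        ∃ y ∈ Icc (0 : ℝ) 1, d y₁ < d y ∧ u y = u y₁) ∨
    (t y₁ < t y₂ ∧ (∃ z ∈ Icc 0 y₁, d z = d y₁ ∧ u z = u y₁ ∧ ∀ y ∈ Ico 0 z, d y < d y₁) ∧
        ∃ y ∈ Icc (0 : ℝ) 1, u y₁ < u y ∧ d y = d y₁)

namespace Chain

variable {t d u : ℝ → ℝ}

lemma swap (C : Chain t d u) : Chain (fun x => - t x) u d where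
  toRunning := C.toRunning.swap
  ge x hx := neg_le_neg (C.le x hx)
  le x hx := by have := C.ge x hx; linarith
  newd y hy H := by rw [C.newu y hy H]
  newu y hy H := by rw [C.newd y hy H, neg_neg]
  level y₁ y₂ h0 h h1 hd hu := by
    rcases C.level y₁ y₂ h0 h h1 hu hd with ⟨a, ⟨z, hz, b1, b2, b3⟩, c⟩ | ⟨a, ⟨z, hz, b1, b2, b3⟩, c⟩
    · exact Or.inr ⟨neg_lt_neg a, ⟨z, hz, b2, b1, b3⟩, c⟩
    · exact Or.inl ⟨neg_lt_neg a, ⟨z, hz, b2, b1, b3⟩, c⟩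

end Chain

/-- A simultaneous new maximum and minimum would make the value at that point both positive and
nonpositive. -/
lemma running_of_continuous {t : ℝ → ℝ} (tc : Continuous t) (t0 : t 0 = 0) :
    Running (dp t) (hi t) where
  dm := dp_mono tc
  um := hi_mono tc
  dc := dp_continuous tc
  uc := hi_continuous tc
  d0 := by rw [dp_of_nonpos le_rfl, t0, neg_zero]
  u0 := by rw [hi_of_nonpos le_rfl, t0]
  one y hy h1 h2 := by
    have e1 := dp_eq_of_new tc hy.le h1
    have e2 := hi_eq_of_new tc hy.le h2
    have h3 := h2 0 ⟨le_rfl, hy⟩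
    have h4 := hi_nonneg tc t0 0
    have h5 := dp_nonneg tc t0 y
    linarith

lemma Zig.chain_of {t : ℝ → ℝ} {β : ℕ → ℝ} {n : ℕ} (Z : Zig t β n) (tc : Continuous t)
    (t0 : t 0 = 0) : Chain t (dp t) (hi t) where
  toRunning := running_of_continuous tc t0
  ge _ hx := neg_dp_le tc hx le_rfl
  le _ hx := le_hi tc hx le_rfl
  newd _ hy H := dp_eq_of_new tc hy H
  newu _ hy H := hi_eq_of_new tc hy H
  level _ _ h0 h h1 hd hu := Z.level tc h0 h h1 hd hu

/-! ### Opposite folds cannot cross -/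

section phi

variable {tL tR dL uL dR uR : ℝ → ℝ} {A e m0 M0 p r X X' Y Y' : ℝ}

/-- Strictly inside a band both chains run through the same hulls, so they cannot reach one hull
with the left chain raising its height and the right chain increasing its depth. -/
lemma same_level_aux (L : Chain tL dL uL) (R : Chain tR dR uR)
    (B : NBand dL uL dR uR A e m0 M0 p r) (hXp : X ≤ p)
    (d1 : dL X = dR Y) (u1 : uL X = uR Y)
    (hne : dL m0 < dL X ∨ uL m0 < uL X)
    (hL : ∃ z ∈ Icc 0 X, dL z = dL X ∧ uL z = uL X ∧ ∀ y ∈ Ico 0 z, uL y < uL X)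
    (hR : ∃ z ∈ Icc 0 Y, dR z = dR Y ∧ uR z = uR Y ∧ ∀ y ∈ Ico 0 z, dR y < dR Y) : False := by
  obtain ⟨z, hz, dz, uz, nz⟩ := hL
  obtain ⟨w, hw, dw, uw, nw⟩ := hR
  have hm0 : 0 ≤ m0 := B.A0.trans B.Am
  have hzm : m0 < z := by
    by_contra h
    have h1 := L.dm (not_lt.1 h); have h2 := L.um (not_lt.1 h)
    rcases hne with h | h <;> linarith
  have hw0 : 0 < w := by
    rcases hw.1.eq_or_lt with h | h
    · exfalso
      rw [← h, R.d0] at dw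
      rw [← h, R.u0] at uw
      have h3 := L.dm hm0; have h4 := L.um hm0
      rw [L.d0] at h3; rw [L.u0] at h4
      rcases hne with h | h <;> linarith
    · exact h
  obtain ⟨x, hx, ex⟩ : ∃ x ∈ Ico 0 z, dL x = dL z := by
    by_contra hcon
    push Not at hcon
    exact L.one z (hm0.trans_lt hzm) (fun x hx => lt_of_le_of_ne (L.dm hx.2.le) (hcon x hx))
      (fun x hx => by rw [uz]; exact nz x hx)
  obtain ⟨y, hy, ey⟩ : ∃ y ∈ Ico 0 w, uR y = uR w := by
    by_contra hcon
    push Not at hcon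
    exact R.one w hw0 (fun x hx => by rw [dw]; exact nw x hx)
      (fun x hx => lt_of_le_of_ne (R.um hx.2.le) (hcon x hx))
  have hlt : max m0 x < z := max_lt hzm hx.2
  obtain ⟨M, hM, eM1, eM2⟩ := B.kL (max m0 x) ⟨le_max_left _ _, hlt.le.trans (hz.2.trans hXp)⟩
  have h1 := nz (max m0 x) ⟨hm0.trans (le_max_left _ _), hlt⟩
  have h2 := nw y hy
  have h3 : dL x ≤ dL (max m0 x) := L.dm (le_max_right _ _)
  rcases le_total M y with h | h
  · have := R.dm h; linarith
  · have := R.um h; linarith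

/-- Each pair lies on a monotone piece of its zigzag. If both pieces run the same way, the exchanged
values give a cyclic strict inequality; if they run in opposite ways, `same_level_aux` applies. -/
lemma same_level (L : Chain tL dL uL) (R : Chain tR dR uR)
    (B : NBand dL uL dR uR A e m0 M0 p r) (hX : 0 ≤ X) (hXX : X < X') (hX1 : X' ≤ 1) (hXp : X ≤ p)
    (hY : 0 ≤ Y) (hYY : Y < Y') (hY1 : Y' ≤ 1)
    (d1 : dL X = dR Y) (u1 : uL X = uR Y) (d2 : dL X = dL X') (u2 : uL X = uL X')
    (d3 : dR Y = dR Y') (u3 : uR Y = uR Y') (hne : dL m0 < dL X ∨ uL m0 < uL X)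
    (e1 : tL X' = tR Y) (e2 : tR Y' = tL X) : False := by
  rcases L.level X X' hX hXX hX1 d2 u2 with ⟨a, b, -⟩ | ⟨a, b, -⟩ <;>
    rcases R.level Y Y' hY hYY hY1 d3 u3 with ⟨a', b', -⟩ | ⟨a', b', -⟩
  · linarith
  · exact same_level_aux L R B hXp d1 u1 hne b b'
  · refine same_level_aux L.swap R.swap B.swap hXp u1 d1 hne.symm ?_ ?_
    · obtain ⟨z, hz, h1, h2, h3⟩ := b; exact ⟨z, hz, h2, h1, h3⟩
    · obtain ⟨z, hz, h1, h2, h3⟩ := b'; exact ⟨z, hz, h2, h1, h3⟩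
  · linarith

/-- The bounds squeeze the four hulls together. If they exceed the initial hull of the band,
`same_level` applies. Otherwise `X'` and `Y'` still have that initial hull, from which the left
chain next grows in depth and the right chain in height; then the band could not extend beyond it,
contrary to `hXn` at `m0`. -/
lemma no_cross_of_turn (L : Chain tL dL uL) (R : Chain tR dR uR)
    (B : NBand dL uL dR uR A e m0 M0 p r) (t : Turn dL uL dR uR A e m0 M0)
    (hX : A ≤ X) (hXX : X < X') (hX1 : X' ≤ 1) (hXp : X ≤ p)
    (hY : e ≤ Y) (hYY : Y < Y') (hY1 : Y' ≤ 1) (hX0 : m0 < X') (hY0 : M0 < Y')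
    (d1 : dL X' ≤ max (dL A) (dR Y)) (u1 : uL X' ≤ max (uL A) (uR Y))
    (d2 : dR Y' ≤ max (dR e) (dL X)) (u2 : uR Y' ≤ max (uR e) (uL X))
    (hXn : ∀ m ∈ Ico 0 X', ¬ (dL m = dL p ∧ uL m = uL p))
    (e1 : tL X' = tR Y) (e2 : tR Y' = tL X) : False := by
  have hm0 : 0 ≤ m0 := B.A0.trans B.Am
  have hM0 : 0 ≤ M0 := B.e0.trans B.eM
  have a1 : dL m0 ≤ dL X := t.dA ▸ L.dm hX
  have a2 : uR M0 ≤ uR Y := t.ue ▸ R.um hY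
  have a3 := t.mnew A ⟨B.A0, t.Alt⟩
  have a4 := t.Mnew e ⟨B.e0, t.elt⟩
  have a5 := L.dm hXX.le; have a6 := L.um hXX.le
  have a7 := R.dm hYY.le; have a8 := R.um hYY.le
  have a9 := L.dm hX0.le; have a10 := L.um hX0.le
  have a11 := R.dm hY0.le; have a12 := R.um hY0.le
  have E0d := B.E0d; have E0u := B.E0u
  rw [t.dA] at d1
  rw [t.ue] at u2
  have b1 : uL X' ≤ uR Y := u1.trans (max_le (by linarith) le_rfl)
  have b2 : dR Y' ≤ dL X := d2.trans (max_le (by linarith) le_rfl)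
  have b3 : dL X' ≤ dL X := d1.trans (max_le a1 (a7.trans b2))
  have b4 : uR Y' ≤ uR Y := u2.trans (max_le a2 (a6.trans b1))
  rcases a1.lt_or_eq with hlt | heq
  · have c1 : dL X' ≤ dR Y := (le_max_iff.1 d1).resolve_left (by linarith)
    have c2 : m0 < X := by
      by_contra h; have := L.dm (not_lt.1 h); linarith
    have c3 := L.um c2.le
    have c4 : uR Y' ≤ uL X := u2.trans (max_le (by linarith) le_rfl)
    exact same_level L R B (B.A0.trans hX) hXX hX1 hXp (B.e0.trans hY) hYY hY1 (by linarith)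
      (by linarith) (by linarith) (by linarith) (by linarith) (by linarith) (Or.inl hlt) e1 e2
  rcases a2.lt_or_eq with hlt | heq'
  · have c1 : uR Y' ≤ uL X := (le_max_iff.1 u2).resolve_left (by linarith)
    have c2 : M0 < Y := by
      by_contra h; have := R.um (not_lt.1 h); linarith
    have c3 := R.dm c2.le
    have c4 : dL X' ≤ dR Y := d1.trans (max_le (by linarith) le_rfl)
    exact same_level L R B (B.A0.trans hX) hXX hX1 hXp (B.e0.trans hY) hYY hY1 (by linarith)
      (by linarith) (by linarith) (by linarith) (by linarith) (by linarith) (Or.inr (by linarith)) e1 e2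
  have hLl := L.level m0 X' hm0 hX0 hX1 (by linarith) (by linarith)
  have hRl := R.level M0 Y' hM0 hY0 hY1 (by linarith) (by linarith)
  have f1 := L.newu m0 hm0 t.mnew
  have f2 := R.newd M0 hM0 t.Mnew
  have f3 := L.le X' (hm0.trans hX0.le)
  have f4 := R.ge Y' (hM0.trans hY0.le)
  obtain ⟨m, hm, dm, um⟩ : ∃ m ∈ Icc (0 : ℝ) 1, dL m0 < dL m ∧ uL m = uL m0 := by
    rcases hLl with h | h
    · exact h.2.2
    · linarith [h.1]
  obtain ⟨M, hM, uM, dM⟩ : ∃ M ∈ Icc (0 : ℝ) 1, uR M0 < uR M ∧ dR M = dR M0 := by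
    rcases hRl with h | h
    · linarith [h.1]
    · exact h.2.2
  have key : ∀ m ∈ Icc m0 p, dL m0 < dL m → uL m = uL m0 → False := by
    intro m hm dm um
    obtain ⟨M', hM', g1, g2⟩ := B.kL m hm
    rcases le_total M M' with h | h
    · have := R.um h; linarith
    · have := R.dm h; linarith
  have hm0m : m0 ≤ m := by
    by_contra h; have := L.dm (not_le.1 h).le; linarith
  rcases le_total m p with h | h
  · exact key m ⟨hm0m, h⟩ dm um
  · have g1 := L.um h; have g2 := L.um B.mp; have g3 := L.dm B.mp
    refine key p ⟨B.mp, le_rfl⟩ (lt_of_le_of_ne g3 fun h => hXn m0 ⟨hm0, hX0⟩ ⟨h, by linarith⟩) (by linarith)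

lemma no_cross (L : Chain tL dL uL) (R : Chain tR dR uR) (L0 : tL 0 = 0)
    (B : NBand dL uL dR uR A e m0 M0 p r)
    (hX : A ≤ X) (hXX : X < X') (hX1 : X' ≤ 1) (hXp : X ≤ p)
    (hY : e ≤ Y) (hYY : Y < Y') (hY1 : Y' ≤ 1) (hX0 : m0 < X') (hY0 : M0 < Y')
    (d1 : dL X' ≤ max (dL A) (dR Y)) (u1 : uL X' ≤ max (uL A) (uR Y))
    (d2 : dR Y' ≤ max (dR e) (dL X)) (u2 : uR Y' ≤ max (uR e) (uL X))
    (hXn : ∀ m ∈ Ico 0 X', ¬ (dL m = dL p ∧ uL m = uL p))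
    (e1 : tL X' = tR Y) (e2 : tR Y' = tL X) : False := by
  rcases B.turn with t | t | t
  · obtain ⟨rfl, rfl, rfl, rfl⟩ := t
    have a5 := L.dm hXX.le; have a6 := L.um hXX.le
    have a7 := R.dm hYY.le; have a8 := R.um hYY.le
    have z1 := L.dm hX; have z2 := L.um hX; have z3 := R.dm hY; have z4 := R.um hY
    rw [L.d0] at z1 d1; rw [L.u0] at z2 u1; rw [R.d0] at z3 d2; rw [R.u0] at z4 u2
    rw [max_eq_right z3] at d1; rw [max_eq_right z4] at u1
    rw [max_eq_right z1] at d2; rw [max_eq_right z2] at u2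
    by_cases hne : dL 0 < dL X ∨ uL 0 < uL X
    · exact same_level L R B hX hXX hX1 hXp hY hYY hY1 (by linarith)
        (by linarith) (by linarith) (by linarith) (by linarith) (by linarith) hne e1 e2
    · rw [L.d0, L.u0] at hne
      push Not at hne
      have g1 := L.ge X' hX0.le; have g2 := L.le X' hX0.le
      rcases L.level 0 X' le_rfl hX0 hX1 (by rw [L.d0]; linarith) (by rw [L.u0]; linarith) with h | h <;>
        linarith [h.1]
  · exact no_cross_of_turn L R B t hX hXX hX1 hXp hY hYY hY1 hX0 hY0 d1 u1 d2 u2 hXn e1 e2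
  · exact no_cross_of_turn L.swap R.swap B.swap t hX hXX hX1 hXp hY hYY hY1 hX0 hY0 u1 d1 u2 d2
      (fun m hm h => hXn m hm h.symm) (by rw [e1]) (by rw [e2])

end phi

/-- The reflection of a function. -/
def refl (T : ℝ → ℝ) : ℝ → ℝ := fun x => T (-x)

@[simp] lemma refl_refl (T : ℝ → ℝ) : refl (refl T) = T := by
  funext x; simp [refl]

/-- A continuous function both halves of which are zigzags. -/
structure BiZig (T : ℝ → ℝ) : Prop where
  c : Continuous T
  z : T 0 = 0
  right : ∃ β n, Zig T β n
  left : ∃ β n, Zig (refl T) β n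

namespace BiZig

variable {T : ℝ → ℝ}

lemma refl_continuous (c : Continuous T) : Continuous (refl T) := c.comp continuous_neg

lemma mirror (B : BiZig T) : BiZig (refl T) where
  c := refl_continuous B.c
  z := by simp [refl, B.z]
  right := B.left
  left := by rw [refl_refl]; exact B.right

lemma chainR (B : BiZig T) : Chain T (dp T) (hi T) := by
  obtain ⟨β, n, Z⟩ := B.right
  exact Z.chain_of B.c B.z

lemma chainL (B : BiZig T) : Chain (refl T) (dp (refl T)) (hi (refl T)) := B.mirror.chainR

end BiZig

/-- The bands of `T`. -/
abbrev TBand (T : ℝ → ℝ) (A e m0 M0 p r : ℝ) : Prop :=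
  NBand (dp (refl T)) (hi (refl T)) (dp T) (hi T) A e m0 M0 p r

/-- At `A` the left zigzag is at a new extreme. The value at `e` is the opposite extreme of the
first common hull, which the left zigzag does not attain before `m0`. -/
lemma NBand.first_left {tL tR dL uL dR uR : ℝ → ℝ} {A e m0 M0 p r : ℝ} (L : Chain tL dL uL)
    (R : Chain tR dR uR) (B : NBand dL uL dR uR A e m0 M0 p r) :
    (∀ x ∈ Ico 0 A, tL x ≠ tL A) ∧ ∀ X, 0 ≤ X → tL X = tR e → m0 ≤ X := by
  have key : ∀ {tL tR dL uL dR uR : ℝ → ℝ}, Chain tL dL uL → Chain tR dR uR →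
      NBand dL uL dR uR A e m0 M0 p r → Turn dL uL dR uR A e m0 M0 →
      (∀ x ∈ Ico 0 A, tL x ≠ tL A) ∧ ∀ X, 0 ≤ X → tL X = tR e → m0 ≤ X := by
    intro tL tR dL uL dR uR L R B t
    constructor
    · intro x hx hcon
      have h1 := L.newd A B.A0 fun x hx => by rw [t.dA]; exact t.Anew x hx
      have h2 := t.Anew x hx
      have h3 := L.ge x hx.1
      rw [hcon, h1, t.dA] at h3
      linarith
    · intro X hX hcon
      have h1 := R.newu e B.e0 fun x hx => by rw [t.ue]; exact t.enew x hx
      by_contra h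
      have h2 := t.mnew X ⟨hX, not_le.1 h⟩
      have h3 := L.le X hX
      rw [hcon, h1, t.ue, ← B.E0u] at h3
      linarith
  rcases B.turn with t | t | t
  · rw [t.1, t.2.2.1]
    exact ⟨fun x hx => absurd hx.2 (not_lt.2 hx.1), fun X hX _ => hX⟩
  · exact key L R B t
  · obtain ⟨h1, h2⟩ := key L.swap R.swap B.swap t
    exact ⟨fun x hx hcon => h1 x hx (by rw [hcon]), fun X hX hcon => h2 X hX (by rw [hcon])⟩

lemma image_union {t s : ℝ → ℝ} (tc : Continuous t) (sc : Continuous s) (t0 : t 0 = 0) (s0 : s 0 = 0)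
    {x y z : ℝ} (hx : 0 ≤ x) (hy : 0 ≤ y) (hz : 0 ≤ z) (hd : dp t z = max (dp t x) (dp s y))
    (hu : hi t z = max (hi t x) (hi s y)) :
    t '' Icc 0 x ∪ s '' Icc 0 y = t '' Icc 0 z := by
  rw [image_Icc_eq tc hx, image_Icc_eq sc hy, image_Icc_eq tc hz, hd, hu]
  have h1 := dp_nonneg tc t0 x; have h2 := dp_nonneg sc s0 y
  have h3 := hi_nonneg tc t0 x; have h4 := hi_nonneg sc s0 y
  rw [Icc_union_Icc' (by linarith) (by linarith), min_neg_neg]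

/-- Folding a band onto its left half. -/
lemma exists_fold_left {T : ℝ → ℝ} (Z : BiZig T) {A e m0 M0 p r : ℝ} (B : TBand T A e m0 M0 p r) :
    ∃ φ : ℝ → ℝ, Continuous φ ∧ (∀ y ∈ Icc (-p) r, φ y ∈ Icc (-p) 0) ∧
      (∀ y ∈ Icc (-p) (-A), φ y = y) ∧ (∀ y ∈ Icc (-p) r, T (φ y) = T y) ∧
      ∀ y ∈ Icc 0 r, dp (refl T) (-φ y) ≤ max (dp (refl T) A) (dp T y) ∧
        hi (refl T) (-φ y) ≤ max (hi (refl T) A) (hi T y) ∧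
        ∀ m ∈ Ico 0 (-φ y), ¬ (dp (refl T) m = dp (refl T) p ∧ hi (refl T) m = hi (refl T) p) := by
  have L := Z.chainL
  have R := Z.chainR
  have lc := Z.mirror.c
  have l0 := Z.mirror.z
  have hA0 := B.A0
  have hp0 : 0 ≤ p := B.A0.trans (B.Am.trans B.mp)
  have hr0 : 0 ≤ r := B.e0.trans (B.eM.trans B.Mr)
  have hAp : A ≤ p := B.Am.trans B.mp
  -- the least position of the largest hull
  have hcomp : IsCompact {m : ℝ | m ∈ Icc (0 : ℝ) p ∧ dp (refl T) m = dp (refl T) p ∧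
      hi (refl T) m = hi (refl T) p} :=
    isCompact_Icc.inter_right ((isClosed_eq L.dc continuous_const).inter
      (isClosed_eq L.uc continuous_const))
  obtain ⟨P, ⟨hP, hPd, hPu⟩, hPmin⟩ := hcomp.exists_isLeast ⟨p, ⟨hp0, le_rfl⟩, rfl, rfl⟩
  have hPleast : ∀ m ∈ Ico 0 P, ¬ (dp (refl T) m = dp (refl T) p ∧ hi (refl T) m = hi (refl T) p) :=
    fun m hm h => absurd (hPmin ⟨⟨hm.1, hm.2.le.trans hP.2⟩, h⟩) (not_le.2 hm.2)
  have hrec : ∀ x ∈ Ico 0 P, refl T x ≠ refl T P := by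
    intro x hx hcon
    have hP0 : 0 < P := hx.1.trans_lt hx.2
    rcases L.new_cases hP0 (fun m hm h => hPleast m hm ⟨h.1.trans hPd, h.2.trans hPu⟩) with h | h
    · have h1 := L.newd P hP.1 h.1
      have h2 := h.1 x hx
      have h3 := L.ge x hx.1
      rw [hcon] at h3; linarith
    · have h1 := L.newu P hP.1 h.1
      have h2 := h.1 x hx
      have h3 := L.le x hx.1
      rw [hcon] at h3; linarith
  -- The path runs from `0` left to `-A`, turns back, and continues through `0` to `r`. By
  -- `in_right` its hulls are left hulls, so it lifts into the left half.
  set h : ℝ → ℝ := fun s => T (|s - A| - A) with hh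
  have hc : Continuous h := Z.c.comp (by fun_prop)
  have h0 : h 0 = 0 := by simp [hh, abs_of_nonneg hA0, Z.z]
  have hle : ∀ s, s ≤ A → h s = refl T s := by
    intro s hs
    simp only [hh, refl]
    rw [abs_of_nonpos (by linarith)]; congr 1; ring
  have hge : ∀ s, A ≤ s → h s = T (s - 2 * A) := by
    intro s hs
    simp only [hh]
    rw [abs_of_nonneg (by linarith)]; congr 1; ring
  -- hulls of the path
  have himg1 : ∀ s, 0 ≤ s → s ≤ A → h '' Icc 0 s = refl T '' Icc 0 s := fun s _ hs =>
    image_congr fun x hx => hle x (hx.2.trans hs)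
  have himg2 : ∀ s, A ≤ s → h '' Icc 0 s = refl T '' Icc 0 A ∪ T '' Icc 0 (max 0 (s - 2 * A)) := by
    intro s hs
    apply Subset.antisymm
    · rintro _ ⟨x, hx, rfl⟩
      rcases le_total x A with hxA | hxA
      · exact Or.inl ⟨x, ⟨hx.1, hxA⟩, (hle x hxA).symm⟩
      · rw [hge x hxA]
        rcases le_total (x - 2 * A) 0 with hx2 | hx2
        · exact Or.inl ⟨-(x - 2 * A), ⟨by linarith, by linarith⟩, by simp [refl]⟩
        · exact Or.inr ⟨x - 2 * A, ⟨hx2, le_max_of_le_right (by linarith [hx.2])⟩, rfl⟩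
    · rintro _ (⟨x, hx, rfl⟩ | ⟨x, hx, rfl⟩)
      · exact ⟨x, ⟨hx.1, hx.2.trans hs⟩, hle x hx.2⟩
      · rcases le_total (s - 2 * A) 0 with h2 | h2
        · rw [max_eq_left h2] at hx
          have : x = 0 := le_antisymm hx.2 hx.1
          exact ⟨0, ⟨le_rfl, hA0.trans hs⟩, by rw [h0, this, Z.z]⟩
        · rw [max_eq_right h2] at hx
          refine ⟨x + 2 * A, ⟨by linarith [hx.1], by linarith [hx.2]⟩, ?_⟩
          rw [hge _ (by linarith [hx.1])]; congr 1; ring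
  have hmin : ∀ z, 0 ≤ z → dp (refl T) z ≤ dp (refl T) p → hi (refl T) z ≤ hi (refl T) p →
      ∃ y ∈ Icc 0 P, refl T '' Icc 0 z = refl T '' Icc 0 y := by
    intro z hz h1 h2
    rcases le_total z P with hzP | hzP
    · exact ⟨z, ⟨hz, hzP⟩, rfl⟩
    · refine ⟨P, ⟨hP.1, le_rfl⟩, ?_⟩
      have h3 := L.dm hzP; have h4 := L.um hzP
      rw [image_Icc_eq lc hz, image_Icc_eq lc hP.1]
      congr 1 <;> linarith
  obtain ⟨θ, θc, θm, θ0, hθ⟩ : ∃ θ : ℝ → ℝ, ContinuousOn θ (Icc 0 (2 * A + r)) ∧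
      MapsTo θ (Icc 0 (2 * A + r)) (Icc 0 P) ∧ θ 0 = 0 ∧
      ∀ s ∈ Icc 0 (2 * A + r), refl T (θ s) = h s := by
    obtain ⟨β, n, ZL⟩ := Z.left
    refine ZL.lift lc n le_rfl P hP.1 (by rw [ZL.last]; exact hP.2.trans B.p1) hrec _ (by linarith)
      h hc h0 fun s hs => ?_
    rcases le_total s A with hsA | hsA
    · rw [himg1 s hs.1 hsA]
      exact hmin s hs.1 (L.dm (hsA.trans hAp)) (L.um (hsA.trans hAp))
    · rw [himg2 s hsA]
      have hy : max 0 (s - 2 * A) ∈ Icc 0 r := ⟨le_max_left _ _, max_le hr0 (by linarith [hs.2])⟩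
      obtain ⟨z, hz, hz1, hz2⟩ := B.in_right L.toRunning R.toRunning hy
      rw [image_union lc Z.c l0 Z.z hA0 hy.1 hz.1 hz1 hz2]
      refine hmin z hz.1 ?_ ?_
      · rw [hz1]; exact max_le (L.dm hAp) (B.E1d ▸ R.dm hy.2)
      · rw [hz2]; exact max_le (L.um hAp) (B.E1u ▸ R.um hy.2)
  -- The value at `A` is new, so the lift must be at `A` exactly then. This lets the identity on
  -- `[-p, -A]` be glued to the lift of the remainder.
  have hθA : θ A = A := by
    have hAm : A ∈ Icc 0 (2 * A + r) := ⟨hA0, by linarith⟩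
    have hfirst := (B.first_left L R).1
    have h1 := θm hAm
    have h2 : refl T (θ A) = refl T A := by rw [hθ A hAm, hle A le_rfl]
    have h3 : A ≤ θ A := by
      by_contra hcon
      exact hfirst _ ⟨h1.1, not_le.1 hcon⟩ h2
    obtain ⟨s, hs, es⟩ := intermediate_value_Icc hA0
      (θc.mono (Icc_subset_Icc_right (by linarith) : Icc 0 A ⊆ Icc 0 (2 * A + r)))
      (show A ∈ Icc (θ 0) (θ A) from ⟨by rw [θ0]; exact hA0, h3⟩)
    rcases hs.2.eq_or_lt with h | h
    · rw [← h]; rw [h] at es ⊢; exact es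
    · exfalso
      have := hθ s ⟨hs.1, by linarith⟩
      rw [es, hle s h.le] at this
      exact hfirst s ⟨hs.1, h⟩ this.symm
  set ψ : ℝ → ℝ := fun y => if y ≤ -A then y else - θ (y + 2 * A) with hψ
  have hψ1 : ∀ y, y ≤ -A → ψ y = y := fun y hy => by simp [hψ, hy]
  have hψ2 : ∀ y, -A ≤ y → ψ y = - θ (y + 2 * A) := by
    intro y hy
    rcases hy.eq_or_lt with h | h
    · rw [← h, hψ1 _ le_rfl, show -A + 2 * A = A by ring, hθA]
    · simp [hψ, not_le.2 h]
  have ψc : ContinuousOn ψ (Icc (-p) r) := by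
    rw [show Icc (-p) r = Icc (-p) (-A) ∪ Icc (-A) r from
      (Icc_union_Icc_eq_Icc (by linarith) (by linarith)).symm]
    apply ContinuousOn.union_of_isClosed _ _ isClosed_Icc isClosed_Icc
    · exact continuousOn_id.congr fun y hy => hψ1 y hy.2
    · have : ContinuousOn (fun y => - θ (y + 2 * A)) (Icc (-A) r) := by
        apply ContinuousOn.neg
        refine θc.comp (by fun_prop) fun y hy => ⟨by linarith [hy.1], by linarith [hy.2]⟩
      exact this.congr fun y hy => hψ2 y hy.1
  have hpr : -p ≤ r := by linarith
  refine ⟨fun y => ψ (projIcc (-p) r hpr y), ?_, ?_, ?_, ?_, ?_⟩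
  · exact (continuousOn_iff_continuous_domRestrict.1 ψc).comp continuous_projIcc
  · intro y hy
    simp only [projIcc_of_mem hpr hy]
    rcases le_total y (-A) with h | h
    · rw [hψ1 y h]; exact ⟨hy.1, by linarith⟩
    · rw [hψ2 y h]
      have := θm (show y + 2 * A ∈ Icc 0 (2 * A + r) from ⟨by linarith, by linarith [hy.2]⟩)
      exact ⟨by linarith [this.2, hP.2], by linarith [this.1]⟩
  · intro y hy
    simp only [projIcc_of_mem hpr (show y ∈ Icc (-p) r from ⟨hy.1, by linarith [hy.2]⟩)]
    exact hψ1 y hy.2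
  · intro y hy
    simp only [projIcc_of_mem hpr hy]
    rcases le_total y (-A) with h | h
    · rw [hψ1 y h]
    · rw [hψ2 y h]
      have := hθ (y + 2 * A) ⟨by linarith, by linarith [hy.2]⟩
      rw [hge _ (by linarith)] at this
      rw [refl] at this
      rw [this]; congr 1; ring
  · intro y hy
    simp only [projIcc_of_mem hpr (show y ∈ Icc (-p) r from ⟨by linarith [hy.1], hy.2⟩)]
    rw [hψ2 y (by linarith [hy.1]), neg_neg]
    have hs : y + 2 * A ∈ Icc 0 (2 * A + r) := ⟨by linarith [hy.1], by linarith [hy.2]⟩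
    have hb := θm hs
    -- The lift passes through every earlier position, so the hull at its current position is
    -- contained in the hull of the path; this yields both bounds.
    have hsub : refl T '' Icc 0 (θ (y + 2 * A)) ⊆ h '' Icc 0 (y + 2 * A) := by
      rintro _ ⟨x, hx, rfl⟩
      obtain ⟨s, hs', es⟩ := intermediate_value_Icc hs.1 (θc.mono (Icc_subset_Icc_right hs.2))
        (show x ∈ Icc (θ 0) (θ (y + 2 * A)) from ⟨by rw [θ0]; exact hx.1, hx.2⟩)
      exact ⟨s, hs', by rw [← hθ s ⟨hs'.1, hs'.2.trans hs.2⟩, es]⟩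
    rw [himg2 _ (by linarith [hy.1]), show y + 2 * A - 2 * A = y by ring, max_eq_right hy.1,
      image_Icc_eq lc hb.1, image_Icc_eq lc hA0, image_Icc_eq Z.c hy.1] at hsub
    have e1 := dp_nonneg lc l0 (θ (y + 2 * A)); have e2 := hi_nonneg lc l0 (θ (y + 2 * A))
    refine ⟨?_, ?_, fun m hm => hPleast m ⟨hm.1, hm.2.trans_le hb.2⟩⟩
    · have := hsub (left_mem_Icc.2 (by linarith))
      rw [le_max_iff]
      rcases this with h | h
      · exact Or.inl (by linarith [h.1])
      · exact Or.inr (by linarith [h.1])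
    · have := hsub (right_mem_Icc.2 (by linarith))
      rw [le_max_iff]
      rcases this with h | h
      · exact Or.inl h.2
      · exact Or.inr h.2

/-- Two folding maps of the interval `[-p, r]`, onto `[-p, 0]` and onto `[0, r]`. -/
structure Fold (T : ℝ → ℝ) (a e p r : ℝ) (φm φp : ℝ → ℝ) : Prop where
  ha : a ≤ 0
  he : 0 ≤ e
  hpa : -p ≤ a
  her : e ≤ r
  cm : Continuous φm
  cp : Continuous φp
  mm : ∀ y ∈ Icc (-p) r, φm y ∈ Icc (-p) 0
  mp : ∀ y ∈ Icc (-p) r, φp y ∈ Icc 0 r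
  im : ∀ y ∈ Icc (-p) a, φm y = y
  ip : ∀ y ∈ Icc e r, φp y = y
  Tm : ∀ y ∈ Icc (-p) r, T (φm y) = T y
  Tp : ∀ y ∈ Icc (-p) r, T (φp y) = T y
  phi : ∀ x ∈ Icc (-p) a, ∀ y ∈ Icc e r, φm y < x → φm y < φm e → y < φp x → φp a < φp x → False

lemma Fold.mirror {T : ℝ → ℝ} {a e p r : ℝ} {φm φp : ℝ → ℝ} (F : Fold T a e p r φm φp) :
    Fold (refl T) (-e) (-a) r p (fun y => - φp (-y)) (fun y => - φm (-y)) where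
  ha := by linarith [F.he]
  he := by linarith [F.ha]
  hpa := by linarith [F.her]
  her := by linarith [F.hpa]
  cm := by have := F.cp; fun_prop
  cp := by have := F.cm; fun_prop
  mm y hy := by
    have := F.mp (-y) ⟨by linarith [hy.2], by linarith [hy.1]⟩
    exact ⟨by linarith [this.2], by linarith [this.1]⟩
  mp y hy := by
    have := F.mm (-y) ⟨by linarith [hy.2], by linarith [hy.1]⟩
    exact ⟨by linarith [this.2], by linarith [this.1]⟩
  im y hy := by rw [F.ip (-y) ⟨by linarith [hy.2], by linarith [hy.1]⟩, neg_neg]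
  ip y hy := by rw [F.im (-y) ⟨by linarith [hy.2], by linarith [hy.1]⟩, neg_neg]
  Tm y hy := by
    have := F.Tp (-y) ⟨by linarith [hy.2], by linarith [hy.1]⟩
    simpa [refl] using this
  Tp y hy := by
    have := F.Tm (-y) ⟨by linarith [hy.2], by linarith [hy.1]⟩
    simpa [refl] using this
  phi x hx y hy h1 h2 h3 h4 := by
    rw [neg_neg] at h2 h4
    refine F.phi (-y) ⟨by linarith [hy.2], by linarith [hy.1]⟩ (-x) ⟨by linarith [hx.2], by linarith [hx.1]⟩
      ?_ ?_ ?_ ?_ <;> linarith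

/-- The right fold is the left fold of the reflection. The no-crossing clause comes from `no_cross`,
since the folds bound hulls and the images of `e` and `-A` lie beyond `m0` and `M0`. -/
lemma exists_fold {T : ℝ → ℝ} (Z : BiZig T) {A e m0 M0 p r : ℝ} (B : TBand T A e m0 M0 p r) :
    ∃ φm φp, Fold T (-A) e p r φm φp := by
  obtain ⟨φ, φc, φm, φi, φT, φb⟩ := exists_fold_left Z B
  obtain ⟨ψ, ψc, ψm, ψi, ψT, ψb⟩ := exists_fold_left Z.mirror
    (A := e) (e := A) (m0 := M0) (M0 := m0) (p := r) (r := p) (by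
      unfold TBand; rw [refl_refl]; exact B.mirror)
  rw [refl_refl] at ψb
  have L := Z.chainL
  have R := Z.chainR
  have hAp : A ≤ p := B.Am.trans B.mp
  have her : e ≤ r := B.eM.trans B.Mr
  have hA0 := B.A0
  have he0 := B.e0
  refine ⟨φ, fun y => - ψ (-y), by linarith, he0, by linarith, her, φc, by fun_prop, φm, ?_, φi, ?_, φT, ?_, ?_⟩
  · intro y hy
    have := ψm (-y) ⟨by linarith [hy.2], by linarith [hy.1]⟩
    exact ⟨by linarith [this.2], by linarith [this.1]⟩
  · intro y hy
    rw [ψi (-y) ⟨by linarith [hy.2], by linarith [hy.1]⟩, neg_neg]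
  · intro y hy
    have := ψT (-y) ⟨by linarith [hy.2], by linarith [hy.1]⟩
    simpa [refl] using this
  · intro x hx y hy h1 h2 h3 h4
    simp only [neg_neg] at h4
    have hy0 : y ∈ Icc 0 r := ⟨he0.trans hy.1, hy.2⟩
    have hx0 : -x ∈ Icc 0 p := ⟨by linarith [hx.2], by linarith [hx.1]⟩
    have hyp : y ∈ Icc (-p) r := ⟨by linarith [hy.1], hy.2⟩
    have hxp : -x ∈ Icc (-r) p := ⟨by linarith [hx.2], hx0.2⟩
    obtain ⟨b1, b2, b3⟩ := φb y hy0
    obtain ⟨c1, c2, c3⟩ := ψb (-x) hx0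
    have hφ := φm y hyp
    have hψ := ψm (-x) hxp
    have hX0 : m0 ≤ - φ e := by
      have h5 := φm e ⟨by linarith, her⟩
      refine (B.first_left L R).2 (-φ e) (by linarith [h5.2]) ?_
      rw [refl, neg_neg]; exact φT e ⟨by linarith, her⟩
    have hY0 : M0 ≤ - ψ A := by
      have h5 := ψm A ⟨by linarith, hAp⟩
      refine (B.mirror.first_left R L).2 (-ψ A) (by linarith [h5.2]) ?_
      have := ψT A ⟨by linarith, hAp⟩
      exact this
    have hp1 := B.p1
    have hr1 := B.r1
    refine no_cross L R Z.mirror.z B (X := -x) (X' := -φ y) (Y := y) (Y' := -ψ (-x)) (by linarith [hx.2])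
      (by linarith) (by linarith [hφ.1]) (by linarith [hx.1]) hy.1 h3 (by linarith [hψ.1])
      (by linarith) (by linarith) b1 b2 c1 c2 b3 ?_ ?_
    · rw [refl, neg_neg]; exact φT y hyp
    · exact ψT (-x) hxp

/-! ### Removing the departures of one band -/

/-- The point reflection of a function. -/
def mir (f : ℝ → ℝ) : ℝ → ℝ := fun x => - f (-x)

@[simp] lemma mir_mir (f : ℝ → ℝ) : mir (mir f) = f := by
  funext x; simp [mir]

lemma mir_continuous {f : ℝ → ℝ} (hf : Continuous f) : Continuous (mir f) :=
  (hf.comp continuous_neg).neg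

lemma mir_image (f : ℝ → ℝ) (x y : ℝ) : mir f '' Icc (-y) (-x) = (fun v => - v) '' (f '' Icc x y) := by
  ext v
  constructor
  · rintro ⟨t, ht, rfl⟩
    exact ⟨f (-t), ⟨-t, ⟨by linarith [ht.2], by linarith [ht.1]⟩, rfl⟩, rfl⟩
  · rintro ⟨_, ⟨t, ht, rfl⟩, rfl⟩
    exact ⟨-t, ⟨by linarith [ht.2], by linarith [ht.1]⟩, by simp [mir]⟩

/-- Positively oriented departure: all values inside lie strictly between those at the ends. -/
def PosDep (s : ℝ → ℝ) (c d : ℝ) : Prop := ∀ t ∈ Ioo c d, s t ∈ Ioo (s c) (s d)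

/-- Negatively oriented departure. -/
def NegDep (s : ℝ → ℝ) (u v : ℝ) : Prop := ∀ t ∈ Ioo u v, s t ∈ Ioo (s v) (s u)

lemma PosDep.mir {s : ℝ → ℝ} {c d : ℝ} (h : PosDep s c d) : PosDep (mir s) (-d) (-c) := by
  intro t ht
  have := h (-t) ⟨by linarith [ht.2], by linarith [ht.1]⟩
  simp only [RadialContour.mir, neg_neg]
  exact ⟨by linarith [this.2], by linarith [this.1]⟩

lemma NegDep.mir {s : ℝ → ℝ} {c d : ℝ} (h : NegDep s c d) : NegDep (mir s) (-d) (-c) := by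
  intro t ht
  have := h (-t) ⟨by linarith [ht.2], by linarith [ht.1]⟩
  simp only [RadialContour.mir, neg_neg]
  exact ⟨by linarith [this.2], by linarith [this.1]⟩

/-- The windows arising from negatively oriented departures of an inner factor. -/
structure NWin (q : ℝ → ℝ) (c d : ℝ) : Prop where
  c1 : -1 ≤ c
  c0 : c < 0
  d0 : 0 < d
  d1 : d ≤ 1
  left : ∀ x ∈ Icc c 0, ∃ β ∈ Ico 0 d, ∃ y ∈ Icc (0 : ℝ) 1, q '' Icc x β = q '' Icc 0 y
  right : ∀ y ∈ Icc 0 d, ∃ α ∈ Ioc c 0, ∃ x ∈ Icc (-1 : ℝ) 0, q '' Icc α y = q '' Icc x 0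

lemma NWin.mir {q : ℝ → ℝ} {c d : ℝ} (h : NWin q c d) : NWin (mir q) (-d) (-c) where
  c1 := by linarith [h.d1]
  c0 := by linarith [h.d0]
  d0 := by linarith [h.c0]
  d1 := by linarith [h.c1]
  left x hx := by
    obtain ⟨α, hα, y, hy, e⟩ := h.right (-x) ⟨by linarith [hx.2], by linarith [hx.1]⟩
    refine ⟨-α, ⟨by linarith [hα.2], by linarith [hα.1]⟩, -y, ⟨by linarith [hy.2], by linarith [hy.1]⟩, ?_⟩
    have h1 := mir_image q α (-x)
    have h2 := mir_image q y 0
    rw [neg_neg] at h1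
    rw [neg_zero] at h2
    rw [h1, h2, e]
  right x hx := by
    obtain ⟨α, hα, y, hy, e⟩ := h.left (-x) ⟨by linarith [hx.2], by linarith [hx.1]⟩
    refine ⟨-α, ⟨by linarith [hα.2], by linarith [hα.1]⟩, -y, ⟨by linarith [hy.2], by linarith [hy.1]⟩, ?_⟩
    have h1 := mir_image q (-x) α
    have h2 := mir_image q 0 y
    rw [neg_neg] at h1
    rw [neg_zero] at h2
    rw [h1, h2, e]

/-- The image of `[c, β]` is a right hull containing `q c`. In a positive departure the right path
cannot take that value before `d`, so the hull also contains `q d`; but `q d` is not taken on `[c,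
β]` with `β < d`. -/
lemma NWin.not_posDep {q : ℝ → ℝ} {c d : ℝ} (h : NWin q c d) (hp : PosDep q c d) : False := by
  have hc0 := h.c0; have hd0 := h.d0
  have h0 := hp 0 ⟨hc0, hd0⟩
  obtain ⟨β, hβ, y, hy, e⟩ := h.left c ⟨le_rfl, hc0.le⟩
  have h1 : q c ∈ q '' Icc 0 y := e ▸ ⟨c, ⟨le_rfl, hc0.le.trans hβ.1⟩, rfl⟩
  obtain ⟨t, ht, et⟩ := h1
  have htd : d ≤ t := by
    by_contra hcon
    have := hp t ⟨hc0.trans_le ht.1, not_le.1 hcon⟩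
    linarith [this.1]
  have h2 : q d ∈ q '' Icc c β := e ▸ ⟨d, ⟨hd0.le, htd.trans ht.2⟩, rfl⟩
  obtain ⟨s, hs, es⟩ := h2
  rcases hs.1.eq_or_lt with h3 | h3
  · rw [← h3] at es; linarith [h0.1, h0.2]
  · have := hp s ⟨h3, hs.2.trans_lt hβ.2⟩
    linarith [this.2]

/-- The window `[xc, yc]` of times up to which `q` stays in `[-p, r]`, together with the conditions
on the order in which the points `a` and `e` are reached. -/
structure Window (q : ℝ → ℝ) (a e p r xc yc : ℝ) : Prop where
  qc : Continuous q
  q0 : q 0 = 0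
  xm : xc ∈ Icc (-1 : ℝ) 0
  ym : yc ∈ Icc (0 : ℝ) 1
  inD : ∀ t ∈ Icc xc yc, q t ∈ Icc (-p) r
  xmax : ∀ x ∈ Icc (-1 : ℝ) 0, (∀ t ∈ Icc x 0, q t ∈ Icc (-p) r) → xc ≤ x
  ymax : ∀ y ∈ Icc (0 : ℝ) 1, (∀ t ∈ Icc 0 y, q t ∈ Icc (-p) r) → y ≤ yc
  xexit : -1 < xc → q xc = -p
  yexit : yc < 1 → q yc = r
  PL : ∀ x ∈ Icc xc 0, e ≤ q x → ∃ x' ∈ Icc x 0, q x' = a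
  PR : ∀ y ∈ Icc 0 yc, q y ≤ a → ∃ y' ∈ Icc 0 y, q y' = e

lemma Window.mir {q : ℝ → ℝ} {a e p r xc yc : ℝ} (W : Window q a e p r xc yc) :
    Window (mir q) (-e) (-a) r p (-yc) (-xc) where
  qc := mir_continuous W.qc
  q0 := by simp [RadialContour.mir, W.q0]
  xm := ⟨by linarith [W.ym.2], by linarith [W.ym.1]⟩
  ym := ⟨by linarith [W.xm.2], by linarith [W.xm.1]⟩
  inD t ht := by
    have := W.inD (-t) ⟨by linarith [ht.2], by linarith [ht.1]⟩
    exact ⟨neg_le_neg this.2, by simp only [RadialContour.mir]; linarith [this.1]⟩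
  xmax x hx H := by
    have := W.ymax (-x) ⟨by linarith [hx.2], by linarith [hx.1]⟩ fun t ht => by
      have := H (-t) ⟨by linarith [ht.2], by linarith [ht.1]⟩
      simp only [RadialContour.mir, neg_neg] at this
      exact ⟨by linarith [this.2], by linarith [this.1]⟩
    linarith
  ymax x hx H := by
    have := W.xmax (-x) ⟨by linarith [hx.2], by linarith [hx.1]⟩ fun t ht => by
      have := H (-t) ⟨by linarith [ht.2], by linarith [ht.1]⟩
      simp only [RadialContour.mir, neg_neg] at this
      exact ⟨by linarith [this.2], by linarith [this.1]⟩
    linarith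
  xexit h := by simp [RadialContour.mir, W.yexit (by linarith)]
  yexit h := by simp [RadialContour.mir, W.xexit (by linarith)]
  PL x hx h := by
    simp only [RadialContour.mir] at h
    obtain ⟨x', hx', e'⟩ := W.PR (-x) ⟨by linarith [hx.2], by linarith [hx.1]⟩ (by linarith)
    exact ⟨-x', ⟨by linarith [hx'.2], by linarith [hx'.1]⟩, by simp [RadialContour.mir, e']⟩
  PR x hx h := by
    simp only [RadialContour.mir] at h
    obtain ⟨x', hx', e'⟩ := W.PL (-x) ⟨by linarith [hx.2], by linarith [hx.1]⟩ (by linarith)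
    exact ⟨-x', ⟨by linarith [hx'.2], by linarith [hx'.1]⟩, by simp [RadialContour.mir, e']⟩

/-- A modification of `q` on the window without departures of the band. -/
structure Good (T q : ℝ → ℝ) (a e p r xc yc : ℝ) (s : ℝ → ℝ) : Prop where
  c : Continuous s
  z : s 0 = 0
  lift : ∀ t ∈ Icc xc yc, T (s t) = T (q t)
  inD : ∀ t ∈ Icc xc yc, s t ∈ Icc (-p) r
  inner : ∀ t ∈ Icc xc yc, (∀ w ∈ uIcc 0 t, q w ∈ Ioo a e) → s t = q t
  xe : -1 < xc → s xc = q xc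
  ye : yc < 1 → s yc = q yc
  pos : ∀ c d, xc ≤ c → d ≤ yc → NWin q c d → ¬ PosDep s c d
  neg : ∀ u v, xc ≤ u → u < 0 → 0 < v → v ≤ yc → NegDep s u v → e < s u → s v < a → False

lemma Good.mir {T q : ℝ → ℝ} {a e p r xc yc : ℝ} {s : ℝ → ℝ} (G : Good T q a e p r xc yc s) :
    Good (refl T) (mir q) (-e) (-a) r p (-yc) (-xc) (mir s) where
  c := mir_continuous G.c
  z := by simp [RadialContour.mir, G.z]
  lift t ht := by
    have := G.lift (-t) ⟨by linarith [ht.2], by linarith [ht.1]⟩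
    simpa [refl, RadialContour.mir] using this
  inD t ht := by
    have := G.inD (-t) ⟨by linarith [ht.2], by linarith [ht.1]⟩
    exact ⟨neg_le_neg this.2, by simp only [RadialContour.mir]; linarith [this.1]⟩
  inner t ht H := by
    simp only [RadialContour.mir]
    rw [G.inner (-t) ⟨by linarith [ht.2], by linarith [ht.1]⟩]
    intro w hw
    have := H (-w) (by
      rw [mem_uIcc] at hw ⊢
      rcases hw with h | h
      · right; constructor <;> linarith [h.1, h.2]
      · left; constructor <;> linarith [h.1, h.2])
    simp only [RadialContour.mir, neg_neg] at this
    exact ⟨by linarith [this.2], by linarith [this.1]⟩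
  xe h := by simp [RadialContour.mir, G.ye (by linarith)]
  ye h := by simp [RadialContour.mir, G.xe (by linarith)]
  pos c d hc hd hw hp := by
    have h1 := hw.mir
    have h2 := hp.mir
    rw [mir_mir] at h1 h2
    exact G.pos (-d) (-c) (by linarith) (by linarith) h1 h2
  neg u v h1 h2 h3 h4 h5 h6 h7 := by
    have h8 := h5.mir
    rw [mir_mir] at h8
    simp only [RadialContour.mir] at h6 h7
    exact G.neg (-v) (-u) (by linarith) (by linarith) (by linarith) (by linarith) h8 (by linarith)
      (by linarith)

/-- Times at which `q` is at `a` or `e`. -/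
structure Times (q : ℝ → ℝ) (a e xc yc w1 wp wl z1 zm zp : ℝ) : Prop where
  w1m : w1 ∈ Icc xc 0
  w1q : q w1 = a
  w1n : ∀ t ∈ Ioc w1 0, q t ≠ a
  wpm : wp ∈ Icc xc 0
  wpq : q wp = e
  wpn : ∀ t ∈ Ioc wp 0, q t ≠ e
  wlm : wl ∈ Icc xc 0
  wlq : q wl = e
  wln : ∀ t ∈ Ico xc wl, q t ≠ e
  z1m : z1 ∈ Icc 0 yc
  z1q : q z1 = e
  z1n : ∀ t ∈ Ico 0 z1, q t ≠ e
  zmm : zm ∈ Icc 0 yc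
  zmq : q zm = a
  zmn : ∀ t ∈ Ico 0 zm, q t ≠ a
  zpm : zp ∈ Icc 0 yc
  zpq : q zp = a
  zpn : ∀ t ∈ Ioc zp yc, q t ≠ a

lemma Times.mir {q : ℝ → ℝ} {a e xc yc w1 wp wl z1 zm zp : ℝ} (H : Times q a e xc yc w1 wp wl z1 zm zp) :
    Times (mir q) (-e) (-a) (-yc) (-xc) (-z1) (-zm) (-zp) (-w1) (-wp) (-wl) := by
  have aux : ∀ {l v : ℝ}, (q l = v) → RadialContour.mir q (-l) = -v := by
    intro l v h; simp [RadialContour.mir, h]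
  have aux2 : ∀ {l v : ℝ}, (q (-l) ≠ v) → RadialContour.mir q l ≠ -v := by
    intro l v h h'; simp only [RadialContour.mir] at h'; exact h (by linarith)
  have mem : ∀ {l x y : ℝ}, l ∈ Icc x y → -l ∈ Icc (-y) (-x) := fun h => ⟨by linarith [h.2], by linarith [h.1]⟩
  refine ⟨?_, aux H.z1q, ?_, ?_, aux H.zmq, ?_, ?_, aux H.zpq, ?_, ?_, aux H.w1q, ?_, ?_, aux H.wpq, ?_,
    ?_, aux H.wlq, ?_⟩
  · simpa using mem H.z1m
  · exact fun t ht => aux2 (H.z1n (-t) ⟨by linarith [ht.2], by linarith [ht.1]⟩)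
  · simpa using mem H.zmm
  · exact fun t ht => aux2 (H.zmn (-t) ⟨by linarith [ht.2], by linarith [ht.1]⟩)
  · simpa using mem H.zpm
  · exact fun t ht => aux2 (H.zpn (-t) ⟨by linarith [ht.2], by linarith [ht.1]⟩)
  · simpa using mem H.w1m
  · exact fun t ht => aux2 (H.w1n (-t) ⟨by linarith [ht.2], by linarith [ht.1]⟩)
  · simpa using mem H.wpm
  · exact fun t ht => aux2 (H.wpn (-t) ⟨by linarith [ht.2], by linarith [ht.1]⟩)
  · simpa using mem H.wlm
  · exact fun t ht => aux2 (H.wln (-t) ⟨by linarith [ht.2], by linarith [ht.1]⟩)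

/-- The situation in which folding `q` to the left creates a positive departure. -/
structure Bad (q φ : ℝ → ℝ) (a xc yc w1 zm zp c d : ℝ) : Prop where
  win : NWin q c d
  xc : xc ≤ c
  dy : d ≤ yc
  zd : zp < d
  ac : a < q c
  lt : ∀ t ∈ Ioc c w1, q t < q c
  phi : ∀ t ∈ Icc zm zp, φ (q c) < φ (q t)
  pos : 0 < q d

/-- The right hull matching `q '' [c, β]` stays in the band, so by maximality of the window its
parameter is at most `yc`. -/
lemma NWin.left_mem {q : ℝ → ℝ} {a e p r xc yc c d : ℝ} (W : Window q a e p r xc yc) (N : NWin q c d)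
    (hc : xc ≤ c) (hd : d ≤ yc) {t : ℝ} (ht : t ∈ Icc c 0) : ∃ y ∈ Icc 0 yc, q y = q t := by
  obtain ⟨β, hβ, y, hy, e⟩ := N.left c ⟨le_rfl, N.c0.le⟩
  have hyc : y ≤ yc := W.ymax y hy fun s hs => by
    have : q s ∈ q '' Icc c β := e ▸ ⟨s, hs, rfl⟩
    obtain ⟨s', hs', e'⟩ := this
    rw [← e']
    exact W.inD s' ⟨hc.trans hs'.1, hs'.2.trans (hβ.2.le.trans hd)⟩
  have : q t ∈ q '' Icc 0 y := e ▸ ⟨t, ⟨ht.1, ht.2.trans hβ.1⟩, rfl⟩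
  obtain ⟨s, hs, es⟩ := this
  exact ⟨s, ⟨hs.1, hs.2.trans hyc⟩, es⟩

/-! ### Folding within one time window -/

section step

variable {T q φm φp : ℝ → ℝ} {a e p r xc yc w1 wp wl z1 zm zp : ℝ}

lemma Times.gt_left (H : Times q a e xc yc w1 wp wl z1 zm zp) (qc : Continuous q) (q0 : q 0 = 0)
    (ha : a ≤ 0) {t : ℝ} (ht : t ∈ Ioc w1 0) : a < q t := by
  by_contra hcon
  obtain ⟨s, hs, es⟩ := intermediate_value_Icc ht.2 qc.continuousOn
    (show a ∈ Icc (q t) (q 0) from ⟨not_lt.1 hcon, by rw [q0]; exact ha⟩)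
  exact H.w1n s ⟨ht.1.trans_le hs.1, hs.2⟩ es

lemma Times.gt_right (H : Times q a e xc yc w1 wp wl z1 zm zp) (qc : Continuous q) (q0 : q 0 = 0)
    (ha : a ≤ 0) {t : ℝ} (ht : t ∈ Ico 0 zm) : a < q t := by
  by_contra hcon
  obtain ⟨s, hs, es⟩ := intermediate_value_Icc' ht.1 qc.continuousOn
    (show a ∈ Icc (q t) (q 0) from ⟨not_lt.1 hcon, by rw [q0]; exact ha⟩)
  exact H.zmn s ⟨hs.1, hs.2.trans_lt ht.2⟩ es

lemma Times.gt_last (H : Times q a e xc yc w1 wp wl z1 zm zp) (qc : Continuous q)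
    {d : ℝ} (hd : d ∈ Ioc zp yc) (hqd : a < q d) {t : ℝ} (ht : t ∈ Ioc zp yc) : a < q t := by
  by_contra hcon
  obtain ⟨s, hs, es⟩ := intermediate_value_uIcc (a := t) (b := d) qc.continuousOn
    (show a ∈ uIcc (q t) (q d) from by
      rw [mem_uIcc]; exact Or.inl ⟨not_lt.1 hcon, hqd.le⟩)
  have h1 : t ⊓ d > zp := lt_min ht.1 hd.1
  have h2 : t ⊔ d ≤ yc := max_le ht.2 hd.2
  exact H.zpn s ⟨h1.trans_le hs.1, hs.2.trans h2⟩ es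

/-- Fold `q` to the left before `w1` and between the first and last right visits to `a`. In the
window left of `0`, the result never exceeds `e`: folded values are nonpositive, and `q` visits `a`
before `e` by `PL`. So no negative departure of the band survives, and a surviving forbidden
positive departure has the shape recorded in `Bad`. -/
lemma good_fold_or_bad (F : Fold T a e p r φm φp) (W : Window q a e p r xc yc)
    (H : Times q a e xc yc w1 wp wl z1 zm zp) :
    (∃ s, Good T q a e p r xc yc s) ∨ ∃ c d, Bad q φm a xc yc w1 zm zp c d := by
  by_cases hbad : ∃ c d, Bad q φm a xc yc w1 zm zp c d
  · exact Or.inr hbad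
  left
  have hmp : zm ≤ zp := by
    by_contra hcon
    exact H.zmn zp ⟨H.zpm.1, not_le.1 hcon⟩ H.zpq
  have hfix : φm a = a := F.im a ⟨F.hpa, le_rfl⟩
  have hw0 := H.w1m.2
  have hz0 := H.zmm.1
  -- At all three junctions `q` equals `a`, which the fold fixes.
  set s : ℝ → ℝ := fun t => if t ≤ w1 then φm (q t) else
    if t ≤ zm then q t else if t ≤ zp then φm (q t) else q t with hs
  have s1 : ∀ t, t ≤ w1 → s t = φm (q t) := fun t ht => by simp [hs, ht]
  have s2 : ∀ t, w1 ≤ t → t ≤ zm → s t = q t := by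
    intro t h1 h2
    rcases h1.eq_or_lt with h | h
    · rw [s1 t h.ge, ← h, H.w1q, hfix]
    · simp [hs, not_le.2 h, h2]
  have s3 : ∀ t, zm ≤ t → t ≤ zp → s t = φm (q t) := by
    intro t h1 h2
    rcases h1.eq_or_lt with h | h
    · rw [s2 t (by linarith) h.ge, ← h, H.zmq, hfix]
    · simp [hs, not_le.2 h, h2]
  have s4 : ∀ t, zp ≤ t → s t = q t := by
    intro t h1
    rcases h1.eq_or_lt with h | h
    · rw [s3 t (by linarith) h.ge, ← h, H.zpq, hfix]
    · have h2 : ¬ t ≤ zm := by linarith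
      have h3 : ¬ t ≤ w1 := by linarith
      simp [hs, not_le.2 h, h2, h3]
  have qc := W.qc
  have fqc : Continuous fun t => φm (q t) := F.cm.comp qc
  have sc : Continuous s := by
    refine Continuous.if_le fqc ?_ continuous_id continuous_const ?_
    · refine Continuous.if_le qc ?_ continuous_id continuous_const ?_
      · refine Continuous.if_le fqc qc continuous_id continuous_const ?_
        rintro t rfl
        rw [H.zpq, hfix]
      · rintro t rfl
        simp [hmp, H.zmq, hfix]
    · rintro t rfl
      have : t ≤ zm := hw0.trans hz0
      simp [this, H.w1q, hfix]
  have scases : ∀ t ∈ Icc xc yc, s t = q t ∨ s t = φm (q t) := by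
    intro t ht
    rcases le_total t w1 with h | h
    · exact Or.inr (s1 t h)
    rcases le_total t zm with h' | h'
    · exact Or.inl (s2 t h h')
    rcases le_total t zp with h'' | h''
    · exact Or.inr (s3 t h' h'')
    · exact Or.inl (s4 t h'')
  have hr0 : 0 ≤ r := F.he.trans F.her
  have s00 : s 0 = 0 := by rw [s2 0 hw0 hz0, W.q0]
  refine ⟨s, sc, s00, ?_, ?_, ?_, ?_, ?_, ?_, ?_⟩
  · intro t ht
    rcases scases t ht with h | h <;> rw [h]
    exact F.Tm _ (W.inD t ht)
  · intro t ht
    rcases scases t ht with h | h <;> rw [h]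
    · exact W.inD t ht
    · have := F.mm _ (W.inD t ht)
      exact ⟨this.1, this.2.trans hr0⟩
  · intro t ht hin
    rcases le_total t 0 with h0 | h0
    · rw [uIcc_of_ge h0] at hin
      refine s2 t ?_ (h0.trans hz0)
      by_contra hcon
      have := (hin w1 ⟨(not_le.1 hcon).le, hw0⟩).1
      rw [H.w1q] at this; exact lt_irrefl _ this
    · rw [uIcc_of_le h0] at hin
      refine s2 t (hw0.trans h0) ?_
      by_contra hcon
      have := (hin zm ⟨hz0, (not_le.1 hcon).le⟩).1
      rw [H.zmq] at this; exact lt_irrefl _ this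
  · intro hx
    rw [s1 xc H.w1m.1, W.xexit hx, F.im _ ⟨le_rfl, F.hpa⟩]
  · intro _
    exact s4 yc H.zpm.2
  · intro c d hc hd N P
    have hc0 := N.c0
    have hd0 := N.d0
    have hs0 := P 0 ⟨hc0, hd0⟩
    rw [s00] at hs0
    have hdm : d ∈ Icc xc yc := ⟨by linarith, hd⟩
    have hcm : c ∈ Icc xc yc := ⟨hc, by linarith⟩
    rcases lt_or_ge d zm with hdz | hdz
    · have sd := s2 d (by linarith) hdz.le
      rcases lt_or_ge w1 c with hcw | hcw
      · refine N.not_posDep fun t ht => ?_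
        have := P t ht
        rwa [s2 t (by linarith [ht.1]) (by linarith [ht.2]), s2 c hcw.le (by linarith), sd] at this
      -- The image of `[w1, β]` contains `a`, so the matching right hull extends past `zm`, hence
      -- past `d`; thus `q d` is taken on `[w1, β]`, before `d`.
      · obtain ⟨β, hβ, y, hy, ey⟩ := N.left w1 ⟨hcw, hw0⟩
        have h1 : q w1 ∈ q '' Icc 0 y := ey ▸ ⟨w1, ⟨le_rfl, hw0.trans hβ.1⟩, rfl⟩
        obtain ⟨t, ht, et⟩ := h1
        rw [H.w1q] at et
        have hzt : zm ≤ t := by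
          by_contra hcon
          exact H.zmn t ⟨ht.1, not_le.1 hcon⟩ et
        have h2 : q d ∈ q '' Icc w1 β := ey ▸ ⟨d, ⟨hd0.le, by linarith [ht.2]⟩, rfl⟩
        obtain ⟨t', ht', et'⟩ := h2
        rcases (hcw.trans ht'.1).eq_or_lt with h | h
        · have : t' = w1 := le_antisymm (h ▸ hcw) ht'.1
          rw [this, H.w1q] at et'
          have := hs0.2
          rw [sd, ← et'] at this
          linarith [F.ha]
        · have := (P t' ⟨h, by linarith [ht'.2, hβ.2]⟩).2
          rw [s2 t' ht'.1 (by linarith [ht'.2, hβ.2]), sd, et'] at this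
          exact lt_irrefl _ this
    -- A folded end value would be nonpositive, whereas the upper end of a positive departure is
    -- above `s 0 = 0`.
    · have hzd : zp < d := by
        by_contra hcon
        have := hs0.2
        rw [s3 d hdz (not_lt.1 hcon)] at this
        linarith [(F.mm _ (W.inD d hdm)).2]
      have sd := s4 d hzd.le
      have hzmem : zm ∈ Ioo c d := ⟨by linarith, by linarith⟩
      have hzv := P zm hzmem
      rw [s2 zm (by linarith) le_rfl, H.zmq] at hzv
      rcases lt_trichotomy c w1 with hcw | hcw | hcw
      · have sc' := s1 c hcw.le
        rw [sd] at hs0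
        -- If `q c ≤ a`, the right path takes the value `q c` between `zm` and `zp`, where it is
        -- folded to the same value as at `c`; this contradicts the departure.
        by_cases hqc : q c ≤ a
        · obtain ⟨y, hy, ey⟩ := N.left_mem W hc hd ⟨le_rfl, hc0.le⟩
          have hzy : zm ≤ y := by
            by_contra hcon
            have := H.gt_right qc W.q0 F.ha ⟨hy.1, not_le.1 hcon⟩
            linarith
          have hyz : y ≤ zp := by
            by_contra hcon
            have := H.gt_last qc ⟨hzd, hd⟩ (by linarith [F.ha, hs0.2]) ⟨not_le.1 hcon, hy.2⟩
            linarith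
          have := (P y ⟨by linarith, by linarith⟩).1
          rw [s3 y hzy hyz, ey, sc'] at this
          exact lt_irrefl _ this
        · refine hbad ⟨c, d, N, hc, hd, hzd, not_le.1 hqc, ?_, ?_, hs0.2⟩
          · intro t ht
            by_contra hcon
            obtain ⟨s', hs', es'⟩ := intermediate_value_Icc' ht.2 qc.continuousOn
              (show q c ∈ Icc (q w1) (q t) from ⟨by rw [H.w1q]; exact (not_le.1 hqc).le, not_lt.1 hcon⟩)
            have := (P s' ⟨ht.1.trans_le hs'.1, by linarith [hs'.2]⟩).1
            rw [s1 s' hs'.2, es', sc'] at this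
            exact lt_irrefl _ this
          · intro t ht
            have := (P t ⟨by linarith [ht.1], by linarith [ht.2]⟩).1
            rwa [s3 t ht.1 ht.2, sc'] at this
      · rw [hcw, s2 w1 le_rfl (by linarith), H.w1q] at hzv
        exact lt_irrefl _ hzv.1
      · rw [s2 c hcw.le (by linarith)] at hzv
        have := H.gt_left qc W.q0 F.ha ⟨hcw, hc0.le⟩
        linarith [hzv.1]
  · intro u v hu hu0 hv0 hv _ heu _
    have hum : u ∈ Icc xc yc := ⟨hu, by linarith⟩
    rcases le_or_gt u w1 with h | h
    · rw [s1 u h] at heu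
      linarith [(F.mm _ (W.inD u hum)).2, F.he]
    · rw [s2 u h.le (by linarith)] at heu
      obtain ⟨x', hx', ex'⟩ := W.PL u ⟨hu, hu0.le⟩ heu.le
      exact H.w1n x' ⟨h.trans_le hx'.1, hx'.2⟩ ex'

/-- The window condition at the right minimum `τ` gives a left hull containing `q τ`. On the left
this low value occurs only before `wl`, hence before the left maximum `κ`, so `q κ` is taken on `[α,
τ]`. The part before `w1` stays below `q c ≤ q κ`, the part from `w1` to `0` stays below `e`, `hM`
excludes `[0, zm]`, and afterwards `q` would cross `q c`, against `B.phi`. -/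
lemma Bad.not_of_early (F : Fold T a e p r φm φp) (W : Window q a e p r xc yc)
    (H : Times q a e xc yc w1 wp wl z1 zm zp) {c d τ κ : ℝ} (B : Bad q φm a xc yc w1 zm zp c d)
    (hτ : τ ∈ Icc 0 yc) (hτm : ∀ t ∈ Icc 0 yc, q τ ≤ q t) (hκ : κ ∈ Icc xc 0)
    (hκm : ∀ t ∈ Icc xc 0, q t ≤ q κ) (hm : ∀ t ∈ Icc wp 0, q t ≠ q τ)
    (hM : ∀ t ∈ Icc 0 zm, q t ≠ q κ) (he : ∀ t ∈ Icc wl wp, a < q t) : False := by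
  have qc := W.qc
  have q0 := W.q0
  have hma : q τ ≤ a := H.zmq ▸ hτm zm H.zmm
  have hLm : ∀ t ∈ Icc wl 0, q τ < q t := by
    intro t ht
    rcases le_total t wp with h | h
    · exact hma.trans_lt (he t ⟨ht.1, h⟩)
    · by_contra hcon
      obtain ⟨s, hs, es⟩ := intermediate_value_Icc ht.2 qc.continuousOn
        (show q τ ∈ Icc (q t) (q 0) from ⟨not_lt.1 hcon, by rw [q0]; linarith [F.ha]⟩)
      exact hm s ⟨h.trans hs.1, hs.2⟩ es
  have hd0 := B.win.d0
  have hzτ : zm ≤ τ := by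
    by_contra hcon
    have := H.gt_right qc q0 F.ha ⟨hτ.1, not_le.1 hcon⟩
    linarith
  have hτz : τ ≤ zp := by
    by_contra hcon
    have := H.gt_last qc ⟨B.zd, B.dy⟩ (by linarith [F.ha, B.pos]) ⟨not_le.1 hcon, hτ.2⟩
    linarith
  obtain ⟨α, hα, x, hx, ex⟩ := B.win.right τ ⟨hτ.1, by linarith [B.zd]⟩
  have hxx : xc ≤ x := W.xmax x hx fun s hs => by
    have : q s ∈ q '' Icc α τ := ex ▸ ⟨s, hs, rfl⟩
    obtain ⟨s', hs', e'⟩ := this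
    rw [← e']
    exact W.inD s' ⟨by linarith [B.xc, hα.1, hs'.1], hs'.2.trans hτ.2⟩
  have h1 : q τ ∈ q '' Icc x 0 := ex ▸ ⟨τ, ⟨hα.2.trans hτ.1, le_rfl⟩, rfl⟩
  obtain ⟨t, ht, et⟩ := h1
  have htl : t < wl := by
    by_contra hcon
    have := hLm t ⟨not_lt.1 hcon, ht.2⟩
    linarith
  have heM : e ≤ q κ := H.wlq ▸ hκm wl H.wlm
  have hae : a ≤ e := F.ha.trans F.he
  have hκl : wl ≤ κ := by
    by_contra hcon
    rw [not_le] at hcon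
    obtain ⟨s, hs, es⟩ := intermediate_value_uIcc (a := t) (b := κ) qc.continuousOn
      (show e ∈ uIcc (q t) (q κ) from by
        rw [mem_uIcc]; exact Or.inl ⟨by linarith, heM⟩)
    have h2 : t ⊓ κ ≥ xc := le_min (hxx.trans ht.1) hκ.1
    have h3 : t ⊔ κ < wl := max_lt htl hcon
    exact H.wln s ⟨h2.le.trans hs.1, hs.2.trans_lt h3⟩ es
  have h2 : q κ ∈ q '' Icc α τ := ex ▸ ⟨κ, ⟨by linarith [ht.1], hκ.2⟩, rfl⟩
  obtain ⟨s, hs, es⟩ := h2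
  have hcκ : q c ≤ q κ := hκm c ⟨B.xc, B.win.c0.le⟩
  rcases le_or_gt s w1 with h | h
  · have := B.lt s ⟨hα.1.trans_le hs.1, h⟩
    linarith
  rcases le_or_gt s 0 with h' | h'
  · obtain ⟨x', hx', ex'⟩ := W.PL s ⟨by linarith [H.w1m.1], h'⟩ (by linarith)
    exact H.w1n x' ⟨h.trans_le hx'.1, hx'.2⟩ ex'
  rcases le_total s zm with h'' | h''
  · exact hM s ⟨h'.le, h''⟩ es
  · obtain ⟨s', hs', es'⟩ := intermediate_value_Icc h'' qc.continuousOn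
      (show q c ∈ Icc (q zm) (q s) from ⟨by rw [H.zmq]; exact B.ac.le, by linarith⟩)
    have := B.phi s' ⟨hs'.1, by linarith [hs'.2, hs.2]⟩
    rw [es'] at this
    exact lt_irrefl _ this

/-- Between `zm` and some time at height at least `e`, the path takes all values in `[a, e]`;
`B.phi` then puts their folds above that of `q c`, which therefore exceeds `e`. Right values at most
`a` occur only in `[zm, zp]` and are fixed by the fold. -/
lemma Bad.facts (F : Fold T a e p r φm φp) (W : Window q a e p r xc yc)
    (H : Times q a e xc yc w1 wp wl z1 zm zp) {c d : ℝ} (B : Bad q φm a xc yc w1 zm zp c d)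
    (he : ∃ t ∈ Icc zm zp, e ≤ q t) :
    e < q c ∧ φm (q c) < φm e ∧ ∀ y ∈ Icc 0 yc, q y ≤ a → φm (q c) < q y := by
  have qc := W.qc
  obtain ⟨t, ht, het⟩ := he
  have hat : ∀ v, a ≤ v → v ≤ e → φm (q c) < φm v := by
    intro v h1 h2
    obtain ⟨s, hs, es⟩ := intermediate_value_Icc ht.1 qc.continuousOn
      (show v ∈ Icc (q zm) (q t) from ⟨by rw [H.zmq]; exact h1, h2.trans het⟩)
    exact es ▸ B.phi s ⟨hs.1, hs.2.trans ht.2⟩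
  refine ⟨?_, hat e (F.ha.trans F.he) le_rfl, ?_⟩
  · by_contra hcon
    exact lt_irrefl _ (hat (q c) B.ac.le (not_lt.1 hcon))
  · intro y hy hya
    have hzy : zm ≤ y := by
      by_contra hcon
      have := H.gt_right qc W.q0 F.ha ⟨hy.1, not_le.1 hcon⟩
      linarith
    have hyz : y ≤ zp := by
      by_contra hcon
      have := H.gt_last qc ⟨B.zd, B.dy⟩ (by linarith [F.ha, B.pos]) ⟨not_le.1 hcon, hy.2⟩
      linarith
    have h1 := B.phi y ⟨hzy, hyz⟩
    have h2 := W.inD y ⟨by linarith [W.xm.2, hy.1], hy.2⟩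
    rwa [F.im (q y) ⟨h2.1, hya⟩] at h1

lemma good_self (W : Window q a e p r xc yc)
    (h : ∀ u v, xc ≤ u → u < 0 → 0 < v → v ≤ yc → NegDep q u v → e < q u → q v < a → False) :
    Good T q a e p r xc yc q where
  c := W.qc
  z := W.q0
  lift _ _ := rfl
  inD := W.inD
  inner _ _ _ := rfl
  xe _ := rfl
  ye _ := rfl
  pos _ _ _ _ N P := N.not_posDep P
  neg := h

lemma exists_nearest_left (qc : Continuous q) {x y v : ℝ} (h : ∃ t ∈ Icc x y, q t = v) :
    ∃ w ∈ Icc x y, q w = v ∧ ∀ t ∈ Ioc w y, q t ≠ v := by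
  have hcomp : IsCompact (Icc x y ∩ q ⁻¹' {v}) :=
    isCompact_Icc.inter_right (isClosed_singleton.preimage qc)
  obtain ⟨s, hs⟩ := h
  obtain ⟨w, hw, hm⟩ := hcomp.exists_isGreatest ⟨s, hs⟩
  exact ⟨w, hw.1, hw.2, fun t ht hcon => absurd (hm ⟨⟨hw.1.1.trans ht.1.le, ht.2⟩, hcon⟩) (not_le.2 ht.1)⟩

lemma exists_nearest_right (qc : Continuous q) {x y v : ℝ} (h : ∃ t ∈ Icc x y, q t = v) :
    ∃ w ∈ Icc x y, q w = v ∧ ∀ t ∈ Ico x w, q t ≠ v := by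
  have hcomp : IsCompact (Icc x y ∩ q ⁻¹' {v}) :=
    isCompact_Icc.inter_right (isClosed_singleton.preimage qc)
  obtain ⟨s, hs⟩ := h
  obtain ⟨w, hw, hm⟩ := hcomp.exists_isLeast ⟨s, hs⟩
  exact ⟨w, hw.1, hw.2, fun t ht hcon => absurd (hm ⟨⟨ht.1, ht.2.le.trans hw.1.2⟩, hcon⟩) (not_le.2 ht.2)⟩

/-- The departures of a single band can be removed. -/
lemma exists_good (F : Fold T a e p r φm φp) (W : Window q a e p r xc yc) :
    ∃ s, Good T q a e p r xc yc s := by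
  have qc := W.qc
  have q0 := W.q0
  have ha := F.ha
  have he := F.he
  by_cases hRa : ∃ t ∈ Icc 0 yc, q t = a
  swap
  · refine ⟨q, good_self W fun u v _ _ hv0 hv _ _ hqv => hRa ?_⟩
    obtain ⟨s, hs, es⟩ := intermediate_value_Icc' hv0.le qc.continuousOn
      (show a ∈ Icc (q v) (q 0) from ⟨hqv.le, by rw [q0]; exact ha⟩)
    exact ⟨s, ⟨hs.1, hs.2.trans hv⟩, es⟩
  by_cases hLe : ∃ t ∈ Icc xc 0, q t = e
  swap
  · refine ⟨q, good_self W fun u v hu hu0 _ _ _ hqu _ => hLe ?_⟩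
    obtain ⟨s, hs, es⟩ := intermediate_value_Icc' hu0.le qc.continuousOn
      (show e ∈ Icc (q 0) (q u) from ⟨by rw [q0]; exact he, hqu.le⟩)
    exact ⟨s, ⟨hu.trans hs.1, hs.2⟩, es⟩
  have hLa : ∃ t ∈ Icc xc 0, q t = a := by
    obtain ⟨t, ht, et⟩ := hLe
    obtain ⟨t', ht', et'⟩ := W.PL t ht et.ge
    exact ⟨t', ⟨ht.1.trans ht'.1, ht'.2⟩, et'⟩
  have hRe : ∃ t ∈ Icc 0 yc, q t = e := by
    obtain ⟨t, ht, et⟩ := hRa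
    obtain ⟨t', ht', et'⟩ := W.PR t ht et.le
    exact ⟨t', ⟨ht'.1, ht'.2.trans ht.2⟩, et'⟩
  obtain ⟨w1, a1, a2, a3⟩ := exists_nearest_left qc hLa
  obtain ⟨wp, b1, b2, b3⟩ := exists_nearest_left qc hLe
  obtain ⟨wl, c1, c2, c3⟩ := exists_nearest_right qc hLe
  obtain ⟨z1, d1, d2, d3⟩ := exists_nearest_right qc hRe
  obtain ⟨zm, e1, e2, e3⟩ := exists_nearest_right qc hRa
  obtain ⟨zp, f1, f2, f3⟩ := exists_nearest_left qc hRa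
  have H : Times q a e xc yc w1 wp wl z1 zm zp :=
    ⟨a1, a2, a3, b1, b2, b3, c1, c2, c3, d1, d2, d3, e1, e2, e3, f1, f2, f3⟩
  obtain ⟨τ, hτ, hτm⟩ := isCompact_Icc.exists_isMinOn (nonempty_Icc.2 W.ym.1) qc.continuousOn
  obtain ⟨κ, hκ, hκm⟩ := isCompact_Icc.exists_isMaxOn (nonempty_Icc.2 W.xm.2) qc.continuousOn
  rw [isMinOn_iff] at hτm
  rw [isMaxOn_iff] at hκm
  -- A departure of the band starts before `wp` and ends after `zm`. If its interior already
  -- contains the right minimum, or in the next case the left maximum, it cannot depart, so `q`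
  -- itself is good.
  by_cases hm : ∃ t ∈ Icc wp 0, q t = q τ
  · refine ⟨q, good_self W fun u v hu hu0 hv0 hv hn hqu _ => ?_⟩
    obtain ⟨t, ht, et⟩ := hm
    have huw : u < wp := by
      by_contra hcon
      obtain ⟨s, hs, es⟩ := intermediate_value_Icc' hu0.le qc.continuousOn
        (show e ∈ Icc (q 0) (q u) from ⟨by rw [q0]; exact he, hqu.le⟩)
      rcases (not_lt.1 hcon).trans hs.1 |>.eq_or_lt with h | h
      · have : u = wp := le_antisymm (by rw [h]; exact hs.1) (not_lt.1 hcon)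
        rw [this, b2] at hqu; exact lt_irrefl _ hqu
      · exact b3 s ⟨h, hs.2⟩ es
    have h1 := (hn t ⟨by linarith [ht.1], by linarith [ht.2]⟩).1
    have h2 := hτm v ⟨hv0.le, hv⟩
    linarith
  by_cases hM : ∃ t ∈ Icc 0 zm, q t = q κ
  · refine ⟨q, good_self W fun u v hu hu0 hv0 hv hn _ hqv => ?_⟩
    obtain ⟨t, ht, et⟩ := hM
    have hzv : zm < v := by
      by_contra hcon
      rcases (not_lt.1 hcon).eq_or_lt with h | h
      · rw [h, e2] at hqv; exact lt_irrefl _ hqv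
      · have := H.gt_right qc q0 ha ⟨hv0.le, h⟩; linarith
    have h1 := (hn t ⟨by linarith [ht.1], by linarith [ht.2]⟩).2
    have h2 := hκm u ⟨hu, hu0.le⟩
    linarith
  push Not at hm hM
  rcases good_fold_or_bad F W H with h | ⟨c, d, B⟩
  · exact h
  rcases good_fold_or_bad F.mirror W.mir H.mir with ⟨s, hs⟩ | ⟨c', d', B'⟩
  · refine ⟨mir s, ?_⟩
    have := hs.mir
    simpa using this
  exfalso
  have mq : ∀ t, mir q t = - q (-t) := fun t => rfl
  have mem : ∀ {l x y : ℝ}, l ∈ Icc (-x) (-y) → -l ∈ Icc y x := fun h => ⟨by linarith [h.2], by linarith [h.1]⟩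
  have mem0 : ∀ {l x : ℝ}, l ∈ Icc (-x) 0 → -l ∈ Icc 0 x := fun h => ⟨by linarith [h.2], by linarith [h.1]⟩
  have mem0' : ∀ {l x : ℝ}, l ∈ Icc 0 (-x) → -l ∈ Icc x 0 := fun h => ⟨by linarith [h.2], by linarith [h.1]⟩
  by_cases hE : ∀ t ∈ Icc wl wp, a < q t
  · exact B.not_of_early F W H hτ hτm hκ hκm hm hM hE
  by_cases hE' : ∀ t ∈ Icc zm zp, q t < e
  · refine B'.not_of_early F.mirror W.mir H.mir (τ := -κ) (κ := -τ) ⟨by linarith [hκ.2], by linarith [hκ.1]⟩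
      (fun t ht => ?_) ⟨by linarith [hτ.2], by linarith [hτ.1]⟩ (fun t ht => ?_) (fun t ht => ?_)
      (fun t ht => ?_) (fun t ht => ?_)
    · rw [mq, mq, neg_neg]; exact neg_le_neg (hκm _ (mem0' ht))
    · rw [mq, mq, neg_neg]; exact neg_le_neg (hτm _ (mem0 ht))
    · rw [mq, mq, neg_neg]; exact fun h => hM _ (mem0 ht) (neg_injective h)
    · rw [mq, mq, neg_neg]; exact fun h => hm _ (mem0' ht) (neg_injective h)
    · rw [mq]; exact neg_lt_neg (hE' _ (mem ht))
  push Not at hE hE'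
  obtain ⟨g1, g2, g3⟩ := B.facts F W H hE'
  obtain ⟨k1, k2, k3⟩ := B'.facts F.mirror W.mir H.mir (by
    obtain ⟨t, ht, et⟩ := hE
    exact ⟨-t, ⟨by linarith [ht.2], by linarith [ht.1]⟩, by rw [mq, neg_neg]; linarith⟩)
  rw [mq] at k1 k2 k3
  simp only [neg_neg] at k2 k3
  have hcm : c ∈ Icc xc 0 := ⟨B.xc, B.win.c0.le⟩
  have hdm : -c' ∈ Icc 0 yc := ⟨by linarith [B'.win.c0], by linarith [B'.xc]⟩
  have hc1 := W.inD c ⟨hcm.1, hcm.2.trans W.ym.1⟩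
  have hd1 := W.inD (-c') ⟨W.xm.2.trans hdm.1, hdm.2⟩
  have h3 := g3 (-c') hdm (by linarith)
  have h4 := k3 (-c) ⟨by linarith [hcm.2], by linarith [hcm.1]⟩ (by rw [mq, neg_neg]; linarith)
  rw [mq, neg_neg] at h4
  -- If both choices fail, the left fold of `q c` and the right fold of `q (-c')` would cross.
  exact F.phi (q (-c')) ⟨hd1.1, by linarith⟩ (q c) ⟨g1.le, hc1.2⟩ h3 g2 (by linarith) (by linarith)

end step

/-! ### Removing all negative departures -/

/-- A path starting at `0` whose hulls are mapped by `T` to left hulls of `T`. -/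
structure Path (T g : ℝ → ℝ) : Prop where
  c : Continuous g
  z : g 0 = 0
  m : ∀ x ∈ Icc (0 : ℝ) 1, g x ∈ Icc (-1 : ℝ) 1
  chain : ∀ x ∈ Icc (0 : ℝ) 1, In (dp (refl T)) (hi (refl T)) (dp T) (hi T) (dp g x) (hi g x)

/-- The path covers exactly the interval from `-dp g x` to `hi g x`, so the hull of `T ∘ g` is the
union of a left and a right hull of `T`. -/
lemma hi_comp {T g : ℝ → ℝ} (Tc : Continuous T) (gc : Continuous g) (g0 : g 0 = 0) {x : ℝ} (hx : 0 ≤ x) :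
    hi (T ∘ g) x = max (hi (refl T) (dp g x)) (hi T (hi g x)) := by
  have hd := dp_nonneg gc g0 x
  have hu := hi_nonneg gc g0 x
  have im := image_Icc_eq gc hx
  apply le_antisymm
  · refine hi_le (Tc.comp gc) hx fun t ht => ?_
    have h1 : g t ∈ Icc (- dp g x) (hi g x) := im ▸ ⟨t, ht, rfl⟩
    rw [le_max_iff]
    rcases le_total 0 (g t) with h | h
    · exact Or.inr (le_hi Tc h h1.2)
    · left
      have := le_hi (BiZig.refl_continuous Tc) (x := - g t) (y := dp g x) (by linarith) (by linarith [h1.1])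
      simpa [refl] using this
  · apply max_le
    · obtain ⟨z, hz, ez⟩ := exists_hi (BiZig.refl_continuous Tc) hd
      have : -z ∈ g '' Icc 0 x := im ▸ ⟨by linarith [hz.2], by linarith [hz.1]⟩
      obtain ⟨t, ht, et⟩ := this
      rw [← ez, refl, ← et]
      exact le_hi (Tc.comp gc) ht.1 ht.2
    · obtain ⟨z, hz, ez⟩ := exists_hi Tc hu
      have : z ∈ g '' Icc 0 x := im ▸ ⟨by linarith [hz.1], hz.2⟩
      obtain ⟨t, ht, et⟩ := this
      rw [← ez, ← et]
      exact le_hi (Tc.comp gc) ht.1 ht.2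

lemma dp_comp {T g : ℝ → ℝ} (Tc : Continuous T) (gc : Continuous g) (g0 : g 0 = 0) {x : ℝ} (hx : 0 ≤ x) :
    dp (T ∘ g) x = max (dp (refl T) (dp g x)) (dp T (hi g x)) :=
  hi_comp (T := fun y => - T y) (cneg Tc) gc g0 hx

lemma Path.of_chain {T g h : ℝ → ℝ} (Tc : Continuous T) (gc : Continuous g) (g0 : g 0 = 0)
    (gm : ∀ x ∈ Icc (0 : ℝ) 1, g x ∈ Icc (-1 : ℝ) 1)
    (e : ∀ x ∈ Icc (0 : ℝ) 1, T (g x) = h x)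
    (H : ∀ x ∈ Icc (0 : ℝ) 1, ∃ m ∈ Icc (0 : ℝ) 1, dp h x = dp (refl T) m ∧ hi h x = hi (refl T) m) :
    Path T g := by
  refine ⟨gc, g0, gm, fun x hx => ?_⟩
  obtain ⟨m, hm, h1, h2⟩ := H x hx
  have he : EqOn (T ∘ g) h (Icc 0 x) := fun y hy => e y ⟨hy.1, hy.2.trans hx.2⟩
  exact ⟨m, hm, by rw [← h1, ← dp_comp Tc gc g0 hx.1, dp_congr hx.1 he],
    by rw [← h2, ← hi_comp Tc gc g0 hx.1, hi_congr hx.1 he]⟩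

lemma Path.first {T g : ℝ → ℝ} (P : Path T g) {x M : ℝ} (hx : x ∈ Icc (0 : ℝ) 1) (hM : M ∈ Icc 0 (hi g x)) :
    ∃ y ∈ Icc 0 x, hi g y = M ∧ In (dp (refl T)) (hi (refl T)) (dp T) (hi T) (dp g y) M := by
  obtain ⟨y, hy, ey⟩ := intermediate_value_Icc hx.1 (hi_continuous P.c).continuousOn
    (show M ∈ Icc (hi g 0) (hi g x) from ⟨by rw [hi_of_nonpos le_rfl, P.z]; exact hM.1, hM.2⟩)
  refine ⟨y, hy, ey, ?_⟩
  have := P.chain y ⟨hy.1, hy.2.trans hx.2⟩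
  rwa [ey] at this

/-- When the running maximum equals `e`, the union of hulls is a left hull, and `left_le_of_in`
forces the path to have gone down to `-A`. -/
lemma Path.hit_left {T g : ℝ → ℝ} (Z : BiZig T) (P : Path T g) {A e m0 M0 p r : ℝ}
    (B : TBand T A e m0 M0 p r) {x : ℝ} (hx : x ∈ Icc (0 : ℝ) 1) (he : e ≤ g x) :
    ∃ y ∈ Icc 0 x, g y = -A := by
  obtain ⟨y, hy, -, hin⟩ := P.first hx ⟨B.e0, he.trans (le_hi P.c hx.1 le_rfl)⟩
  have h1 := B.left_le_of_in Z.chainL.toRunning (dp_nonneg P.c P.z y) hin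
  have : -A ∈ g '' Icc 0 y := by
    rw [image_Icc_eq P.c hy.1]
    exact ⟨by linarith, by linarith [B.A0, hi_nonneg P.c P.z y]⟩
  obtain ⟨t, ht, et⟩ := this
  exact ⟨t, ⟨ht.1, ht.2.trans hy.2⟩, et⟩

/-- Passing `r` without going below `-p` would produce a union of hulls excluded by
`exists_forall_not_in`. -/
lemma Path.le_of_ge {T g : ℝ → ℝ} (Z : BiZig T) (P : Path T g) {A e m0 M0 p r : ℝ}
    (B : TBand T A e m0 M0 p r) {x : ℝ} (hx : x ∈ Icc (0 : ℝ) 1) (hp : ∀ t ∈ Icc 0 x, -p ≤ g t) :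
    g x ≤ r := by
  by_contra hcon
  rw [not_le] at hcon
  have hr0 : 0 ≤ r := B.e0.trans (B.eM.trans B.Mr)
  obtain ⟨M', hM', hno⟩ := B.exists_forall_not_in Z.chainL.toRunning Z.chainR.toRunning (M := g x) ⟨hcon, (P.m x hx).2⟩
  obtain ⟨y, hy, -, hin⟩ := P.first hx ⟨hr0.trans hM'.1.le, hM'.2.trans (le_hi P.c hx.1 le_rfl)⟩
  exact hno _ ⟨dp_nonneg P.c P.z y, dp_le P.c hy.1 fun t ht => hp t ⟨ht.1, ht.2.trans hy.2⟩⟩ hin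

/-- By `Path.le_of_ge` the path can leave `[-p, r]` only through `-p`. Continuity keeps it below `r`
for a short time afterwards. -/
lemma Path.exit {T g : ℝ → ℝ} (Z : BiZig T) (P : Path T g) {A e m0 M0 p r : ℝ}
    (B : TBand T A e m0 M0 p r) (hpr : -p < r) :
    ∃ x ∈ Icc (0 : ℝ) 1, (∀ t ∈ Icc 0 x, g t ∈ Icc (-p) r) ∧
      (∀ y ∈ Icc (0 : ℝ) 1, (∀ t ∈ Icc 0 y, g t ∈ Icc (-p) r) → y ≤ x) ∧ (x < 1 → g x = -p ∧
      ∀ m ∈ Ioc x 1, ∃ t ∈ Ioc x m, g t < -p ∧ ∀ s ∈ Icc 0 t, g s ≤ r) := by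
  have hr0 : 0 ≤ r := B.e0.trans (B.eM.trans B.Mr)
  have hp0 : 0 ≤ p := B.A0.trans (B.Am.trans B.mp)
  obtain ⟨x, hx, hsub, hex⟩ := exists_right_end (K := g ⁻¹' Icc (-p) r) (isClosed_Icc.preimage P.c)
    (x := 0) (b := 1) (by simp [P.z, hr0, hp0]) zero_le_one
  refine ⟨x, hx, hsub, ?_, ?_⟩
  · intro y hy hyD
    by_contra hcon
    obtain ⟨m', hm', hno⟩ := hex y ⟨not_le.1 hcon, hy.2⟩
    exact hno (hyD m' ⟨hx.1.trans hm'.1.le, hm'.2⟩)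
  · intro hx1
    have hgx := hsub (right_mem_Icc.2 hx.1)
    have hexit : g x = -p := by
      by_contra hne
      have hlt : -p < g x := lt_of_le_of_ne hgx.1 (Ne.symm hne)
      obtain ⟨δ, hδ, hball⟩ := Metric.continuousAt_iff.1 (P.c.continuousAt (x := x)) (g x + p) (by linarith)
      have hmin : x < min 1 (x + δ / 2) := lt_min hx1 (by linarith)
      obtain ⟨m', hm', hno⟩ := hex (min 1 (x + δ / 2)) ⟨hmin, min_le_left _ _⟩
      have hge : ∀ t ∈ Icc 0 m', -p ≤ g t := by
        intro t ht
        rcases le_total t x with h | h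
        · exact (hsub ⟨ht.1, h⟩).1
        · have h2 := hm'.2.trans (min_le_right _ _)
          have := hball (x := t) (by rw [Real.dist_eq, abs_lt]; constructor <;> linarith [ht.2])
          rw [Real.dist_eq, abs_lt] at this
          linarith [this.1]
      have h01 : m' ∈ Icc (0 : ℝ) 1 := ⟨hx.1.trans hm'.1.le, hm'.2.trans (min_le_left _ _)⟩
      exact hno ⟨hge m' ⟨h01.1, le_rfl⟩, P.le_of_ge Z B h01 hge⟩
    refine ⟨hexit, fun m hm => ?_⟩
    obtain ⟨δ, hδ, hball⟩ := Metric.continuousAt_iff.1 (P.c.continuousAt (x := x)) (r + p) (by linarith)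
    have hmin : x < min m (x + δ / 2) := lt_min hm.1 (by linarith)
    obtain ⟨t, ht, hno⟩ := hex (min m (x + δ / 2)) ⟨hmin, (min_le_left _ _).trans hm.2⟩
    have hle : ∀ s ∈ Icc 0 t, g s ≤ r := by
      intro s hs
      rcases le_total s x with h | h
      · exact (hsub ⟨hs.1, h⟩).2
      · have h2 := ht.2.trans (min_le_right _ _)
        have := hball (x := s) (by rw [Real.dist_eq, abs_lt]; constructor <;> linarith [hs.2])
        rw [Real.dist_eq, abs_lt] at this
        linarith [this.2]
    refine ⟨t, ⟨ht.1, ht.2.trans (min_le_left _ _)⟩, ?_, hle⟩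
    by_contra hcon
    exact hno ⟨not_lt.1 hcon, hle t ⟨hx.1.trans ht.1.le, le_rfl⟩⟩

/-- A nondegenerate band of `T`. -/
def IsBand (T : ℝ → ℝ) (A e p r : ℝ) : Prop :=
  ∃ m0 M0, TBand T A e m0 M0 p r ∧ 0 < p ∧ 0 < r

lemma IsBand.mirror {T : ℝ → ℝ} {A e p r : ℝ} (B : IsBand T A e p r) : IsBand (refl T) e A r p := by
  obtain ⟨m0, M0, h, hp, hr⟩ := B
  refine ⟨M0, m0, ?_, hr, hp⟩
  unfold TBand
  rw [refl_refl]
  exact h.mirror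

/-- The data on which the construction runs: `q` has hulls compatible with those of `T`. -/
structure Compat (T q : ℝ → ℝ) : Prop where
  Z : BiZig T
  c : Continuous q
  z : q 0 = 0
  m : ∀ x ∈ Icc (-1 : ℝ) 1, q x ∈ Icc (-1 : ℝ) 1
  left : ∀ x ∈ Icc (0 : ℝ) 1, ∃ m ∈ Icc (0 : ℝ) 1,
    dp (refl (T ∘ q)) x = dp (refl T) m ∧ hi (refl (T ∘ q)) x = hi (refl T) m
  right : ∀ x ∈ Icc (0 : ℝ) 1, ∃ m ∈ Icc (0 : ℝ) 1, dp (T ∘ q) x = dp T m ∧ hi (T ∘ q) x = hi T m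

namespace Compat

variable {T q : ℝ → ℝ}

lemma of_lift (C : Compat T q) {s : ℝ → ℝ} (sc : Continuous s) (s0 : s 0 = 0)
    (sm : ∀ x ∈ Icc (-1 : ℝ) 1, s x ∈ Icc (-1 : ℝ) 1) (h : ∀ x ∈ Icc (-1 : ℝ) 1, T (s x) = T (q x)) :
    Compat T s where
  Z := C.Z
  c := sc
  z := s0
  m := sm
  left x hx := by
    have e : EqOn (refl (T ∘ s)) (refl (T ∘ q)) (Icc 0 x) := fun y hy =>
      h (-y) ⟨by linarith [hy.2, hx.2], by linarith [hy.1]⟩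
    rw [dp_congr hx.1 e, hi_congr hx.1 e]
    exact C.left x hx
  right x hx := by
    have e : EqOn (T ∘ s) (T ∘ q) (Icc 0 x) := fun y hy =>
      h y ⟨by linarith [hy.1], hy.2.trans hx.2⟩
    rw [dp_congr hx.1 e, hi_congr hx.1 e]
    exact C.right x hx

lemma mirror (C : Compat T q) : Compat (refl T) (mir q) := by
  have e : refl T ∘ mir q = refl (T ∘ q) := by
    funext x; simp [refl, mir]
  refine ⟨C.Z.mirror, mir_continuous C.c, by simp [mir, C.z], fun x hx => ?_, ?_, ?_⟩
  · have := C.m (-x) ⟨by linarith [hx.2], by linarith [hx.1]⟩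
    exact ⟨neg_le_neg this.2, by simp only [mir]; linarith [this.1]⟩
  · rw [e, refl_refl, refl_refl]; exact C.right
  · rw [e]; exact C.left

lemma pathL (C : Compat T q) : Path T (refl q) :=
  Path.of_chain C.Z.c (BiZig.refl_continuous C.c) (by simp [refl, C.z])
    (fun x hx => C.m (-x) ⟨by linarith [hx.2], by linarith [hx.1]⟩) (h := refl (T ∘ q))
    (fun _ _ => rfl) C.left

lemma pathR (C : Compat T q) : Path (refl T) (fun x => - q x) := by
  have := C.mirror.pathL
  have e : refl (mir q) = fun x => - q x := by funext x; simp [refl, mir]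
  rwa [e] at this

lemma exists_window (C : Compat T q) {A e p r : ℝ} (B : IsBand T A e p r) :
    ∃ xc yc, Window q (-A) e p r xc yc ∧ (yc < 1 → ∀ m ∈ Ioc yc 1, ∃ t ∈ Ioc yc m,
      r < q t ∧ ∀ s ∈ Icc 0 t, -p ≤ q s) := by
  obtain ⟨m0, M0, b, hp, hr⟩ := B
  obtain ⟨n0, N0, b', -, -⟩ := IsBand.mirror ⟨m0, M0, b, hp, hr⟩
  obtain ⟨x, hx, x1, x2, x3⟩ := C.pathL.exit C.Z b (by linarith)
  obtain ⟨y, hy, y1, y2, y3⟩ := C.pathR.exit C.Z.mirror b' (by linarith)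
  have hl : ∀ t ∈ Icc (-x) 0, q t ∈ Icc (-p) r := fun t ht => by
    have := x1 (-t) ⟨by linarith [ht.2], by linarith [ht.1]⟩
    rwa [refl, neg_neg] at this
  have hR : ∀ t ∈ Icc 0 y, q t ∈ Icc (-p) r := fun t ht => by
    have := y1 t ht
    exact ⟨by linarith [this.2], by linarith [this.1]⟩
  refine ⟨-x, y, ⟨C.c, C.z, ⟨by linarith [hx.2], by linarith [hx.1]⟩, hy, ?_, ?_, ?_, ?_, ?_, ?_, ?_⟩, ?_⟩
  · intro t ht
    rcases le_total t 0 with h | h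
    · exact hl t ⟨ht.1, h⟩
    · exact hR t ⟨h, ht.2⟩
  · intro z hz H
    have := x2 (-z) ⟨by linarith [hz.2], by linarith [hz.1]⟩ fun t ht =>
      H (-t) ⟨by linarith [ht.2], by linarith [ht.1]⟩
    linarith
  · intro z hz H
    exact y2 z hz fun t ht => by
      have := H t ht
      exact ⟨by linarith [this.2], by linarith [this.1]⟩
  · intro h
    exact (x3 (by linarith)).1
  · intro h
    have := (y3 h).1
    linarith
  · intro z hz h
    obtain ⟨w, hw, ew⟩ := C.pathL.hit_left C.Z b (x := -z) ⟨by linarith [hz.2], by linarith [hz.1, hx.2]⟩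
      (by rwa [refl, neg_neg])
    exact ⟨-w, ⟨by linarith [hw.2], by linarith [hw.1]⟩, ew⟩
  · intro z hz h
    obtain ⟨w, hw, ew⟩ := C.pathR.hit_left C.Z.mirror b' (x := z) ⟨hz.1, hz.2.trans hy.2⟩ (by linarith)
    exact ⟨w, hw, by linarith⟩
  · intro h m hm
    obtain ⟨t, ht, h1, h2⟩ := (y3 h).2 m hm
    exact ⟨t, ht, by linarith, fun s hs => by linarith [h2 s hs]⟩

/-- Just after `yc` the right path exceeds `r` while still at least `-p`. The left hull supplied by
`N.right` would then do the same, against `Path.le_of_ge`. -/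
lemma no_cross_right (C : Compat T q) {A e p r xc yc : ℝ} (B : IsBand T A e p r)
    (W : Window q (-A) e p r xc yc) {c d : ℝ} (N : NWin q c d) (hc : xc ≤ c) (hd : yc < d) : False := by
  obtain ⟨xc', yc', W', hex⟩ := C.exists_window B
  obtain ⟨m0, M0, b, hp, hr⟩ := B
  have hy : yc' = yc := le_antisymm
    (W.ymax yc' W'.ym fun t ht => W'.inD t ⟨W'.xm.2.trans ht.1, ht.2⟩)
    (W'.ymax yc W.ym fun t ht => W.inD t ⟨W.xm.2.trans ht.1, ht.2⟩)
  rw [hy] at hex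
  obtain ⟨t, ht, hrt, hge⟩ := hex (hd.trans_le N.d1) d ⟨hd, N.d1⟩
  have ht0 : 0 ≤ t := W.ym.1.trans ht.1.le
  obtain ⟨α, hα, x, hx, ex⟩ := N.right t ⟨ht0, ht.2⟩
  have hL : ∀ s ∈ Icc x 0, -p ≤ q s := by
    intro s hs
    have : q s ∈ q '' Icc α t := ex ▸ ⟨s, hs, rfl⟩
    obtain ⟨s', hs', e'⟩ := this
    rw [← e']
    rcases le_total s' 0 with h | h
    · exact (W.inD s' ⟨by linarith [hs'.1, hα.1], h.trans W.ym.1⟩).1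
    · exact hge s' ⟨h, hs'.2⟩
  have : q t ∈ q '' Icc x 0 := ex ▸ ⟨t, ⟨hα.2.trans ht0, le_rfl⟩, rfl⟩
  obtain ⟨s, hs, es⟩ := this
  have := C.pathL.le_of_ge C.Z b (x := -s) ⟨by linarith [hs.2], by linarith [hs.1, hx.1]⟩ fun w hw =>
    hL (-w) ⟨by linarith [hw.2, hs.1], by linarith [hw.1]⟩
  rw [refl, neg_neg] at this
  linarith

lemma no_cross_left (C : Compat T q) {A e p r xc yc : ℝ} (B : IsBand T A e p r)
    (W : Window q (-A) e p r xc yc) {c d : ℝ} (N : NWin q c d) (hc : c < xc) (hd : d ≤ yc) : False := by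
  have := W.mir
  rw [neg_neg] at this
  exact C.mirror.no_cross_right B.mirror this N.mir (by linarith) (by linarith)

end Compat

lemma NBand.vertex {T : ℝ → ℝ} {β : ℕ → ℝ} {n : ℕ} (Tc : Continuous T) (Z : Zig T β n) {A e m0 M0 p r : ℝ}
    (B : TBand T A e m0 M0 p r) : e ∈ β '' Iic n := by
  have h1 : M0 ≤ 1 := B.Mr.trans B.r1
  rcases B.turn with t | t | t
  · exact ⟨0, by simp, by rw [Z.zero, t.2.1]⟩
  · obtain ⟨k, hk, e⟩ := Z.vertex Tc B.e0 t.elt h1 t.ue fun y hy => by rw [t.ue]; exact t.enew y hy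
    exact ⟨k, hk, e.symm⟩
  · obtain ⟨k, hk, e⟩ := Z.neg.vertex (cneg Tc) B.e0 t.elt h1 t.ue
      fun y hy => by rw [hi_neg, hi_neg, t.ue]; exact t.enew y hy
    exact ⟨k, hk, e.symm⟩

/-- A mark of the outer band lying inside the inner one would, by `in_right` and `left_le_of_in`,
force the marks into the wrong order. Hence a patch for the outer band leaves windows of inner bands
untouched. -/
lemma NBand.nested {T : ℝ → ℝ} (Z : BiZig T) {A e m0 M0 p r A' e' m0' M0' p' r' : ℝ}
    (B : TBand T A e m0 M0 p r) (B' : TBand T A' e' m0' M0' p' r') (h : e' < e) : p' < A ∧ r' < e := by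
  have L := Z.chainL.toRunning
  have R := Z.chainR.toRunning
  have h1 : p' < A := by
    by_contra hcon
    have h2 := B'.mirror.in_right R L (y := A) ⟨B.A0, not_lt.1 hcon⟩
    have h3 := B.mirror.left_le_of_in R B'.e0 h2
    linarith
  refine ⟨h1, ?_⟩
  by_contra hcon
  have h2 := B'.in_right L R (y := e) ⟨B.e0, not_lt.1 hcon⟩
  have h3 := B.left_le_of_in L B'.A0 h2
  linarith [B'.Am, B'.mp]

/-- At a negative departure the left path has running maximum `s u` and depth less than `-s v`, the
right path depth `-s v` and running maximum less than `s u`. These are the strict inequalities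
required by `exists_nband`. -/
lemma Compat.exists_band {T s : ℝ → ℝ} (C : Compat T s) {u v : ℝ} (hu1 : -1 ≤ u) (hu0 : u < 0)
    (hv0 : 0 < v) (hv1 : v ≤ 1) (hn : NegDep s u v) :
    ∃ A e p r, IsBand T A e p r ∧ e < s u ∧ s u ≤ r ∧ -p ≤ s v ∧ s v < -A := by
  have L := C.Z.chainL.toRunning
  have R := C.Z.chainR.toRunning
  have PL := C.pathL
  have PR := C.pathR
  have h0 := hn 0 ⟨hu0, hv0⟩
  have hum : -u ∈ Icc (0 : ℝ) 1 := ⟨by linarith, by linarith⟩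
  have hvm : v ∈ Icc (0 : ℝ) 1 := ⟨hv0.le, hv1⟩
  have hsu := C.m u ⟨hu1, by linarith⟩
  have hsv := C.m v ⟨by linarith, hv1⟩
  have hMl : hi (refl s) (-u) = s u := by
    apply le_antisymm
    · refine hi_le PL.c hum.1 fun t ht => ?_
      rcases ht.2.eq_or_lt with h | h
      · rw [h, refl, neg_neg]
      · exact (hn (-t) ⟨by linarith, by linarith [ht.1]⟩).2.le
    · have := le_hi PL.c hum.1 le_rfl
      rwa [refl, neg_neg] at this
  have hmr : hi (fun x => - s x) v = - s v := by
    apply le_antisymm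
    · refine hi_le PR.c hv0.le fun t ht => ?_
      rcases ht.2.eq_or_lt with h | h
      · rw [h]
      · exact neg_le_neg (hn t ⟨by linarith [ht.1], h⟩).1.le
    · exact le_hi PR.c hv0.le le_rfl
  have hml : dp (refl s) (-u) < - s v := by
    obtain ⟨t, ht, et⟩ := exists_dp PL.c hum.1
    rcases ht.2.eq_or_lt with h | h
    · rw [h, refl, neg_neg] at et
      linarith [h0.1, h0.2]
    · have := (hn (-t) ⟨by linarith, by linarith [ht.1]⟩).1
      rw [refl] at et
      linarith
  have hMr : dp (fun x => - s x) v < s u := by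
    obtain ⟨t, ht, et⟩ := exists_dp PR.c hv0.le
    rcases ht.2.eq_or_lt with h | h
    · rw [h] at et
      linarith [h0.1, h0.2]
    · have := (hn t ⟨by linarith [ht.1], h⟩).2
      linarith
  have h1 := PL.chain (-u) hum
  have h2 := PR.chain v hvm
  rw [hMl] at h1
  rw [hmr, refl_refl] at h2
  obtain ⟨A, e, m0, M0, p, r, B, e1, e2, e3, e4⟩ := exists_nband L R (dp_nonneg PL.c PL.z (-u)) hml
    (by linarith [hsv.1]) (dp_nonneg PR.c PR.z v) hMr hsu.2 h1 h2
    (fun M' hM' => by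
      obtain ⟨y, hy, -, hin⟩ := PL.first hum (M := M') (by rwa [hMl])
      exact ⟨_, ⟨dp_nonneg PL.c PL.z y, dp_mono PL.c hy.2⟩, hin⟩)
    (fun m' hm' => by
      obtain ⟨y, hy, -, hin⟩ := PR.first hvm (M := m') (by rwa [hmr])
      rw [refl_refl] at hin
      exact ⟨_, ⟨dp_nonneg PR.c PR.z y, dp_mono PR.c hy.2⟩, hin⟩)
  exact ⟨A, e, p, r, ⟨m0, M0, B, by linarith [B.A0], by linarith [B.e0]⟩, e1, e2, by linarith, by linarith⟩

/-- A stage of the construction: the remaining negative departures have height at most `μ`. -/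
structure Stage (T q s : ℝ → ℝ) (μ : ℝ) : Prop where
  c : Continuous s
  z : s 0 = 0
  m : ∀ x ∈ Icc (-1 : ℝ) 1, s x ∈ Icc (-1 : ℝ) 1
  lift : ∀ x ∈ Icc (-1 : ℝ) 1, T (s x) = T (q x)
  pos : ∀ c d, NWin q c d → ¬ PosDep s c d
  neg : ∀ u v, -1 ≤ u → u < 0 → 0 < v → v ≤ 1 → NegDep s u v → s u ≤ μ
  agree : ∀ A e p r xc yc, IsBand T A e p r → e < μ → Window q (-A) e p r xc yc →
    ∀ t ∈ Icc xc yc, s t = q t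

/-- Insert the good map on the window of the band. A departure with just one end outside the window
is stopped by the value `r` or `-p` at the window boundary or by `no_cross_right` and
`no_cross_left`; one with both ends outside is inherited from `s`. -/
lemma Stage.patch {T q s g : ℝ → ℝ} {μ : ℝ} (C : Compat T q) (S : Stage T q s μ) {A e p r xc yc : ℝ}
    (B : IsBand T A e p r) (heμ : e < μ) (W : Window q (-A) e p r xc yc) (G : Good T q (-A) e p r xc yc g)
    (hmax : ∀ u v A' e' p' r', -1 ≤ u → u < 0 → 0 < v → v ≤ 1 → NegDep s u v → IsBand T A' e' p' r' →
      e' < s u → s u ≤ r' → -p' ≤ s v → s v < -A' → e' ≤ e) :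
    ∃ s', Stage T q s' e := by
  have L := C.Z.chainL.toRunning
  have R := C.Z.chainR.toRunning
  have hagree := S.agree A e p r xc yc B heμ W
  have B0 := B
  obtain ⟨m0, M0, b, hp, hr⟩ := B
  have hxm := W.xm
  have hym := W.ym
  have hxy : xc ≤ yc := hxm.2.trans hym.1
  obtain ⟨s', s'c, hin, hout⟩ : ∃ s' : ℝ → ℝ, Continuous s' ∧ (∀ t ∈ Icc xc yc, s' t = g t) ∧
      ∀ t ∈ Icc (-1 : ℝ) 1, (t < xc ∨ yc < t) → s' t = s t := by
    -- Projecting the time to the window makes the correction constant outside it; there the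
    -- constant is zero because `g` and `s` agree with `q` at the ends.
    refine ⟨fun t => s t + (g (max xc (min yc t)) - s (max xc (min yc t))), ?_, ?_, ?_⟩
    · have := S.c; have := G.c; fun_prop
    · intro t ht
      simp only [min_eq_right ht.2, max_eq_right ht.1]; ring
    · rintro t ht (h | h)
      · simp only [min_eq_right (h.le.trans hxy), max_eq_left h.le]
        rw [G.xe (by linarith [ht.1]), hagree xc ⟨le_rfl, hxy⟩]; ring
      · simp only [min_eq_left h.le, max_eq_right hxy]
        rw [G.ye (by linarith [ht.2]), hagree yc ⟨hxy, le_rfl⟩]; ring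
  have hcases : ∀ t ∈ Icc (-1 : ℝ) 1, t ∈ Icc xc yc ∨ (t < xc ∨ yc < t) := by
    intro t _
    by_cases h : t ∈ Icc xc yc
    · exact Or.inl h
    · rw [mem_Icc, not_and_or, not_le, not_le] at h
      exact Or.inr h
  have h0m : (0 : ℝ) ∈ Icc xc yc := ⟨hxm.2, hym.1⟩
  have s'0 : s' 0 = 0 := by rw [hin 0 h0m, G.z]
  have s'm : ∀ x ∈ Icc (-1 : ℝ) 1, s' x ∈ Icc (-1 : ℝ) 1 := by
    intro x hx
    rcases hcases x hx with h | h
    · rw [hin x h]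
      have := G.inD x h
      exact ⟨by linarith [this.1, b.p1], this.2.trans b.r1⟩
    · rw [hout x hx h]; exact S.m x hx
  have s'l : ∀ x ∈ Icc (-1 : ℝ) 1, T (s' x) = T (q x) := by
    intro x hx
    rcases hcases x hx with h | h
    · rw [hin x h]; exact G.lift x h
    · rw [hout x hx h]; exact S.lift x hx
  have hxe : -1 < xc → s' xc = -p := fun h => by rw [hin xc ⟨le_rfl, hxy⟩, G.xe h, W.xexit h]
  have hye : yc < 1 → s' yc = r := fun h => by rw [hin yc ⟨hxy, le_rfl⟩, G.ye h, W.yexit h]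
  have hsD : ∀ t ∈ Icc xc yc, s t ∈ Icc (-p) r := fun t ht => by
    rw [hagree t ht]; exact W.inD t ht
  refine ⟨s', s'c, s'0, s'm, s'l, ?_, ?_, ?_⟩
  · intro c d N P
    have hc0 := N.c0
    have hd0 := N.d0
    rcases le_or_gt xc c with hc | hc <;> rcases le_or_gt d yc with hd | hd
    · refine G.pos c d hc hd N fun t ht => ?_
      have := P t ht
      rwa [hin t ⟨hc.trans ht.1.le, ht.2.le.trans hd⟩, hin c ⟨hc, hc0.le.trans hym.1⟩,
        hin d ⟨hxm.2.trans hd0.le, hd⟩] at this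
    · exact C.no_cross_right B0 W N hc hd
    · exact C.no_cross_left B0 W N hc hd
    · refine S.pos c d N fun t ht => ?_
      have e1 := hout c ⟨N.c1, by linarith⟩ (Or.inl hc)
      have e2 := hout d ⟨by linarith, N.d1⟩ (Or.inr hd)
      have h1 := P xc ⟨hc, by linarith [hxm.2]⟩
      have h2 := P yc ⟨by linarith [hym.1], hd⟩
      rw [hxe (by linarith [N.c1]), e1] at h1
      rw [hye (by linarith [N.d1]), e2] at h2
      have htm : t ∈ Icc (-1 : ℝ) 1 := ⟨by linarith [N.c1, ht.1], by linarith [N.d1, ht.2]⟩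
      rcases hcases t htm with h | h
      · have := hsD t h
        exact ⟨by linarith [this.1, h1.1], by linarith [this.2, h2.2]⟩
      · have := P t ht
        rwa [hout t htm h, e1, e2] at this
  · intro u v hu1 hu0 hv0 hv1 hn
    by_contra hcon
    rw [not_le] at hcon
    have C' := C.of_lift s'c s'0 s'm s'l
    have hAe : -A ≤ e := by linarith [b.A0, b.e0]
    rcases le_or_gt xc u with hu | hu <;> rcases le_or_gt v yc with hv | hv
    · have eu := hin u ⟨hu, hu0.le.trans hym.1⟩
      have ev := hin v ⟨hxm.2.trans hv0.le, hv⟩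
      have hv' : s' v < -A := by
        obtain ⟨y, hy, ey⟩ := C'.pathL.hit_left C.Z b (x := -u) ⟨by linarith, by linarith⟩
          (by rw [refl, neg_neg]; exact hcon.le)
        rcases hy.2.eq_or_lt with h | h
        · rw [h, refl, neg_neg] at ey; linarith
        · have := (hn (-y) ⟨by linarith, by linarith [hy.1]⟩).1
          rw [refl] at ey; linarith
      refine G.neg u v hu hu0 hv0 hv (fun t ht => ?_) (eu ▸ hcon) (ev ▸ hv')
      have := hn t ht
      rwa [hin t ⟨hu.trans ht.1.le, ht.2.le.trans hv⟩, eu, ev] at this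
    · have h1 := (hn yc ⟨by linarith [hym.1], hv⟩).2
      rw [hye (by linarith), hin u ⟨hu, hu0.le.trans hym.1⟩] at h1
      have := G.inD u ⟨hu, hu0.le.trans hym.1⟩
      linarith [this.2]
    · have h1 := (hn xc ⟨hu, by linarith [hxm.2]⟩).1
      rw [hxe (by linarith), hin v ⟨hxm.2.trans hv0.le, hv⟩] at h1
      have := G.inD v ⟨hxm.2.trans hv0.le, hv⟩
      linarith [this.1]
    · have eu := hout u ⟨hu1, by linarith⟩ (Or.inl hu)
      have ev := hout v ⟨by linarith, hv1⟩ (Or.inr hv)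
      have h1 := (hn xc ⟨hu, by linarith [hxm.2]⟩).1
      have h2 := (hn yc ⟨by linarith [hym.1], hv⟩).2
      rw [hxe (by linarith), ev] at h1
      rw [hye (by linarith), eu] at h2
      have hns : NegDep s u v := by
        intro t ht
        have htm : t ∈ Icc (-1 : ℝ) 1 := ⟨by linarith [ht.1], by linarith [ht.2]⟩
        rcases hcases t htm with h | h
        · have := hsD t h
          exact ⟨by linarith [this.1], by linarith [this.2]⟩
        · have := hn t ht
          rwa [hout t htm h, eu, ev] at this
      -- The band of the inherited departure reaches below `-p` but has `e' ≤ e` by the choice of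
      -- `e`; this contradicts maximality of the given band.
      obtain ⟨A', e', p', r', B', g1, g2, g3, g4⟩ :=
        (C.of_lift S.c S.z S.m S.lift).exists_band hu1 hu0 hv0 hv1 hns
      have hle := hmax u v A' e' p' r' hu1 hu0 hv0 hv1 hns B' g1 g2 g3 g4
      obtain ⟨m0', M0', b', -, -⟩ := B'
      obtain ⟨m', hm', hno⟩ := b.mirror.exists_forall_not_in R L (M := p') ⟨by linarith, b'.p1⟩
      exact hno e' ⟨b'.e0, hle.trans (b.eM.trans b.Mr)⟩
        (b'.mirror.in_right R L ⟨hp.le.trans hm'.1.le, hm'.2⟩)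
  · intro A' e' p' r' xc' yc' B' he' W' t ht
    obtain ⟨m0', M0', b', hp', hr'⟩ := B'
    obtain ⟨h1, h2⟩ := b.nested C.Z b' he'
    have hAp : A ≤ p := b.Am.trans b.mp
    have her : e ≤ r := b.eM.trans b.Mr
    have hin' : ∀ w ∈ Icc xc' yc', q w ∈ Ioo (-A) e := fun w hw => by
      have := W'.inD w hw
      exact ⟨by linarith [this.1], by linarith [this.2]⟩
    have h3 : xc ≤ xc' := W.xmax xc' W'.xm fun w hw => by
      have := hin' w ⟨hw.1, hw.2.trans W'.ym.1⟩
      exact ⟨by linarith [this.1], by linarith [this.2]⟩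
    have h4 : yc' ≤ yc := W.ymax yc' W'.ym fun w hw => by
      have := hin' w ⟨W'.xm.2.trans hw.1, hw.2⟩
      exact ⟨by linarith [this.1], by linarith [this.2]⟩
    have htm : t ∈ Icc xc yc := ⟨h3.trans ht.1, ht.2.trans h4⟩
    rw [hin t htm]
    refine G.inner t htm fun w hw => hin' w ?_
    exact uIcc_subset_Icc (⟨W'.xm.2, W'.ym.1⟩ : (0 : ℝ) ∈ Icc xc' yc') ht hw

/-- A compatible map can be modified, keeping the composition with `T`, so that no negative
departures and no new positive departures remain. -/
theorem Compat.exists_no_negDep {T q : ℝ → ℝ} (C : Compat T q) :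
    ∃ s : ℝ → ℝ, Continuous s ∧ s 0 = 0 ∧ (∀ x ∈ Icc (-1 : ℝ) 1, s x ∈ Icc (-1 : ℝ) 1) ∧
      (∀ x ∈ Icc (-1 : ℝ) 1, T (s x) = T (q x)) ∧ (∀ c d, NWin q c d → ¬ PosDep s c d) ∧
      ∀ u v, -1 ≤ u → u < 0 → 0 < v → v ≤ 1 → ¬ NegDep s u v := by
  obtain ⟨β, n, Zr⟩ := C.Z.right
  set V : Set ℝ := β '' Iic n with hV
  have hVf : V.Finite := (finite_Iic n).image β
  -- The marks `e` of bands are break points, so the number of break points below `μ` drops with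
  -- every patch.
  have main : ∀ k : ℕ, ∀ s μ, Stage T q s μ → (V ∩ Iio μ).ncard ≤ k →
      ∃ s μ, Stage T q s μ ∧ ∀ u v, -1 ≤ u → u < 0 → 0 < v → v ≤ 1 → ¬ NegDep s u v := by
    intro k
    induction k with
    | zero =>
      intro s μ S hk
      refine ⟨s, μ, S, fun u v hu1 hu0 hv0 hv1 hn => ?_⟩
      obtain ⟨A, e, p, r, ⟨m0, M0, b, hp, hr⟩, h1, h2, -, -⟩ :=
        (C.of_lift S.c S.z S.m S.lift).exists_band hu1 hu0 hv0 hv1 hn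
      have h3 := S.neg u v hu1 hu0 hv0 hv1 hn
      have h4 : (V ∩ Iio μ) = ∅ := (ncard_eq_zero (hVf.inter_of_left _)).1 (by omega)
      have h5 : e ∈ V ∩ Iio μ := ⟨b.vertex C.Z.c Zr, h1.trans_le h3⟩
      rw [h4] at h5; exact h5
    | succ k ih =>
      intro s μ S hk
      by_cases hex : ∃ u v, -1 ≤ u ∧ u < 0 ∧ 0 < v ∧ v ≤ 1 ∧ NegDep s u v
      swap
      · exact ⟨s, μ, S, fun u v hu1 hu0 hv0 hv1 hn => hex ⟨u, v, hu1, hu0, hv0, hv1, hn⟩⟩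
      set E : Set ℝ := {e | ∃ u v A p r, (-1 ≤ u ∧ u < 0 ∧ 0 < v ∧ v ≤ 1 ∧ NegDep s u v) ∧
        IsBand T A e p r ∧ e < s u ∧ s u ≤ r ∧ -p ≤ s v ∧ s v < -A} with hE
      have hEV : E ⊆ V ∩ Iio μ := by
        rintro e ⟨u, v, A, p, r, ⟨hu1, hu0, hv0, hv1, hn⟩, ⟨m0, M0, b, -, -⟩, h1, -⟩
        exact ⟨b.vertex C.Z.c Zr, h1.trans_le (S.neg u v hu1 hu0 hv0 hv1 hn)⟩
      have hEf : E.Finite := (hVf.inter_of_left _).subset hEV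
      have hEne : E.Nonempty := by
        obtain ⟨u, v, hu1, hu0, hv0, hv1, hn⟩ := hex
        obtain ⟨A, e, p, r, B, h⟩ := (C.of_lift S.c S.z S.m S.lift).exists_band hu1 hu0 hv0 hv1 hn
        exact ⟨e, u, v, A, p, r, ⟨hu1, hu0, hv0, hv1, hn⟩, B, h⟩
      obtain ⟨e, heE, hemax⟩ := exists_max_image E id hEf hEne
      obtain ⟨heV, heμ⟩ := hEV heE
      obtain ⟨u, v, A, p, r, -, B, -⟩ := heE
      obtain ⟨xc, yc, W, -⟩ := C.exists_window B
      obtain ⟨m0, M0, b, hp, hr⟩ := id B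
      obtain ⟨φm, φp, F⟩ := exists_fold C.Z b
      obtain ⟨g, G⟩ := exists_good F W
      obtain ⟨s', S'⟩ := S.patch C B heμ W G fun u v A' e' p' r' hu1 hu0 hv0 hv1 hn B' h1 h2 h3 h4 =>
        hemax e' ⟨u, v, A', p', r', ⟨hu1, hu0, hv0, hv1, hn⟩, B', h1, h2, h3, h4⟩
      refine ih s' e S' ?_
      have : (V ∩ Iio e).ncard < (V ∩ Iio μ).ncard := by
        apply ncard_lt_ncard _ (hVf.inter_of_left _)
        refine ⟨fun x hx => ⟨hx.1, mem_Iio.2 ((mem_Iio.1 hx.2).trans heμ)⟩, fun hcon => ?_⟩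
        exact lt_irrefl e (hcon ⟨heV, heμ⟩).2
      omega
  have S0 : Stage T q q 1 := ⟨C.c, C.z, C.m, fun _ _ => rfl, fun c d N P => N.not_posDep P,
    fun u v hu1 hu0 _ _ _ => (C.m u ⟨hu1, by linarith⟩).2, fun _ _ _ _ _ _ _ _ _ _ _ => rfl⟩
  obtain ⟨s, μ, S, h⟩ := main _ q 1 S0 le_rfl
  exact ⟨s, S.c, S.z, S.m, S.lift, S.pos, h⟩

/-! ### Radial contour factors -/

/-- Retraction of the line onto `[-1, 1]`. -/
noncomputable def clamp (x : ℝ) : ℝ := max (-1) (min 1 x)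

lemma clamp_continuous : Continuous clamp := by unfold clamp; fun_prop

lemma clamp_mem (x : ℝ) : clamp x ∈ Icc (-1 : ℝ) 1 :=
  ⟨le_max_left _ _, max_le (by norm_num) (min_le_left _ _)⟩

lemma clamp_eq {x : ℝ} (hx : x ∈ Icc (-1 : ℝ) 1) : clamp x = x := by
  rw [clamp, min_eq_right hx.2, max_eq_right hx.1]

/-- `f` is affine to the right of every point of `[-1, 1)`. -/
def RightGerms (f : ℝ → ℝ) : Prop :=
  ∀ c ∈ Ico (-1 : ℝ) 1, ∃ w, c < w ∧ w ≤ 1 ∧ ∃ a b : ℝ, ∀ x ∈ Icc c w, f x = a * x + b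

lemma RightGerms.rightAffine {f : ℝ → ℝ} (h : RightGerms f) : RightAffine f :=
  fun c hc => h c ⟨by linarith [hc.1], hc.2⟩

lemma RightGerms.congr {f g : ℝ → ℝ} (h : RightGerms f) (e : EqOn f g (Icc (-1) 1)) : RightGerms g := by
  intro c hc
  obtain ⟨w, h1, h2, a, b, h3⟩ := h c hc
  exact ⟨w, h1, h2, a, b, fun x hx => by rw [← e ⟨hc.1.trans hx.1, hx.2.trans h2⟩, h3 x hx]⟩

/-- Where the inner slope is negative the outer map is entered from the other side, hence the
condition on the reflection. -/
lemma RightGerms.comp {f g : ℝ → ℝ} (hf : RightGerms f) (hf' : RightGerms (refl f)) (hg : RightGerms g)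
    (hm : MapsTo g (Icc (-1) 1) (Icc (-1) 1)) : RightGerms (f ∘ g) := by
  intro c hc
  obtain ⟨w, h1, h2, a, b, h3⟩ := hg c hc
  have gc := h3 c ⟨le_rfl, h1.le⟩
  have gw := h3 w ⟨h1.le, le_rfl⟩
  have mc := hm (show c ∈ Icc (-1 : ℝ) 1 from ⟨hc.1, hc.2.le⟩)
  have mw := hm (show w ∈ Icc (-1 : ℝ) 1 from ⟨by linarith [hc.1], h2⟩)
  rcases lt_trichotomy a 0 with ha | ha | ha
  · obtain ⟨v, k1, k2, a', b', k3⟩ := hf' (- g c) ⟨by linarith [mc.2], by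
      have : g w < g c := by rw [gc, gw]; nlinarith
      linarith [mw.1]⟩
    refine ⟨min w ((-v - b) / a), lt_min h1 ?_, (min_le_left _ _).trans h2, -a' * a, -a' * b + b', fun x hx => ?_⟩
    · rw [lt_div_iff_of_neg ha]; linarith
    · have hx1 := hx.2.trans (min_le_left _ _)
      have hx2 := hx.2.trans (min_le_right _ _)
      rw [le_div_iff_of_neg ha] at hx2
      have e := h3 x ⟨hx.1, hx1⟩
      have := k3 (- g x) ⟨by rw [e, gc]; nlinarith [hx.1], by rw [e]; linarith⟩
      rw [refl, neg_neg] at this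
      rw [Function.comp_apply, this, e]; ring
  · refine ⟨w, h1, h2, 0, f b, fun x hx => ?_⟩
    rw [Function.comp_apply, h3 x hx, ha]; simp
  · obtain ⟨v, k1, k2, a', b', k3⟩ := hf (g c) ⟨mc.1, by
      have : g c < g w := by rw [gc, gw]; nlinarith
      linarith [mw.2]⟩
    refine ⟨min w ((v - b) / a), lt_min h1 ?_, (min_le_left _ _).trans h2, a' * a, a' * b + b', fun x hx => ?_⟩
    · rw [lt_div_iff₀ ha]; linarith
    · have hx1 := hx.2.trans (min_le_left _ _)
      have hx2 := hx.2.trans (min_le_right _ _)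
      rw [le_div_iff₀ ha] at hx2
      have e := h3 x ⟨hx.1, hx1⟩
      rw [Function.comp_apply, k3 (g x) ⟨by rw [e, gc]; nlinarith [hx.1], by rw [e]; linarith⟩, e]; ring

lemma PiecewiseLinear.refl {f : ℝ → ℝ} (h : PiecewiseLinear f) : PiecewiseLinear (refl f) := by
  obtain ⟨n, c, h0, hn, hlt, haff⟩ := h
  refine ⟨n, fun i => - c (n - i), by simp [hn], by simp [h0], fun i hi => ?_, fun i hi => ?_⟩
  · have := hlt (n - (i + 1)) (by omega)
    rw [show n - (i + 1) + 1 = n - i by omega] at this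
    exact neg_lt_neg this
  · obtain ⟨a, b, hab⟩ := haff (n - (i + 1)) (by omega)
    rw [show n - (i + 1) + 1 = n - i by omega] at hab
    refine ⟨-a, b, fun x hx => ?_⟩
    rw [RadialContour.refl, hab (-x) ⟨by linarith [hx.2], by linarith [hx.1]⟩]; ring

lemma PiecewiseLinear.exists_piece {n : ℕ} {c : ℕ → ℝ} (h0 : c 0 = -1) (hn : c n = 1)
    (hlt : ∀ i < n, c i < c (i + 1)) {x : ℝ} (hx : x ∈ Ico (-1 : ℝ) 1) :
    ∃ i < n, c i ≤ x ∧ x < c (i + 1) ∧ c (i + 1) ≤ 1 := by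
  have hP : ∃ j, j ≤ n ∧ x < c j := ⟨n, le_rfl, by rw [hn]; exact hx.2⟩
  classical
  have hm := Nat.find_spec hP
  have hm0 : Nat.find hP ≠ 0 := by
    intro h
    rw [h, h0] at hm
    linarith [hm.2, hx.1]
  obtain ⟨k, hk⟩ := Nat.exists_eq_succ_of_ne_zero hm0
  rw [hk] at hm
  have hmono : ∀ m, ∀ j ≤ n, m ≤ j → c m ≤ c j := by
    intro m j
    induction j with
    | zero => intro _ h; rw [Nat.le_zero.1 h]
    | succ j ih =>
      intro hj hmj
      rcases hmj.eq_or_lt with rfl | h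
      · exact le_rfl
      · exact (ih (by omega) (by omega)).trans (hlt j hj).le
  refine ⟨k, hm.1, ?_, hm.2, hn ▸ hmono _ n le_rfl hm.1⟩
  by_contra hcon
  exact Nat.find_min hP (m := k) (by omega) ⟨by have := hm.1; omega, not_le.1 hcon⟩

lemma PiecewiseLinear.rightGerms {f : ℝ → ℝ} (h : PiecewiseLinear f) : RightGerms f := by
  obtain ⟨n, c, h0, hn, hlt, haff⟩ := h
  intro x hx
  obtain ⟨i, hi, h1, h2, h3⟩ := exists_piece h0 hn hlt hx
  obtain ⟨a, b, hab⟩ := haff i hi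
  exact ⟨c (i + 1), h2, h3, a, b, fun y hy => hab y ⟨h1.trans hy.1, hy.2⟩⟩

lemma PiecewiseLinear.continuousOn {f : ℝ → ℝ} (h : PiecewiseLinear f) : ContinuousOn f (Icc (-1) 1) := by
  obtain ⟨n, c, h0, hn, hlt, haff⟩ := h
  have hn0 : 0 < n := by
    rcases Nat.eq_zero_or_pos n with rfl | h
    · rw [h0] at hn; norm_num at hn
    · exact h
  have hcover : Icc (-1 : ℝ) 1 ⊆ ⋃ i : Fin n, Icc (c i) (c (i + 1)) := by
    intro x hx
    rcases hx.2.eq_or_lt with rfl | hlt1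
    · refine mem_iUnion.2 ⟨⟨n - 1, by omega⟩, ?_⟩
      have := hlt (n - 1) (by omega)
      rw [Nat.sub_add_cancel hn0, hn] at this
      simp only [Nat.sub_add_cancel hn0, hn]
      exact ⟨this.le, le_rfl⟩
    · obtain ⟨i, hi, h1, h2, -⟩ := exists_piece h0 hn hlt ⟨hx.1, hlt1⟩
      exact mem_iUnion.2 ⟨⟨i, hi⟩, h1, h2.le⟩
  refine ContinuousOn.mono ?_ hcover
  apply (locallyFinite_of_finite _).continuousOn_iUnion (fun k => isClosed_Icc)
  intro k
  obtain ⟨a, b, hab⟩ := haff k k.2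
  exact (show ContinuousOn (fun x => a * x + b) _ by fun_prop).congr hab

lemma Zig.congr {t s : ℝ → ℝ} {β : ℕ → ℝ} {n : ℕ} (Z : Zig t β n) (h : EqOn t s (Icc 0 1)) :
    Zig s β n := by
  have hm : ∀ k ≤ n, β k ∈ Icc (0 : ℝ) 1 := fun k hk => ⟨Z.nonneg hk, Z.le_one' hk⟩
  have hx : ∀ k < n, ∀ x ∈ Icc 0 (β (k + 1)), x ∈ Icc (0 : ℝ) 1 := fun k hk x hx =>
    ⟨hx.1, hx.2.trans (hm _ hk).2⟩
  refine ⟨⟨Z.one_le, Z.zero, Z.lt, Z.le_one, fun k hk x h1 => ?_, fun k hk x h1 => ?_, fun x h1 => ?_⟩,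
    Z.last, fun k hk x h1 => ?_⟩
  · rw [← h (hx k hk x h1), ← h (hm k hk.le), ← h (hm _ hk)]; exact Z.bd k hk x h1
  · rw [← h (hx k hk x ⟨h1.1, h1.2.le⟩), ← h (hm _ hk)]; exact Z.new k hk x h1
  · obtain ⟨x', h2, h3⟩ := Z.top x h1
    exact ⟨x', h2, by rw [← h h1, ← h ⟨h2.1, h2.2.trans (hm n le_rfl).2⟩, h3]⟩
  · have h2 : x ∈ Icc (0 : ℝ) 1 := ⟨(hm k hk.le).1.trans h1.1, h1.2.trans (hm _ hk).2⟩
    rw [← h h2, ← h (hm k hk.le), ← h (hm _ hk)]; exact Z.affine k hk x h1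

/-- The hulls of `h` are hulls of `t`. -/
def HullsIn (h t : ℝ → ℝ) : Prop :=
  ∀ y ∈ Icc (0 : ℝ) 1, ∃ y' ∈ Icc (0 : ℝ) 1, dp h y = dp t y' ∧ hi h y = hi t y'

lemma HullsIn.image {h t : ℝ → ℝ} (H : HullsIn h t) (hc : Continuous h) (tc : Continuous t) {y : ℝ}
    (hy : y ∈ Icc (0 : ℝ) 1) : ∃ y' ∈ Icc (0 : ℝ) 1, h '' Icc 0 y = t '' Icc 0 y' := by
  obtain ⟨y', hy', h1, h2⟩ := H y hy
  exact ⟨y', hy', by rw [image_Icc_eq hc hy.1, image_Icc_eq tc hy'.1, h1, h2]⟩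

/-- `T` is a zigzag on both sides, with the same hulls as `h`. -/
structure Factor (h T : ℝ → ℝ) : Prop where
  hc : Continuous h
  Z : BiZig T
  r1 : HullsIn h T
  r2 : HullsIn T h
  l1 : HullsIn (refl h) (refl T)
  l2 : HullsIn (refl T) (refl h)

lemma contourFactor_zero {h : ℝ → ℝ} (h0 : h 0 = 0) : contourFactor h 0 = 0 := by
  simp [contourFactor, contourPoint, h0]

/-- The radial contour factor, extended continuously. -/
noncomputable def ext (h : ℝ → ℝ) : ℝ → ℝ := fun x => radialContourFactor h (clamp x)

lemma ext_right {h : ℝ → ℝ} : EqOn (contourFactor h) (ext h) (Icc 0 1) := by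
  intro x hx
  rw [ext, clamp_eq ⟨by linarith [hx.1], hx.2⟩, radialContourFactor, if_pos hx.1]

lemma ext_left {h : ℝ → ℝ} (h0 : h 0 = 0) : EqOn (contourFactor (refl h)) (refl (ext h)) (Icc 0 1) := by
  intro x hx
  rw [refl, ext, clamp_eq ⟨by linarith [hx.2], by linarith [hx.1]⟩, radialContourFactor]
  split_ifs with hneg
  · have : x = 0 := by linarith [hx.1]
    rw [this, neg_zero, contourFactor_zero h0, contourFactor_zero (by simp [refl, h0])]
  · rw [neg_neg]; rfl

lemma hulls_of_zdata {h t : ℝ → ℝ} (hc : Continuous h) (tc : Continuous t)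
    (Z : ZData h (contourPoint h) (numContourPoints h)) (e : EqOn (contourFactor h) t (Icc 0 1)) :
    HullsIn h t ∧ HullsIn t h := by
  have Y := (zig_contourFactor Z).congr e
  have hv : ∀ k ≤ numContourPoints h, h (contourPoint h k) = t (k / numContourPoints h) := by
    intro k hk
    rw [← e ⟨Y.nonneg hk, Y.le_one' hk⟩, contourFactor_node Z.one_le]
  exact ⟨fun y hy => Z.chain hc Y.toZData tc hv hy,
    fun y hy => Y.toZData.chain tc Z hc (fun k hk => (hv k hk).symm) hy⟩

/-- On each side `h` and its contour factor have the same successive extreme values, hence the same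
hulls. -/
lemma factor_ext {h : ℝ → ℝ} (hc : Continuous h) (h0 : h 0 = 0) (hr : RightGerms h)
    (hl : RightGerms (refl h)) (hR : ∃ x ∈ Icc (0 : ℝ) 1, h x ≠ 0)
    (hL : ∃ x ∈ Icc (0 : ℝ) 1, refl h x ≠ 0) : Factor h (ext h) := by
  have lc := BiZig.refl_continuous hc
  have l0 : refl h 0 = 0 := by simp [refl, h0]
  have ZR := zdata_contour hc h0 hR hr.rightAffine
  have ZL := zdata_contour lc l0 hL hl.rightAffine
  have c1 : ContinuousOn (radialContourFactor h) (Icc (-1) 1) := by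
    rw [← Icc_union_Icc_eq_Icc (show (-1 : ℝ) ≤ 0 by norm_num) zero_le_one]
    apply ContinuousOn.union_of_isClosed _ _ isClosed_Icc isClosed_Icc
    · have : ContinuousOn (fun x => contourFactor (refl h) (-x)) (Icc (-1) 0) :=
        (contourFactor_continuousOn ZL.one_le).comp continuous_neg.continuousOn
          fun x hx => ⟨by linarith [hx.2], by linarith [hx.1]⟩
      refine this.congr fun x hx => ?_
      have h1 := ext_left h0 (show -x ∈ Icc (0 : ℝ) 1 from ⟨by linarith [hx.2], by linarith [hx.1]⟩)
      rw [refl, neg_neg, ext, clamp_eq ⟨hx.1, by linarith [hx.2]⟩] at h1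
      exact h1.symm
    · exact (contourFactor_continuousOn ZR.one_le).congr fun x hx => by
        rw [radialContourFactor, if_pos hx.1]
  have Tc : Continuous (ext h) := c1.comp_continuous clamp_continuous clamp_mem
  obtain ⟨r1, r2⟩ := hulls_of_zdata hc Tc ZR ext_right
  obtain ⟨l1, l2⟩ := hulls_of_zdata lc (BiZig.refl_continuous Tc) ZL (ext_left h0)
  refine ⟨hc, ⟨Tc, ?_, ⟨_, _, (zig_contourFactor ZR).congr ext_right⟩,
    ⟨_, _, (zig_contourFactor ZL).congr (ext_left h0)⟩⟩, r1, r2, l1, l2⟩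
  rw [← ext_right (by simp), contourFactor_zero h0]

lemma contourFactor_eq_zero {h : ℝ → ℝ} (H : ∀ x ∈ Icc (0 : ℝ) 1, h x = 0) (x : ℝ) :
    contourFactor h x = 0 := by
  simp only [contourFactor]
  rw [H _ (contourPoint_mem h _), H _ (contourPoint_mem h _)]
  simp

lemma Factor.ne_zero {h T : ℝ → ℝ} (F : Factor h T) (hR : ∃ x ∈ Icc (0 : ℝ) 1, h x ≠ 0) :
    ∃ x ∈ Icc (0 : ℝ) 1, T x ≠ 0 := by
  obtain ⟨x, hx, hne⟩ := hR
  obtain ⟨y, hy, e⟩ := F.r1.image F.hc F.Z.c hx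
  have : h x ∈ T '' Icc 0 y := e ▸ ⟨x, ⟨hx.1, le_rfl⟩, rfl⟩
  obtain ⟨z, hz, ez⟩ := this
  exact ⟨z, ⟨hz.1, hz.2.trans hy.2⟩, by rw [ez]; exact hne⟩

lemma Factor.mirror {h T : ℝ → ℝ} (F : Factor h T) : Factor (refl h) (refl T) :=
  ⟨BiZig.refl_continuous F.hc, F.Z.mirror, F.l1, F.l2, by rw [refl_refl, refl_refl]; exact F.r1,
    by rw [refl_refl, refl_refl]; exact F.r2⟩

lemma Factor.lift_right {h T : ℝ → ℝ} (F : Factor h T) (h0 : h 0 = 0) :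
    ∃ θ : ℝ → ℝ, ContinuousOn θ (Icc 0 1) ∧ MapsTo θ (Icc 0 1) (Icc 0 1) ∧ θ 0 = 0 ∧
      ∀ x ∈ Icc (0 : ℝ) 1, T (θ x) = h x := by
  obtain ⟨β, n, Z⟩ := F.Z.right
  exact Z.lift F.Z.c n le_rfl 1 zero_le_one Z.last.ge
    (fun x hx => by rw [← Z.last]; exact Z.new' le_rfl hx.1 (by rw [Z.last]; exact hx.2)) 1 zero_le_one h F.hc h0
    fun s hs => F.r1.image F.hc F.Z.c hs

lemma Factor.lift {h T : ℝ → ℝ} (F : Factor h T) (h0 : h 0 = 0) :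
    ∃ s : ℝ → ℝ, Continuous s ∧ s 0 = 0 ∧ (∀ x, s x ∈ Icc (-1 : ℝ) 1) ∧
      ∀ x ∈ Icc (-1 : ℝ) 1, T (s x) = h x := by
  obtain ⟨θ, θc, θm, θ0, hθ⟩ := F.lift_right h0
  obtain ⟨η, ηc, ηm, η0, hη⟩ := F.mirror.lift_right (by simp [refl, h0])
  have pm : ∀ x : ℝ, max 0 (min 1 x) ∈ Icc (0 : ℝ) 1 := fun x =>
    ⟨le_max_left _ _, max_le zero_le_one (min_le_left _ _)⟩
  -- At every point one of the two one-sided lifts is evaluated at `0`, where it vanishes.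
  refine ⟨fun x => θ (max 0 (min 1 x)) - η (max 0 (min 1 (-x))), ?_, ?_, fun x => ?_, fun x hx => ?_⟩
  · exact (θc.comp_continuous (by fun_prop) pm).sub (ηc.comp_continuous (by fun_prop) fun x => pm (-x))
  · simp [θ0, η0]
  · have h1 := θm (pm x)
    have h2 := ηm (pm (-x))
    exact ⟨by linarith [h1.1, h2.2], by linarith [h1.2, h2.1]⟩
  · simp only
    rcases le_total 0 x with h | h
    · rw [min_eq_right hx.2, max_eq_right h, min_eq_right (by linarith : -x ≤ 1), max_eq_left (by linarith), η0,
        sub_zero]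
      exact hθ x ⟨h, hx.2⟩
    · rw [min_eq_right hx.2, max_eq_left h, min_eq_right (by linarith [hx.1] : -x ≤ 1),
        max_eq_right (by linarith), θ0, zero_sub]
      have := hη (-x) ⟨by linarith, by linarith [hx.1]⟩
      rwa [refl, refl, neg_neg] at this

/-- If `q` factors through `F₂`, the hulls of `F₃` are those of `t`, and `F₂`, `F₂ ∘ F₃` have the
same hulls, then the hulls of `q ∘ t` are hulls of `q`. -/
lemma hull_transfer {s F₂ F₃ T₂ t : ℝ → ℝ} (A : Factor F₂ T₂) (B : Factor (F₂ ∘ F₃) T₂) (D : Factor F₃ t)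
    {z : ℝ} (hz : z ∈ Icc (0 : ℝ) 1) :
    ∃ y ∈ Icc (0 : ℝ) 1, (s ∘ F₂) '' (t '' Icc 0 z) = (s ∘ F₂) '' Icc 0 y := by
  obtain ⟨y₁, hy₁, e₁⟩ := D.r2.image D.Z.c D.hc hz
  obtain ⟨y₂, hy₂, e₂⟩ := B.r1.image B.hc B.Z.c hy₁
  obtain ⟨y₃, hy₃, e₃⟩ := A.r2.image A.Z.c A.hc hy₂
  refine ⟨y₃, hy₃, ?_⟩
  rw [image_comp] at e₂
  rw [e₁, image_comp, e₂, e₃, image_comp]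

lemma hull_transfer_left {s F₂ F₃ T₂ t : ℝ → ℝ} (A : Factor F₂ T₂) (B : Factor (F₂ ∘ F₃) T₂) (D : Factor F₃ t)
    {z : ℝ} (hz : z ∈ Icc (0 : ℝ) 1) :
    ∃ x ∈ Icc (-1 : ℝ) 0, (s ∘ F₂) '' (refl t '' Icc 0 z) = (s ∘ F₂) '' Icc x 0 := by
  obtain ⟨y₁, hy₁, e₁⟩ := D.l2.image D.mirror.Z.c D.mirror.hc hz
  obtain ⟨y₂, hy₂, e₂⟩ := B.l1.image B.mirror.hc B.mirror.Z.c hy₁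
  obtain ⟨y₃, hy₃, e₃⟩ := A.l2.image A.mirror.Z.c A.mirror.hc hy₂
  refine ⟨-y₃, ⟨by linarith [hy₃.2], by linarith [hy₃.1]⟩, ?_⟩
  have e₄ : F₂ '' (refl F₃ '' Icc 0 y₁) = refl T₂ '' Icc 0 y₂ := by
    rw [← e₂, ← image_comp]; rfl
  have e₅ : refl F₂ '' Icc 0 y₃ = F₂ '' Icc (-y₃) 0 := by
    have : refl F₂ = F₂ ∘ fun x => -x := rfl
    rw [this, image_comp]
    congr 1
    ext v
    constructor
    · rintro ⟨w, hw, rfl⟩; exact ⟨by linarith [hw.2], by linarith [hw.1]⟩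
    · intro hv; exact ⟨-v, ⟨by linarith [hv.2], by linarith [hv.1]⟩, by simp⟩
  rw [e₁, image_comp, e₄, e₃, e₅, image_comp]

/-- Choose a time on the right at which `t` has depth exactly `-x`; its hull is `[x, β]` with `β`
below `t x₁`. Hull transfer turns the image of this interval into a right hull of `s ∘ F₂`; the left
side is symmetric. -/
lemma nwin_of_swap {s F₂ F₃ T₂ t : ℝ → ℝ} (A : Factor F₂ T₂) (B : Factor (F₂ ∘ F₃) T₂) (D : Factor F₃ t)
    (tm : ∀ x ∈ Icc (-1 : ℝ) 1, t x ∈ Icc (-1 : ℝ) 1) {x₁ x₂ : ℝ} (h1 : -1 ≤ x₁) (h10 : x₁ < 0)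
    (h20 : 0 < x₂) (h2 : x₂ ≤ 1) (hc : t x₂ < 0) (hd : 0 < t x₁)
    (hin : ∀ z ∈ Ioo x₁ x₂, t z ∈ Ioo (t x₂) (t x₁)) : NWin (s ∘ F₂) (t x₂) (t x₁) := by
  have tc := D.Z.c
  have t0 := D.Z.z
  have lc := D.Z.mirror.c
  have l0 := D.Z.mirror.z
  refine ⟨(tm x₂ ⟨by linarith, h2⟩).1, hc, hd, (tm x₁ ⟨h1, by linarith⟩).2, fun x hx => ?_, fun y hy => ?_⟩
  · obtain ⟨z, hz, ez⟩ := intermediate_value_Icc h20.le (dp_continuous tc).continuousOn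
      (show -x ∈ Icc (dp t 0) (dp t x₂) from ⟨by rw [dp_of_nonpos le_rfl, t0]; linarith [hx.2], by
        linarith [hx.1, neg_dp_le tc h20.le (le_refl x₂)]⟩)
    obtain ⟨y, hy, e⟩ := hull_transfer (s := s) A B D (z := z) ⟨hz.1, hz.2.trans h2⟩
    refine ⟨hi t z, ⟨hi_nonneg tc t0 z, ?_⟩, y, hy, ?_⟩
    · obtain ⟨w, hw, ew⟩ := exists_hi tc hz.1
      rw [← ew]
      rcases (hw.2.trans hz.2).eq_or_lt with h | h
      · rw [h]; linarith
      · exact (hin w ⟨by linarith [hw.1], h⟩).2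
    · rw [← e, image_Icc_eq tc hz.1, ez, neg_neg]
  · obtain ⟨z, hz, ez⟩ := intermediate_value_Icc (show (0 : ℝ) ≤ -x₁ by linarith) (hi_continuous lc).continuousOn
      (show y ∈ Icc (hi (refl t) 0) (hi (refl t) (-x₁)) from ⟨by
        rw [hi_of_nonpos le_rfl, l0]; exact hy.1, by
        have := le_hi lc (show (0 : ℝ) ≤ -x₁ by linarith) le_rfl
        rw [refl, neg_neg] at this
        exact hy.2.trans this⟩)
    obtain ⟨x, hx, e⟩ := hull_transfer_left (s := s) A B D (z := z) ⟨hz.1, by linarith [hz.2]⟩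
    refine ⟨- dp (refl t) z, ⟨?_, by linarith [dp_nonneg lc l0 z]⟩, x, hx, ?_⟩
    · obtain ⟨w, hw, ew⟩ := exists_dp lc hz.1
      rw [← ew, refl]
      rcases (hw.2.trans hz.2).eq_or_lt with h | h
      · rw [h, neg_neg]; linarith
      · exact (hin (-w) ⟨by linarith, by linarith [hw.1]⟩).1
    · rw [← e, image_Icc_eq lc hz.1, ez]

/-- The image of an open interval around `0` by a continuous function avoiding its end values. -/
lemma departure_split {t : ℝ → ℝ} (tc : Continuous t) (t0 : t 0 = 0) {x₁ x₂ : ℝ} (h10 : x₁ < 0) (h20 : 0 < x₂)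
    (hne : t x₁ ≠ t x₂) (a1 : ∀ z ∈ Ioo x₁ x₂, t z ≠ t x₁) (a2 : ∀ z ∈ Ioo x₁ x₂, t z ≠ t x₂) :
    (t x₁ < 0 ∧ 0 < t x₂ ∧ t '' Ioo x₁ x₂ = Ioo (t x₁) (t x₂)) ∨
      (t x₂ < 0 ∧ 0 < t x₁ ∧ t '' Ioo x₁ x₂ = Ioo (t x₂) (t x₁)) := by
  have h0 : (0 : ℝ) ∈ Ioo x₁ x₂ := ⟨h10, h20⟩
  have hoc := (isPreconnected_Ioo (a := x₁) (b := x₂)).image t tc.continuousOn |>.ordConnected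
  have m0 : (0 : ℝ) ∈ t '' Ioo x₁ x₂ := ⟨0, h0, t0⟩
  have hlt : x₁ < x₂ := h10.trans h20
  have up : ∀ P, 0 < P → (∀ z ∈ Ioo x₁ x₂, t z ≠ P) → ∀ z ∈ Icc x₁ x₂, t z ≤ P := by
    intro P hP hav
    have hb : ∀ z ∈ Ioo x₁ x₂, t z ≤ P := by
      intro z hz
      by_contra hcon
      obtain ⟨w, hw, ew⟩ := hoc.out m0 ⟨z, hz, rfl⟩ ⟨hP.le, (not_le.1 hcon).le⟩
      exact hav w hw ew
    have : closure (Ioo x₁ x₂) ⊆ {z | t z ≤ P} :=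
      closure_minimal hb (isClosed_le tc continuous_const)
    rw [closure_Ioo hlt.ne] at this
    exact this
  have down : ∀ P, P < 0 → (∀ z ∈ Ioo x₁ x₂, t z ≠ P) → ∀ z ∈ Icc x₁ x₂, P ≤ t z := by
    intro P hP hav
    have hb : ∀ z ∈ Ioo x₁ x₂, P ≤ t z := by
      intro z hz
      by_contra hcon
      obtain ⟨w, hw, ew⟩ := hoc.out ⟨z, hz, rfl⟩ m0 ⟨(not_le.1 hcon).le, hP.le⟩
      exact hav w hw ew
    have : closure (Ioo x₁ x₂) ⊆ {z | P ≤ t z} :=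
      closure_minimal hb (isClosed_le continuous_const tc)
    rw [closure_Ioo hlt.ne] at this
    exact this
  have m1 : x₁ ∈ Icc x₁ x₂ := ⟨le_rfl, hlt.le⟩
  have m2 : x₂ ∈ Icc x₁ x₂ := ⟨hlt.le, le_rfl⟩
  have n1 : t x₁ ≠ 0 := fun h => a1 0 h0 (by rw [t0, h])
  have n2 : t x₂ ≠ 0 := fun h => a2 0 h0 (by rw [t0, h])
  rcases lt_or_gt_of_ne n1 with p1 | p1 <;> rcases lt_or_gt_of_ne n2 with p2 | p2
  · exact absurd (le_antisymm (down _ p1 a1 x₂ m2) (down _ p2 a2 x₁ m1)) hne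
  · left
    refine ⟨p1, p2, Subset.antisymm ?_ fun w hw => ?_⟩
    · rintro _ ⟨z, hz, rfl⟩
      have hz' := Ioo_subset_Icc_self hz
      exact ⟨lt_of_le_of_ne (down _ p1 a1 z hz') (a1 z hz).symm, lt_of_le_of_ne (up _ p2 a2 z hz') (a2 z hz)⟩
    · obtain ⟨z, hz, ez⟩ := intermediate_value_Icc hlt.le tc.continuousOn (Ioo_subset_Icc_self hw)
      refine ⟨z, ⟨lt_of_le_of_ne hz.1 ?_, lt_of_le_of_ne hz.2 ?_⟩, ez⟩
      · intro h; rw [← h] at ez; exact hw.1.ne ez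
      · intro h; rw [h] at ez; exact hw.2.ne' ez
  · right
    refine ⟨p2, p1, Subset.antisymm ?_ fun w hw => ?_⟩
    · rintro _ ⟨z, hz, rfl⟩
      have hz' := Ioo_subset_Icc_self hz
      exact ⟨lt_of_le_of_ne (down _ p2 a2 z hz') (a2 z hz).symm, lt_of_le_of_ne (up _ p1 a1 z hz') (a1 z hz)⟩
    · obtain ⟨z, hz, ez⟩ := intermediate_value_Icc' hlt.le tc.continuousOn (Ioo_subset_Icc_self hw)
      refine ⟨z, ⟨lt_of_le_of_ne hz.1 ?_, lt_of_le_of_ne hz.2 ?_⟩, ez⟩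
      · intro h; rw [← h] at ez; exact hw.2.ne' ez
      · intro h; rw [h] at ez; exact hw.1.ne ez
  · exact absurd (le_antisymm (up _ p2 a2 x₁ m1) (up _ p1 a1 x₂ m2)) hne

lemma ext_congr {f g : ℝ → ℝ} (h : EqOn f g (Icc (-1) 1)) : ext f = ext g := by
  have e1 : contourFactor f = contourFactor g := contourFactor_congr fun x hx => h ⟨by linarith [hx.1], hx.2⟩
  have e2 : contourFactor (fun u => f (-u)) = contourFactor (fun u => g (-u)) := contourFactor_congr fun x hx =>
    h ⟨by linarith [hx.2], by linarith [hx.1]⟩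
  funext x
  simp only [ext, radialContourFactor, e1, e2]

lemma ext_eq_of_eqOn {f g : ℝ → ℝ} (h : EqOn (radialContourFactor f) (radialContourFactor g) (Icc (-1) 1)) :
    ext f = ext g := funext fun x => h (clamp_mem x)

lemma ext_apply {f : ℝ → ℝ} {x : ℝ} (hx : x ∈ Icc (-1 : ℝ) 1) : ext f x = radialContourFactor f x := by
  rw [ext, clamp_eq hx]

/-! ### From piecewise-linear maps to factors -/

namespace IsPLMap

variable {f : ℝ → ℝ}

lemma eqOn_clamp : EqOn f (f ∘ clamp) (Icc (-1) 1) := fun x hx => by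
  rw [Function.comp_apply, clamp_eq hx]

lemma clamp_cont (h : IsPLMap f) : Continuous (f ∘ clamp) :=
  h.piecewiseLinear.continuousOn.comp_continuous clamp_continuous clamp_mem

lemma clamp_range (h : IsPLMap f) (x : ℝ) : (f ∘ clamp) x ∈ Icc (-1 : ℝ) 1 := h.mapsTo (clamp_mem x)

lemma clamp_zero (h : IsPLMap f) : (f ∘ clamp) 0 = 0 := by
  rw [Function.comp_apply, clamp_eq (by simp), h.map_zero]

lemma germs (h : IsPLMap f) : RightGerms (f ∘ clamp) := h.piecewiseLinear.rightGerms.congr eqOn_clamp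

lemma germs_refl (h : IsPLMap f) : RightGerms (refl (f ∘ clamp)) :=
  h.piecewiseLinear.refl.rightGerms.congr fun x hx =>
    eqOn_clamp (show -x ∈ Icc (-1 : ℝ) 1 from ⟨by linarith [hx.2], by linarith [hx.1]⟩)

lemma ne_right (h : IsPLMap f) : ∃ x ∈ Icc (0 : ℝ) 1, (f ∘ clamp) x ≠ 0 := by
  obtain ⟨x, hx, y, hy, hne⟩ := h.nonconst_right
  by_contra hcon
  push Not at hcon
  have e : ∀ x ∈ Icc (0 : ℝ) 1, f x = 0 := fun x hx => by
    rw [eqOn_clamp (f := f) ⟨by linarith [hx.1], hx.2⟩, hcon x hx]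
  exact hne (by rw [e x hx, e y hy])

lemma ne_left (h : IsPLMap f) : ∃ x ∈ Icc (0 : ℝ) 1, RadialContour.refl (f ∘ clamp) x ≠ 0 := by
  obtain ⟨x, hx, y, hy, hne⟩ := h.nonconst_left
  by_contra hcon
  push Not at hcon
  have e : ∀ x ∈ Icc (-1 : ℝ) 0, f x = 0 := fun x hx => by
    have := hcon (-x) ⟨by linarith [hx.2], by linarith [hx.1]⟩
    rwa [RadialContour.refl, neg_neg, Function.comp_apply, clamp_eq ⟨hx.1, by linarith [hx.2]⟩] at this
  exact hne (by rw [e x hx, e y hy])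

lemma factor (h : IsPLMap f) : Factor (f ∘ clamp) (ext f) := by
  rw [ext_congr eqOn_clamp]
  exact factor_ext h.clamp_cont h.clamp_zero h.germs h.germs_refl h.ne_right h.ne_left

/-- The composition cannot vanish identically on a side: its contour factor would vanish there, but
it equals that of `f`, which does not. -/
lemma factor_comp {g : ℝ → ℝ} (hf : IsPLMap f) (hg : IsPLMap g)
    (e : EqOn (radialContourFactor f) (radialContourFactor (f ∘ g)) (Icc (-1) 1)) :
    Factor ((f ∘ clamp) ∘ (g ∘ clamp)) (ext f) := by
  set h : ℝ → ℝ := (f ∘ clamp) ∘ (g ∘ clamp) with hh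
  have e1 : ext f = ext h := by
    rw [ext_eq_of_eqOn e]
    apply ext_congr
    intro x hx
    simp only [hh, Function.comp_apply, clamp_eq hx, clamp_eq (hg.mapsTo hx)]
  have h0 : h 0 = 0 := by
    rw [hh, Function.comp_apply, hg.clamp_zero, hf.clamp_zero]
  have F := hf.factor
  rw [e1] at F ⊢
  refine factor_ext (hf.clamp_cont.comp hg.clamp_cont) h0
    (hf.germs.comp hf.germs_refl hg.germs fun x _ => hg.clamp_range x)
    (hf.germs.comp hf.germs_refl hg.germs_refl fun x _ => hg.clamp_range (-x)) ?_ ?_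
  · by_contra hcon
    push Not at hcon
    obtain ⟨x, hx, hne⟩ := F.ne_zero hf.ne_right
    exact hne (by rw [← ext_right hx, contourFactor_eq_zero hcon])
  · by_contra hcon
    push Not at hcon
    obtain ⟨x, hx, hne⟩ := F.mirror.ne_zero hf.ne_left
    exact hne (by rw [← ext_left h0 hx, contourFactor_eq_zero hcon])

end IsPLMap

lemma Factor.range {h T : ℝ → ℝ} (F : Factor h T) (hm : ∀ x, h x ∈ Icc (-1 : ℝ) 1) {x : ℝ}
    (hx : x ∈ Icc (-1 : ℝ) 1) : T x ∈ Icc (-1 : ℝ) 1 := by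
  have key : ∀ {h T : ℝ → ℝ}, Factor h T → (∀ x, h x ∈ Icc (-1 : ℝ) 1) → ∀ x ∈ Icc (0 : ℝ) 1,
      T x ∈ Icc (-1 : ℝ) 1 := by
    intro h T F hm x hx
    obtain ⟨y, hy, e⟩ := F.r2.image F.Z.c F.hc hx
    have : T x ∈ h '' Icc 0 y := e ▸ ⟨x, ⟨hx.1, le_rfl⟩, rfl⟩
    obtain ⟨z, hz, ez⟩ := this
    exact ez ▸ hm z
  rcases le_total 0 x with h0 | h0
  · exact key F hm x ⟨h0, hx.2⟩
  · have := key F.mirror (fun x => hm (-x)) (-x) ⟨by linarith, by linarith [hx.1]⟩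
    rwa [refl, neg_neg] at this

end RadialContour

theorem lemma4p1 (f₁ f₂ f₃ : ℝ → ℝ)
    (h₁ : RadialContour.IsPLMap f₁) (h₂ : RadialContour.IsPLMap f₂)
    (h₃ : RadialContour.IsPLMap f₃)
    (h₁₂ : Set.EqOn (RadialContour.radialContourFactor f₁)
      (RadialContour.radialContourFactor (f₁ ∘ f₂)) (Set.Icc (-1) 1))
    (h₂₃ : Set.EqOn (RadialContour.radialContourFactor f₂)
      (RadialContour.radialContourFactor (f₂ ∘ f₃)) (Set.Icc (-1) 1)) :
    ∃ s : ℝ → ℝ,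
      ContinuousOn s (Set.Icc (-1) 1) ∧
      Set.MapsTo s (Set.Icc (-1) 1) (Set.Icc (-1) 1) ∧
      s 0 = 0 ∧
      (∀ x ∈ Set.Icc (-1 : ℝ) 1, RadialContour.radialContourFactor f₁ (s x) = f₁ (f₂ x)) ∧
      ¬ ∃ x₁ x₂ : ℝ,
        RadialContour.IsNegRadialDeparture (s ∘ RadialContour.radialContourFactor f₃) x₁ x₂ := by
  open RadialContour in
  have F₁ := h₁.factor
  have F₁₂ := h₁.factor_comp h₂ h₁₂
  have F₂ := h₂.factor
  have F₂₃ := h₂.factor_comp h₃ h₂₃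
  have F₃ := h₃.factor
  obtain ⟨s₁, s₁c, s₁0, s₁m, s₁T⟩ := F₁.lift h₁.clamp_zero
  have hT : ∀ x, ext f₁ (s₁ ((f₂ ∘ clamp) x)) = ((f₁ ∘ clamp) ∘ (f₂ ∘ clamp)) x := fun x =>
    s₁T _ (h₂.clamp_range x)
  have hTc : ext f₁ ∘ (s₁ ∘ (f₂ ∘ clamp)) = (f₁ ∘ clamp) ∘ (f₂ ∘ clamp) := funext hT
  have C : Compat (ext f₁) (s₁ ∘ (f₂ ∘ clamp)) := by
    refine ⟨F₁.Z, s₁c.comp h₂.clamp_cont, ?_, fun x _ => s₁m _, ?_, ?_⟩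
    · rw [Function.comp_apply, h₂.clamp_zero, s₁0]
    · rw [hTc]; exact F₁₂.l1
    · rw [hTc]; exact F₁₂.r1
  obtain ⟨s, sc, s0, sm, sT, spos, sneg⟩ := C.exists_no_negDep
  refine ⟨s, sc.continuousOn, sm, s0, fun x hx => ?_, ?_⟩
  · rw [← ext_apply (sm x hx), sT x hx, Function.comp_apply, hT]
    simp only [Function.comp_apply, clamp_eq hx, clamp_eq (h₂.mapsTo hx)]
  · rintro ⟨x₁, x₂, g1, g10, g20, g2, himg⟩
    have hlt := g10.trans g20
    have tm : ∀ x ∈ Icc (-1 : ℝ) 1, ext f₃ x ∈ Icc (-1 : ℝ) 1 := fun x hx => F₃.range h₃.clamp_range hx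
    have m1 : x₁ ∈ Icc (-1 : ℝ) 1 := ⟨g1, by linarith⟩
    have m2 : x₂ ∈ Icc (-1 : ℝ) 1 := ⟨by linarith, g2⟩
    have hin : ∀ z ∈ Ioo x₁ x₂, s (ext f₃ z) ∈ Ioo (s (ext f₃ x₂)) (s (ext f₃ x₁)) := by
      intro z hz
      have : (s ∘ radialContourFactor f₃) z ∈ Ioo ((s ∘ radialContourFactor f₃) x₂)
          ((s ∘ radialContourFactor f₃) x₁) := himg ▸ ⟨z, hz, rfl⟩
      simp only [Function.comp_apply] at this
      rwa [← ext_apply m1, ← ext_apply m2, ← ext_apply ⟨by linarith [hz.1], by linarith [hz.2]⟩] at this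
    have h0 := hin 0 ⟨g10, g20⟩
    -- The strict inequalities for `s ∘ t` keep the inner factor away from its own end values, so it
    -- departs in one of the two orientations.
    rcases departure_split F₃.Z.c F₃.Z.z g10 g20 (fun h => by rw [h] at h0; linarith [h0.1, h0.2])
      (fun z hz h => by have := hin z hz; rw [h] at this; exact lt_irrefl _ this.2)
      (fun z hz h => by have := hin z hz; rw [h] at this; exact lt_irrefl _ this.1) with
      ⟨p1, p2, e⟩ | ⟨p2, p1, e⟩
    · refine sneg (ext f₃ x₁) (ext f₃ x₂) (tm x₁ m1).1 p1 p2 (tm x₂ m2).2 fun w hw => ?_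
      rw [← e] at hw
      obtain ⟨z, hz, rfl⟩ := hw
      exact hin z hz
    · refine spos _ _ (nwin_of_swap F₂ F₂₃ F₃ tm g1 g10 g20 g2 p2 p1 fun z hz => ?_) fun w hw => ?_
      · rw [← e]; exact ⟨z, hz, rfl⟩
      · rw [← e] at hw
        obtain ⟨z, hz, rfl⟩ := hw
        exact hin z hz
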